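/- Let $\mathbb K=\mathbb C$ (holomorphic category) or $\mathbb K=\mathbb R$ (smooth category), and let $G$ be the simply connected "Bianchi II" group: $G=\mathbb K^3$ with coordinates $(x,y,z)$ and left-invariant vector fields $L_1=e^{-y}\partial_x$, $L_2=\partial_y$, $L_3=\partial_z$, so that $[L_1,L_2]=L_1$, $[L_1,L_3]=[L_2,L_3]=0$. Let $U\subseteq\mathbb K$ be open and let $G$ act on $M=U\times G$ by left translations, with generators the right-invariant vector fields $R_1,R_2,R_3$. Let $Z,\tilde Z,W,\tilde W$ be a $G$-invariant frame on $M$ defining the conformal class of the (contravariant) metric $g=Z\odot\tilde Z-W\odot\tilde W$, with orientation $\mathrm{vol}(W,\tilde W,Z,\tilde Z)=1$, such that the $G$-orbits are nowhere null. The class is anti-self-dual (ASD) if the self-dual part of its Weyl tensor vanishes. In this case let $f_0,f_1$ be the functions on $M\times\mathbb{P}^1$, cubic in $\lambda$, for which $l=\tilde Z-\lambda W+f_0\partial_\lambda$ and $m=\tilde W-\lambda Z+f_1\partial_\lambda$ satisfy $[l,m]=0$ modulo $l,m$, and let $s=(d\lambda\wedge\mathrm{vol})(l,m,R_1,R_2,R_3)$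 be the twistor quartic, regarded as a section of $\mathcal O(4)$ over the $\lambda$-line. Suppose that at every point $s$ has a zero of order exactly four at some $\lambda_0\in\mathbb{KP}^1$. The $\alpha$-plane of $\lambda_0$ (spanned by $\tilde Z-\lambda_0W$, $\tilde W-\lambda_0Z$) meets the tangent space of the orbit in a null line; call the class general if this line is nowhere contained in $\langle L_1,L_3\rangle$ and nowhere orthogonal to $L_1$. (1) If the class is ASD, $s$ has such a quadruple zero and the class is general, then near every point of $U$ there are a new coordinate $t$ on $U$, a $G$-invariant vector field $\partial_t$ and $G$-invariant vector fields $L_1,L_2,L_3$ tangent to the orbits, linearly independent, commuting with $\partial_t$ and satisfying $[L_1,L_2]=L_1$, $[L_1,L_3]=[L_2,L_3]=0$, constants $c_1,c_2\in\mathbb K$ and a function $F(t)$ such that, up to a nowhere vanishing conformal factor and with the same orientation, the class is given by the tetrad $$\tilde Z=\partial_t+R,\qquad Z=\partial_t-R,\qquad W=-P,\qquad \tilde W=Q,$$ $$P=\tfrac12FL_1+L_2,\qquad Q=\left(\tfrac12(c_1^2+t)F+c_1F'+F''\right)L_1+(c_1^2+t)L_2+c_2L_3,\qquad R=\tfrac12(c_1F+F')L_1+c_1L_2+L_3,$$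 where $f=F'$ satisfies the Airy equation $f''+tf=0$; and for this tetrad $f_0=0$, $f_1=1$. (2) For every function $F$ on an open set and all constants $c_1,c_2$, with $P,Q,R$ as above, $\partial_t$ the coordinate field and $L_1,L_2,L_3$ the given basis, the tetrad satisfies $[l,m]=0$ modulo $l,m$ with $f_0=0$, $f_1=1$ if and only if $Q'=[Q,R]+P$, $R'=\tfrac12[Q,P]$, $P'=[R,P]$, and these equations hold if and only if $f=F'$ satisfies the Airy equation. (3) Conversely, if $f=F'$ satisfies the Airy equation and $F''+(c_1-\tfrac12c_2)F'$ vanishes nowhere (that is, $P,Q,R$ are linearly independent), then this tetrad is a $G$-invariant frame with nowhere null orbits, it is ASD, its functions are $f_0=0$, $f_1=1$, its twistor quartic has a zero of order exactly four at $\lambda=\infty$, and it is general. -/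

import Mathlib

open scoped ContDiff

noncomputable section

namespace BianchiAiry

/-- The coordinate space of `𝕜 × G`, with coordinates `(t, x, y, z)`; here `(x, y, z)` are global
coordinates on the three-dimensional group `G`. -/
abbrev Pt (𝕜 : Type*) : Type _ := Fin 4 → 𝕜

/-- Vector fields on (open subsets of) the coordinate space. -/
abbrev VField (𝕜 : Type*) : Type _ := Pt 𝕜 → Pt 𝕜

/-- The cohomogeneity-one four-manifold `U × G`. -/
def cyl {𝕜 : Type*} (U : Set 𝕜) : Set (Pt 𝕜) := {p | p 0 ∈ U}

/-! ### The group, its action, and its invariant vector fields -/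

/-- The multiplication of `G = 𝕜³`:
`(a₁, a₂, a₃) · (x, y, z) = (a₁ + e^{-a₂} x, a₂ + y, a₃ + z)`. -/
def gmul {𝕜 : Type*} [RCLike 𝕜] (a b : Fin 3 → 𝕜) : Fin 3 → 𝕜 :=
  ![a 0 + NormedSpace.exp (-(a 1)) * b 0, a 1 + b 1, a 2 + b 2]

/-- The action of `G` on `𝕜 × G` by left translations of the second factor. -/
def act {𝕜 : Type*} [RCLike 𝕜] (a : Fin 3 → 𝕜) (p : Pt 𝕜) : Pt 𝕜 :=
  Fin.cons (p 0) (gmul a (Fin.tail p))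

/-- `X` is invariant, on `U × G`, under all left translations. -/
def IsInvariant {𝕜 : Type*} [RCLike 𝕜] (U : Set 𝕜) (X : VField 𝕜) : Prop :=
  ∀ a : Fin 3 → 𝕜, ∀ p ∈ cyl U, fderiv 𝕜 (act a) p (X p) = X (act a p)

/-- The basis of left-invariant vector fields
`L₁ = e^{-y} ∂_x`, `L₂ = ∂_y`, `L₃ = ∂_z` (numbered from `0`). -/
def leftField {𝕜 : Type*} [RCLike 𝕜] : Fin 3 → VField 𝕜 :=
  ![fun p => ![0, NormedSpace.exp (-(p 2)), 0, 0],
    fun _ => ![0, 0, 1, 0],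
    fun _ => ![0, 0, 0, 1]]

/-- The right-invariant vector fields `∂_x`, `∂_y - x ∂_x`, `∂_z`, which generate the action. -/
def rightField {𝕜 : Type*} [RCLike 𝕜] : Fin 3 → VField 𝕜 :=
  ![fun _ => ![0, 1, 0, 0],
    fun p => ![0, -(p 1), 1, 0],
    fun _ => ![0, 0, 0, 1]]

/-- The vector field `∂_t`. -/
def dtField {𝕜 : Type*} [RCLike 𝕜] : VField 𝕜 := fun _ => ![1, 0, 0, 0]

/-! ### Null tetrads and the metrics they define -/

/-- Four vector fields `W`, `W̃`, `Z`, `Z̃`. -/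
structure Tetrad (𝕜 : Type*) where
  W : VField 𝕜
  Wt : VField 𝕜
  Z : VField 𝕜
  Zt : VField 𝕜

namespace Tetrad

variable {𝕜 : Type*} [RCLike 𝕜]

/-- The frame `(W, W̃, Z, Z̃)`; the orientation is the one with `vol (W, W̃, Z, Z̃) = 1`. -/
def frame (e : Tetrad 𝕜) : Fin 4 → VField 𝕜 := ![e.W, e.Wt, e.Z, e.Zt]

/-- The matrix whose columns are the frame vectors at `p`. -/
def frameMatrix (e : Tetrad 𝕜) (p : Pt 𝕜) : Matrix (Fin 4) (Fin 4) 𝕜 :=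
  Matrix.of fun i a => e.frame a p i

/-- The components of a tangent vector at `p` with respect to the frame. -/
def coords (e : Tetrad 𝕜) (p : Pt 𝕜) (v : Pt 𝕜) : Fin 4 → 𝕜 :=
  Matrix.mulVec (e.frameMatrix p)⁻¹ v

/-- The contravariant metric `g = Z ⊙ Z̃ - W ⊙ W̃`, where `X ⊙ Y = X ⊗ Y + Y ⊗ X`. -/
def cometric (e : Tetrad 𝕜) (p : Pt 𝕜) (ξ η : Module.Dual 𝕜 (Pt 𝕜)) : 𝕜 :=
  (ξ (e.Z p) * η (e.Zt p) + ξ (e.Zt p) * η (e.Z p))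
    - (ξ (e.W p) * η (e.Wt p) + ξ (e.Wt p) * η (e.W p))

end Tetrad

/-- The components of the metric in the frame `(W, W̃, Z, Z̃)`: `g(Z, Z̃) = 1`, `g(W, W̃) = -1`,
and all other products vanish. This matrix is its own inverse. -/
def eta (𝕜 : Type*) [RCLike 𝕜] : Matrix (Fin 4) (Fin 4) 𝕜 :=
  !![0, -1, 0, 0; -1, 0, 0, 0; 0, 0, 0, 1; 0, 0, 1, 0]

namespace Tetrad

variable {𝕜 : Type*} [RCLike 𝕜]

/-- The (covariant) metric at `p`. -/
def metric (e : Tetrad 𝕜) (p u v : Pt 𝕜) : 𝕜 :=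
  ∑ a, ∑ b, e.coords p u a * eta 𝕜 a b * e.coords p v b

/-! ### Curvature, computed in the frame -/

/-- Structure functions: `[e_a, e_b] = ∑ c, C_{ab}^c e_c`. -/
def structFn (e : Tetrad 𝕜) (a b c : Fin 4) (p : Pt 𝕜) : 𝕜 :=
  e.coords p (VectorField.lieBracket 𝕜 (e.frame a) (e.frame b) p) c

/-- `g([e_a, e_b], e_c)`. -/
def structLow (e : Tetrad 𝕜) (a b c : Fin 4) (p : Pt 𝕜) : 𝕜 :=
  ∑ d, e.structFn a b d p * eta 𝕜 d c

/-- `g(∇_{e_a} e_b, e_c)` for the Levi-Civita connection, by Koszul's formula (the products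
`g(e_a, e_b)` are constant). -/
def connLow (e : Tetrad 𝕜) (a b c : Fin 4) (p : Pt 𝕜) : 𝕜 :=
  (e.structLow a b c p - e.structLow b c a p + e.structLow c a b p) / 2

/-- Connection coefficients: `∇_{e_a} e_b = ∑ d, Γ_{ab}^d e_d`. -/
def conn (e : Tetrad 𝕜) (a b d : Fin 4) (p : Pt 𝕜) : 𝕜 :=
  ∑ c, e.connLow a b c p * eta 𝕜 c d

/-- The derivative of a function along the frame vector field `e_a`. -/
def frameDeriv (e : Tetrad 𝕜) (a : Fin 4) (φ : Pt 𝕜 → 𝕜) (p : Pt 𝕜) : 𝕜 :=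
  fderiv 𝕜 φ p (e.frame a p)

/-- The component along `e_d` of
`R(e_a, e_b) e_c = ∇_{e_a} ∇_{e_b} e_c - ∇_{e_b} ∇_{e_a} e_c - ∇_{[e_a, e_b]} e_c`. -/
def riem (e : Tetrad 𝕜) (a b c d : Fin 4) (p : Pt 𝕜) : 𝕜 :=
  e.frameDeriv a (e.conn b c d) p - e.frameDeriv b (e.conn a c d) p
    + ∑ f, (e.conn b c f p * e.conn a f d p - e.conn a c f p * e.conn b f d p)
    - ∑ f, e.structFn a b f p * e.conn f c d p

/-- `g(R(e_a, e_b) e_c, e_d)`. -/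
def riemLow (e : Tetrad 𝕜) (a b c d : Fin 4) (p : Pt 𝕜) : 𝕜 :=
  ∑ f, e.riem a b c f p * eta 𝕜 f d

/-- The Ricci tensor: the trace of `X ↦ R(X, e_b) e_c`. -/
def ricci (e : Tetrad 𝕜) (b c : Fin 4) (p : Pt 𝕜) : 𝕜 :=
  ∑ a, e.riem a b c a p

/-- The scalar curvature. -/
def scal (e : Tetrad 𝕜) (p : Pt 𝕜) : 𝕜 :=
  ∑ b, ∑ c, eta 𝕜 b c * e.ricci b c p

/-- The Schouten tensor in dimension four. -/
def schouten (e : Tetrad 𝕜) (b c : Fin 4) (p : Pt 𝕜) : 𝕜 :=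
  (e.ricci b c p - e.scal p / 6 * eta 𝕜 b c) / 2

/-- The Weyl tensor, with the index convention of `riemLow`. -/
def weyl (e : Tetrad 𝕜) (a b c d : Fin 4) (p : Pt 𝕜) : 𝕜 :=
  e.riemLow a b c d p
    - (eta 𝕜 a d * e.schouten b c p + eta 𝕜 b c * e.schouten a d p
      - eta 𝕜 a c * e.schouten b d p - eta 𝕜 b d * e.schouten a c p)

end Tetrad

/-- The components `vol (e_a, e_b, e_c, e_d)` of the volume form in the frame `(W, W̃, Z, Z̃)`. -/
def eps (𝕜 : Type*) [RCLike 𝕜] (a b c d : Fin 4) : 𝕜 :=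
  Matrix.det (Matrix.of fun i j : Fin 4 => if ![a, b, c, d] i = j then (1 : 𝕜) else 0)

namespace Tetrad

variable {𝕜 : Type*} [RCLike 𝕜]

/-- The self-dual part `(C + *C) / 2` of the Weyl tensor `C`, where
`(*C)_{abcd} = 1/2 ε_{ab}^{fh} C_{fhcd}`. -/
def weylSD (e : Tetrad 𝕜) (a b c d : Fin 4) (p : Pt 𝕜) : 𝕜 :=
  (e.weyl a b c d p
    + (∑ m, ∑ n, ∑ f, ∑ h,
        eps 𝕜 a b m n * eta 𝕜 m f * eta 𝕜 n h * e.weyl f h c d p) / 2) / 2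

/-- The conformal structure of the tetrad is anti-self-dual on `M`: the self-dual part of its Weyl
tensor vanishes. -/
def IsASD (e : Tetrad 𝕜) (M : Set (Pt 𝕜)) : Prop :=
  ∀ p ∈ M, ∀ a b c d : Fin 4, e.weylSD a b c d p = 0

/-- `e` and `e'` define the same oriented conformal structure on `M`: `g' = Ω g` for a nowhere
vanishing function `Ω`, and the orientations agree. -/
def SameConformal (e e' : Tetrad 𝕜) (M : Set (Pt 𝕜)) : Prop :=
  ∃ Ω : Pt 𝕜 → 𝕜, ContDiffOn 𝕜 ∞ Ω M ∧ ∀ p ∈ M, Ω p ≠ 0 ∧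
    (∀ ξ η : Module.Dual 𝕜 (Pt 𝕜), e'.cometric p ξ η = Ω p * e.cometric p ξ η) ∧
    (e'.frameMatrix p).det = Ω p ^ 2 * (e.frameMatrix p).det

/-! ### The twistor distribution and the twistor quartic -/

/-- `l = Z̃ - s W + f₀ ∂_s` on `M × 𝕜`, where `s` is the twistor coordinate (an affine coordinate
on the projective line) and `f₀ = ∑ i ≤ 3, f i * s ^ i` is cubic in `s`. -/
def laxL (e : Tetrad 𝕜) (f : Fin 4 → Pt 𝕜 → 𝕜) (q : Pt 𝕜 × 𝕜) : Pt 𝕜 × 𝕜 :=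
  (e.Zt q.1 - q.2 • e.W q.1, ∑ i : Fin 4, f i q.1 * q.2 ^ (i : ℕ))

/-- `m = W̃ - s Z + f₁ ∂_s`, with `f₁` cubic in `s`. -/
def laxM (e : Tetrad 𝕜) (f : Fin 4 → Pt 𝕜 → 𝕜) (q : Pt 𝕜 × 𝕜) : Pt 𝕜 × 𝕜 :=
  (e.Wt q.1 - q.2 • e.Z q.1, ∑ i : Fin 4, f i q.1 * q.2 ^ (i : ℕ))

/-- The coefficients of the constant function `c`, viewed as a cubic in the twistor coordinate. -/
def constCubic (c : 𝕜) : Fin 4 → Pt 𝕜 → 𝕜 := fun i _ => if i = 0 then c else 0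

/-- `f₀`, `f₁` (given by their coefficients) make the distribution `⟨l, m⟩` Frobenius integrable:
`[l, m] = 0` modulo `l` and `m`. -/
def IsLaxPair (e : Tetrad 𝕜) (M : Set (Pt 𝕜)) (f₀ f₁ : Fin 4 → Pt 𝕜 → 𝕜) : Prop :=
  (∀ i, ContDiffOn 𝕜 ∞ (f₀ i) M ∧ ContDiffOn 𝕜 ∞ (f₁ i) M) ∧
  ∀ q : Pt 𝕜 × 𝕜, q.1 ∈ M →
    VectorField.lieBracket 𝕜 (e.laxL f₀) (e.laxM f₁) q ∈
      Submodule.span 𝕜 {e.laxL f₀ q, e.laxM f₁ q}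

/-- The twistor quartic `(ds ∧ vol)(l, m, R₁, R₂, R₃)`, where `vol (W, W̃, Z, Z̃) = 1` and the `R_j`
are the right-invariant vector fields. -/
def twistorQuartic (e : Tetrad 𝕜) (f₀ f₁ : Fin 4 → Pt 𝕜 → 𝕜) (p : Pt 𝕜) (s : 𝕜) : 𝕜 :=
  let v : Fin 5 → Pt 𝕜 × 𝕜 :=
    ![e.laxL f₀ (p, s), e.laxM f₁ (p, s), (rightField 0 p, 0), (rightField 1 p, 0),
      (rightField 2 p, 0)]
  Matrix.det (Matrix.of fun i j : Fin 5 =>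
    (Fin.cons (v i).2 (e.coords p (v i).1) : Fin 5 → 𝕜) j)

/-- At `p` the twistor quartic, as a section of `O(4)` over the projective line, has a zero of
order (exactly) four at the point `s = b / a` (the point at infinity if `a = 0`). -/
def QuadrupleZeroAt (e : Tetrad 𝕜) (f₀ f₁ : Fin 4 → Pt 𝕜 → 𝕜) (p : Pt 𝕜) (a b : 𝕜) : Prop :=
  (a ≠ 0 ∨ b ≠ 0) ∧ ∃ k : 𝕜, k ≠ 0 ∧ ∀ s : 𝕜, e.twistorQuartic f₀ f₁ p s = k * (a * s - b) ^ 4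

/-- General position at `p`, with respect to the point `s = b / a` of the projective line. The
`α`-plane of this point meets the tangent space of the `G`-orbit in a null line; a vector `X`
spanning it is not tangent to the orbits of the nilradical `⟨L₁, L₃⟩`, and it is not orthogonal
to the derived direction `L₁`. -/
def GenericAt (e : Tetrad 𝕜) (p : Pt 𝕜) (a b : 𝕜) : Prop :=
  ∀ X ∈ Submodule.span 𝕜 {a • e.Zt p - b • e.W p, a • e.Wt p - b • e.Z p},
    X 0 = 0 → X ≠ 0 →
      X ∉ Submodule.span 𝕜 {leftField 0 p, leftField 2 p} ∧ e.metric p X (leftField 0 p) ≠ 0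

/-- `e` is a null tetrad of `G`-invariant vector fields on `U × G`, and the `G`-orbits are nowhere
null for the metric it defines. -/
structure IsInvariantTetrad (e : Tetrad 𝕜) (U : Set 𝕜) : Prop where
  smooth : ∀ a, ContDiffOn 𝕜 ∞ (e.frame a) (cyl U)
  indep : ∀ p ∈ cyl U, LinearIndependent 𝕜 fun a => e.frame a p
  invariant : ∀ a, IsInvariant U (e.frame a)
  nonnull : ∀ p ∈ cyl U, e.cometric p (LinearMap.proj 0) (LinearMap.proj 0) ≠ 0

end Tetrad

/-! ### The normal form -/

/-- `τ` is a coordinate on `V`, the vector fields `L₁, L₂, L₃` on `V × G` are left-invariant,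
tangent to `G` and satisfy `[L₁, L₂] = L₁`, `[L₁, L₃] = [L₂, L₃] = 0`, and `T` is the
vector field `∂_τ` for a product structure in which the `L_j` do not depend on `τ`. -/
structure IsAdapted {𝕜 : Type*} [RCLike 𝕜] (V : Set 𝕜) (τ : 𝕜 → 𝕜) (T : VField 𝕜)
    (L : Fin 3 → VField 𝕜) : Prop where
  smooth_τ : ContDiffOn 𝕜 ∞ τ V
  smooth_T : ContDiffOn 𝕜 ∞ T (cyl V)
  smooth_L : ∀ j, ContDiffOn 𝕜 ∞ (L j) (cyl V)
  invariant_T : IsInvariant V T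
  invariant_L : ∀ j, IsInvariant V (L j)
  indep : ∀ p ∈ cyl V, LinearIndependent 𝕜 fun j => L j p
  dτ_T : ∀ p ∈ cyl V, deriv τ (p 0) * T p 0 = 1
  dτ_L : ∀ p ∈ cyl V, ∀ j, L j p 0 = 0
  comm : ∀ p ∈ cyl V, ∀ j, VectorField.lieBracket 𝕜 T (L j) p = 0
  bracket₁₂ : ∀ p ∈ cyl V, VectorField.lieBracket 𝕜 (L 0) (L 1) p = L 0 p
  bracket₁₃ : ∀ p ∈ cyl V, VectorField.lieBracket 𝕜 (L 0) (L 2) p = 0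
  bracket₂₃ : ∀ p ∈ cyl V, VectorField.lieBracket 𝕜 (L 1) (L 2) p = 0

section NormalForm

variable {𝕜 : Type*} [RCLike 𝕜]

/-- `P = 1/2 F L₁ + L₂`. -/
def fieldP (F τ : 𝕜 → 𝕜) (L : Fin 3 → VField 𝕜) : VField 𝕜 := fun p =>
  (1 / 2 * F (τ (p 0))) • L 0 p + L 1 p

/-- `Q = (1/2 (c₁² + t) F + c₁ F' + F'') L₁ + (c₁² + t) L₂ + c₂ L₃`. -/
def fieldQ (c₁ c₂ : 𝕜) (F τ : 𝕜 → 𝕜) (L : Fin 3 → VField 𝕜) : VField 𝕜 := fun p =>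
  (1 / 2 * (c₁ ^ 2 + τ (p 0)) * F (τ (p 0)) + c₁ * deriv F (τ (p 0))
      + deriv (deriv F) (τ (p 0))) • L 0 p
    + (c₁ ^ 2 + τ (p 0)) • L 1 p + c₂ • L 2 p

/-- `R = 1/2 (c₁ F + F') L₁ + c₁ L₂ + L₃`. -/
def fieldR (c₁ : 𝕜) (F τ : 𝕜 → 𝕜) (L : Fin 3 → VField 𝕜) : VField 𝕜 := fun p =>
  (1 / 2 * (c₁ * F (τ (p 0)) + deriv F (τ (p 0)))) • L 0 p + c₁ • L 1 p + L 2 p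

/-- The tetrad `Z̃ = T + R`, `Z = T - R`, `W = -P`, `W̃ = Q`. -/
def tetradOf (T P Q R : VField 𝕜) : Tetrad 𝕜 where
  W := -P
  Wt := Q
  Z := T - R
  Zt := T + R

/-- The tetrad `Z̃ = T + R`, `Z = T - R`, `W = -P`, `W̃ = Q` for the above `P`, `Q`, `R`. -/
def normalTetrad (c₁ c₂ : 𝕜) (F τ : 𝕜 → 𝕜) (T : VField 𝕜) (L : Fin 3 → VField 𝕜) : Tetrad 𝕜 :=
  tetradOf T (fieldP F τ L) (fieldQ c₁ c₂ F τ L) (fieldR c₁ F τ L)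

/-- The reduced equations `Q' = [Q, R] + P`, `R' = 1/2 [Q, P]`, `P' = [R, P]` on `U × G`, where
the prime is the derivative with respect to `t`. -/
def ReducedASD (U : Set 𝕜) (P Q R : VField 𝕜) : Prop :=
  ∀ p ∈ cyl U,
    fderiv 𝕜 Q p (dtField p) = VectorField.lieBracket 𝕜 Q R p + P p ∧
    fderiv 𝕜 R p (dtField p) = (1 / 2 : 𝕜) • VectorField.lieBracket 𝕜 Q P p ∧
    fderiv 𝕜 P p (dtField p) = VectorField.lieBracket 𝕜 R P p

/-- The Airy equation `f'' + t f = 0` on `U`. -/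
def IsAiryOn (f : 𝕜 → 𝕜) (U : Set 𝕜) : Prop :=
  ∀ t ∈ U, deriv (deriv f) t + t * f t = 0

end NormalForm

end BianchiAiry

end

/-!
An invariant vector field on `U × G` is given by four functions of `t`, its components in the basis
`∂_t, L₁, L₂, L₃` (`invField`, `IsInvariant.eq_invField`), and brackets of invariant fields become
algebraic in these components and their derivatives (`lieBracket_invField`). Curvature, twistor
distribution and quartic of an invariant tetrad are therefore expressions in the structure functions
`structC` and their derivatives.

*Anti-self-duality and integrability.* In `[l, m] = α l + β m` the components along `M` determine
`f₀`, `f₁`, `α`, `β` from the components of `[Z̃ - s W, W̃ - s Z]`; what remains is the `∂_s`-component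
`vertDefect`. The identity `vertDefect_eq` says that it is `-g(R(l, m) l, m)`, the quartic in `s` whose
five coefficients are the components of the self-dual Weyl tensor. So an anti-self-dual class has a
Lax pair (`Tetrad.HasComponents.isLaxPair`); conversely, by the Jacobi and Bianchi identities, the
vanishing of `vertDefect` implies anti-self-duality (`Tetrad.HasComponents.isASD_of_vertDefect`).

*The normal form.* For a tetrad `W = -P`, `W̃ = Q`, `Z = T - R`, `Z̃ = T + R` with `P`, `Q`, `R` tangent
to the orbits, `f₀ = 0`, `f₁ = 1` give a Lax pair if and only if the reduced equations hold
(`isLaxPair_constCubic_iff`), and for the fields of the normal form these come down to the Airy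
equation (`reducedEqs_iff_isAiryOn`). They make `[Z̃ - s W, W̃ - s Z]` equal to `P`, so that
`vertDefect` vanishes trivially and the class is anti-self-dual (`ReducedEqs.isASD`).

*Existence.* Since the orbits are not null, a change of frame which does not move the parameter `s`
brings any invariant tetrad into the form above, up to a conformal factor (`splitFrame`); its
anti-self-duality equations are the system `RedSys`, whose quartic is a multiple of the twistor
quartic (`quartic_split`). If the quadruple zero is at the origin, the inversion `s ↦ -1 / s` moves it
away (`RedSys.inversion`); a rotation of the frame then moves it to infinity
(`RedSys.exists_inftySys`), and the vertical equation says precisely that the quartic remains there.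
Rescaling, together with the remaining rotations, which fix infinity, normalizes the equations to the
reduced ones (`InftySys.exists_reducedEqs`); this amounts to solving two linear differential
equations. Finally the components of the reduced equations are integrated
(`ReducedEqs.exists_normalForm`): all components along `L₂`, `L₃` are constant or affine functions of a
coordinate `τ`, the basis is chosen so as to commute with `T`, and twice the component of `P` along
`L₁` is the function `F`. General position is used twice: the null line outside `⟨L₁, L₃⟩` makes it possible to
normalize the `L₂`-component of `P`, and the null line not orthogonal to `L₁` makes the `L₃`-component
of the new basis nonzero (`isGeneral_split`).
-/

noncomputable section

namespace BianchiAiry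

/-! ### Invariant vector fields in components -/

section

variable {𝕜 : Type*} [RCLike 𝕜]

/-- The tangent vector at `p` with components `v` in the basis `∂_t, L₁, L₂, L₃` of invariant
vector fields. -/
def lift (p : Pt 𝕜) : (Fin 4 → 𝕜) →ₗ[𝕜] Pt 𝕜 where
  toFun v := ![v 0, NormedSpace.exp (-(p 2)) * v 1, v 2, v 3]
  map_add' u v := by ext i; fin_cases i <;> simp [mul_add]
  map_smul' c v := by ext i; fin_cases i <;> simp [mul_left_comm]

theorem lift_apply (p : Pt 𝕜) (v : Fin 4 → 𝕜) :
    lift p v = ![v 0, NormedSpace.exp (-(p 2)) * v 1, v 2, v 3] := rfl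

theorem exp_ne_zero' (a : 𝕜) : NormedSpace.exp a ≠ 0 := (NormedSpace.isUnit_exp a).ne_zero

theorem lift_injective (p : Pt 𝕜) : Function.Injective (lift p) := by
  intro u v h
  have h0 := congrFun h 0
  have h1 := congrFun h 1
  have h2 := congrFun h 2
  have h3 := congrFun h 3
  simp [lift_apply, exp_ne_zero'] at h0 h1 h2 h3
  ext i; fin_cases i <;> assumption

/-- The invariant vector field whose components in the basis `∂_t, L₁, L₂, L₃` are the functions
`x` of `t`. -/
def invField (x : 𝕜 → Fin 4 → 𝕜) : VField 𝕜 := fun p => lift p (x (p 0))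

theorem dtField_eq (p : Pt 𝕜) : dtField p = lift p ![1, 0, 0, 0] := by
  ext i; fin_cases i <;> simp [dtField, lift_apply]

theorem leftField_zero_eq (p : Pt 𝕜) : leftField 0 p = lift p ![0, 1, 0, 0] := by
  ext i; fin_cases i <;> simp [leftField, lift_apply]

theorem leftField_one_eq (p : Pt 𝕜) : leftField 1 p = lift p ![0, 0, 1, 0] := by
  ext i; fin_cases i <;> simp [leftField, lift_apply]

theorem leftField_two_eq (p : Pt 𝕜) : leftField 2 p = lift p ![0, 0, 0, 1] := by
  ext i; fin_cases i <;> simp [leftField, lift_apply]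

/-- The bracket of two invariant vector fields at a fixed `t`, in terms of their components `x`,
`y` and the derivatives `dx`, `dy` of these. Index `0` is the `∂_t`-component; the only bracket of
the basis fields that does not vanish is `[L₁, L₂] = L₁`. -/
def algBr (x dx y dy : Fin 4 → 𝕜) : Fin 4 → 𝕜 :=
  ![x 0 * dy 0 - y 0 * dx 0, x 0 * dy 1 - y 0 * dx 1 + (x 1 * y 2 - x 2 * y 1),
    x 0 * dy 2 - y 0 * dx 2, x 0 * dy 3 - y 0 * dx 3]

/-- The components of the bracket of two invariant vector fields. -/
def br (x y : 𝕜 → Fin 4 → 𝕜) (t : 𝕜) : Fin 4 → 𝕜 := algBr (x t) (deriv x t) (y t) (deriv y t)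

theorem hasFDerivAt_invField {x : 𝕜 → Fin 4 → 𝕜} {p : Pt 𝕜} (hx : DifferentiableAt 𝕜 x (p 0)) :
    ∃ A : Pt 𝕜 →L[𝕜] Pt 𝕜, HasFDerivAt (invField x) A p ∧
      ∀ v, A v = lift p ![v 0 * deriv x (p 0) 0, v 0 * deriv x (p 0) 1 - v 2 * x (p 0) 1,
        v 0 * deriv x (p 0) 2, v 0 * deriv x (p 0) 3] := by
  have hx' : ∀ i, HasFDerivAt (fun q : Pt 𝕜 => x (q 0) i)
      (deriv x (p 0) i • (ContinuousLinearMap.proj 0 : Pt 𝕜 →L[𝕜] 𝕜)) p := fun i => by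
    have h1 : HasDerivAt (fun t => x t i) (deriv x (p 0) i) (p 0) :=
      (hasDerivAt_pi.1 hx.hasDerivAt) i
    exact HasDerivAt.comp_hasFDerivAt (f := fun q : Pt 𝕜 => q 0) p h1
      (ContinuousLinearMap.proj (R := 𝕜) (φ := fun _ : Fin 4 => 𝕜) 0).hasFDerivAt
  have he : HasFDerivAt (fun q : Pt 𝕜 => NormedSpace.exp (-(q 2)))
      (NormedSpace.exp (-(p 2)) • -(ContinuousLinearMap.proj 2 : Pt 𝕜 →L[𝕜] 𝕜)) p :=
    HasDerivAt.comp_hasFDerivAt (f := fun q : Pt 𝕜 => -(q 2)) p (hasDerivAt_exp (𝕂 := 𝕜) (x := -(p 2)))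
      (ContinuousLinearMap.proj (R := 𝕜) (φ := fun _ : Fin 4 => 𝕜) 2).hasFDerivAt.neg
  have hc : ∀ i, ∃ A : Pt 𝕜 →L[𝕜] 𝕜, HasFDerivAt (fun q => invField x q i) A p ∧
      ∀ v, A v = lift p ![v 0 * deriv x (p 0) 0, v 0 * deriv x (p 0) 1 - v 2 * x (p 0) 1,
        v 0 * deriv x (p 0) 2, v 0 * deriv x (p 0) 3] i := by
    intro i
    fin_cases i
    · exact ⟨_, hx' 0, fun v => by simp [lift_apply, mul_comm]⟩
    · exact ⟨_, he.mul (hx' 1), fun v => by simp [lift_apply]; ring⟩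
    · exact ⟨_, hx' 2, fun v => by simp [lift_apply, mul_comm]⟩
    · exact ⟨_, hx' 3, fun v => by simp [lift_apply, mul_comm]⟩
  choose A hA hA' using hc
  exact ⟨ContinuousLinearMap.pi A, hasFDerivAt_pi.2 hA, fun v => funext fun i => hA' i v⟩

theorem lieBracket_invField {x y : 𝕜 → Fin 4 → 𝕜} {p : Pt 𝕜} (hx : DifferentiableAt 𝕜 x (p 0))
    (hy : DifferentiableAt 𝕜 y (p 0)) :
    VectorField.lieBracket 𝕜 (invField x) (invField y) p = lift p (br x y (p 0)) := by
  obtain ⟨A, hA, hA'⟩ := hasFDerivAt_invField hx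
  obtain ⟨B, hB, hB'⟩ := hasFDerivAt_invField hy
  rw [VectorField.lieBracket, hA.fderiv, hB.fderiv, hA', hB', ← map_sub]
  congr 1
  ext i
  fin_cases i <;> simp [br, algBr, invField, lift_apply]
  ring

end

/-! ### Invariance and the lift to the twistor space -/

section

variable {𝕜 : Type*} [RCLike 𝕜]

theorem isOpen_cyl {U : Set 𝕜} (hU : IsOpen U) : IsOpen (cyl U) :=
  hU.preimage (continuous_apply 0)

theorem hasFDerivAt_act (a : Fin 3 → 𝕜) (p : Pt 𝕜) :
    ∃ A : Pt 𝕜 →L[𝕜] Pt 𝕜, HasFDerivAt (act a) A p ∧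
      ∀ v, A v = ![v 0, NormedSpace.exp (-(a 1)) * v 1, v 2, v 3] := by
  have hp : ∀ i, HasFDerivAt (fun q : Pt 𝕜 => q i)
      (ContinuousLinearMap.proj i : Pt 𝕜 →L[𝕜] 𝕜) p := fun i =>
    (ContinuousLinearMap.proj (R := 𝕜) (φ := fun _ : Fin 4 => 𝕜) i).hasFDerivAt
  have hc : ∀ i, ∃ A : Pt 𝕜 →L[𝕜] 𝕜, HasFDerivAt (fun q => act a q i) A p ∧
      ∀ v, A v = (![v 0, NormedSpace.exp (-(a 1)) * v 1, v 2, v 3] : Pt 𝕜) i := by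
    intro i
    fin_cases i
    · exact ⟨_, hp 0, fun v => by simp⟩
    · exact ⟨_, ((hp 1).const_mul (NormedSpace.exp (-(a 1)))).const_add (a 0), fun v => by simp⟩
    · exact ⟨_, (hp 2).const_add (a 1), fun v => by simp⟩
    · exact ⟨_, (hp 3).const_add (a 2), fun v => by simp⟩
  choose A hA hA' using hc
  exact ⟨ContinuousLinearMap.pi A, hasFDerivAt_pi.2 hA, fun v => funext fun i => hA' i v⟩

theorem isInvariant_invField (U : Set 𝕜) (x : 𝕜 → Fin 4 → 𝕜) : IsInvariant U (invField x) := by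
  intro a p _
  obtain ⟨A, hA, hA'⟩ := hasFDerivAt_act a p
  rw [hA.fderiv, hA']
  have h : NormedSpace.exp (-(a 1 + p 2)) = NormedSpace.exp (-(a 1)) * NormedSpace.exp (-(p 2)) := by
    rw [neg_add, NormedSpace.exp_add]
  rw [neg_add_rev] at h
  ext i
  fin_cases i <;> simp [invField, lift_apply, act, gmul, Fin.tail, h, mul_assoc]

/-- An invariant field is determined by its values at the unit element of the group, where the
basis `∂_t, L₁, L₂, L₃` is the coordinate basis. -/
theorem IsInvariant.eq_invField {U : Set 𝕜} {X : VField 𝕜} (hX : IsInvariant U X) :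
    ∀ p ∈ cyl U, X p = invField (fun t => X ![t, 0, 0, 0]) p := by
  intro p hp
  have h := hX ![p 1, p 2, p 3] ![p 0, 0, 0, 0] hp
  obtain ⟨A, hA, hA'⟩ := hasFDerivAt_act (𝕜 := 𝕜) ![p 1, p 2, p 3] ![p 0, 0, 0, 0]
  have hact : act ![p 1, p 2, p 3] ![p 0, 0, 0, 0] = p := by
    ext i
    fin_cases i <;> simp [act, gmul, Fin.tail]
  rw [hA.fderiv, hA', hact] at h
  rw [← h]
  rfl

theorem contDiffOn_invField {U : Set 𝕜} {x : 𝕜 → Fin 4 → 𝕜} (hx : ContDiffOn 𝕜 ∞ x U) :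
    ContDiffOn 𝕜 ∞ (invField x) (cyl U) := by
  have hp : ∀ i, ContDiff 𝕜 ∞ (fun q : Pt 𝕜 => q i) := fun i =>
    (ContinuousLinearMap.proj (R := 𝕜) (φ := fun _ : Fin 4 => 𝕜) i).contDiff
  have hx' : ∀ i, ContDiffOn 𝕜 ∞ (fun q : Pt 𝕜 => x (q 0) i) (cyl U) := fun i =>
    (contDiffOn_pi.1 hx i).comp (hp 0).contDiffOn fun q hq => hq
  have he : ContDiff 𝕜 ∞ (fun q : Pt 𝕜 => NormedSpace.exp (-(q 2))) :=
    (AnalyticOnNhd.contDiff fun x _ => NormedSpace.exp_analytic (𝕂 := 𝕜) x).comp (hp 2).neg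
  refine contDiffOn_pi.2 fun i => ?_
  fin_cases i
  · exact hx' 0
  · exact he.contDiffOn.mul (hx' 1)
  · exact hx' 2
  · exact hx' 3

theorem contDiffOn_comp_time {U : Set 𝕜} {f : 𝕜 → 𝕜} (hf : ContDiffOn 𝕜 ∞ f U) :
    ContDiffOn 𝕜 ∞ (fun p : Pt 𝕜 => f (p 0)) (cyl U) :=
  hf.comp (ContinuousLinearMap.proj (R := 𝕜) (φ := fun _ : Fin 4 => 𝕜) 0).contDiff.contDiffOn
    fun _ hq => hq

/-- The tetrad `e` is given on `U × G` by invariant fields with components `E`. -/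
def Tetrad.HasComponents (e : Tetrad 𝕜) (U : Set 𝕜) (E : Fin 4 → 𝕜 → Fin 4 → 𝕜) : Prop :=
  ∀ a, ∀ p ∈ cyl U, e.frame a p = invField (E a) p

/-- The value at the parameter `s` of the cubic with coefficients `g`. -/
def cubic (g : Fin 4 → 𝕜) (s : 𝕜) : 𝕜 := g 0 + g 1 * s + g 2 * s ^ 2 + g 3 * s ^ 3

/-- The derivative at the parameter `s` of the cubic with coefficients `g`. -/
def cubicDeriv (g : Fin 4 → 𝕜) (s : 𝕜) : 𝕜 := g 1 + 2 * g 2 * s + 3 * g 3 * s ^ 2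

theorem hasFDerivAt_laxField {y w : 𝕜 → Fin 4 → 𝕜} {g : Fin 4 → 𝕜 → 𝕜} {q : Pt 𝕜 × 𝕜}
    (hy : DifferentiableAt 𝕜 y (q.1 0)) (hw : DifferentiableAt 𝕜 w (q.1 0))
    (hg : ∀ i, DifferentiableAt 𝕜 (g i) (q.1 0)) :
    ∃ A : Pt 𝕜 × 𝕜 →L[𝕜] Pt 𝕜 × 𝕜,
      HasFDerivAt (fun r : Pt 𝕜 × 𝕜 => (invField y r.1 - r.2 • invField w r.1,
        cubic (fun i => g i (r.1 0)) r.2)) A q ∧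
      ∀ v, A v = (lift q.1
        (![v.1 0 * deriv y (q.1 0) 0, v.1 0 * deriv y (q.1 0) 1 - v.1 2 * y (q.1 0) 1,
          v.1 0 * deriv y (q.1 0) 2, v.1 0 * deriv y (q.1 0) 3]
        - q.2 • ![v.1 0 * deriv w (q.1 0) 0, v.1 0 * deriv w (q.1 0) 1 - v.1 2 * w (q.1 0) 1,
          v.1 0 * deriv w (q.1 0) 2, v.1 0 * deriv w (q.1 0) 3]
        - v.2 • w (q.1 0)),
        v.1 0 * cubic (fun i => deriv (g i) (q.1 0)) q.2
          + v.2 * cubicDeriv (fun i => g i (q.1 0)) q.2) := by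
  obtain ⟨A, hA, hA'⟩ := hasFDerivAt_invField hy
  obtain ⟨B, hB, hB'⟩ := hasFDerivAt_invField hw
  have h1 := (ContinuousLinearMap.fst 𝕜 (Pt 𝕜) 𝕜).hasFDerivAt (x := q)
  have h2 := (ContinuousLinearMap.snd 𝕜 (Pt 𝕜) 𝕜).hasFDerivAt (x := q)
  have hA1 := hA.comp q h1
  have hB1 := hB.comp q h1
  have h3 : HasFDerivAt (fun r : Pt 𝕜 × 𝕜 => r.1 0)
      ((ContinuousLinearMap.proj 0).comp (ContinuousLinearMap.fst 𝕜 (Pt 𝕜) 𝕜)) q :=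
    ((ContinuousLinearMap.proj (R := 𝕜) (φ := fun _ : Fin 4 => 𝕜) 0).comp
      (ContinuousLinearMap.fst 𝕜 (Pt 𝕜) 𝕜)).hasFDerivAt
  have hgi : ∀ i, HasFDerivAt (fun r : Pt 𝕜 × 𝕜 => g i (r.1 0)) _ q := fun i =>
    HasDerivAt.comp_hasFDerivAt (f := fun r : Pt 𝕜 × 𝕜 => r.1 0) q (hg i).hasDerivAt h3
  have hcub := (((hgi 0).add ((hgi 1).mul h2)).add ((hgi 2).mul (h2.pow 2))).add
    ((hgi 3).mul (h2.pow 3))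
  refine ⟨_, (hA1.sub (h2.smul hB1)).prodMk hcub, fun v => ?_⟩
  refine Prod.ext ?_ ?_
  · simp only [map_sub, map_smul, ← hA', ← hB']
    simp [invField]
    abel
  · simp [cubic, cubicDeriv]
    ring

/-- The bracket of the two fields `l`, `m` of the twistor distribution, for invariant frames and
cubics with invariant coefficients. -/
theorem lieBracket_lax {e : Tetrad 𝕜} {U : Set 𝕜} {E : Fin 4 → 𝕜 → Fin 4 → 𝕜} (hU : IsOpen U)
    (he : e.HasComponents U E) (hE : ∀ a, DifferentiableOn 𝕜 (E a) U)
    {f₀ f₁ : Fin 4 → Pt 𝕜 → 𝕜} {g₀ g₁ : Fin 4 → 𝕜 → 𝕜}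
    (hf₀ : ∀ i, ∀ p ∈ cyl U, f₀ i p = g₀ i (p 0)) (hf₁ : ∀ i, ∀ p ∈ cyl U, f₁ i p = g₁ i (p 0))
    (hg₀ : ∀ i, DifferentiableOn 𝕜 (g₀ i) U) (hg₁ : ∀ i, DifferentiableOn 𝕜 (g₁ i) U)
    {p : Pt 𝕜} {s t : 𝕜} (ht : t ∈ U) (hp : p 0 = t) :
    VectorField.lieBracket 𝕜 (e.laxL f₀) (e.laxM f₁) (p, s) =
      (lift p (algBr (E 3 t - s • E 0 t) (deriv (E 3) t - s • deriv (E 0) t)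
          (E 1 t - s • E 2 t) (deriv (E 1) t - s • deriv (E 2) t)
          - cubic (fun i => g₀ i t) s • E 2 t + cubic (fun i => g₁ i t) s • E 0 t),
        (E 3 t 0 - s * E 0 t 0) * cubic (fun i => deriv (g₁ i) t) s
          + cubic (fun i => g₀ i t) s * cubicDeriv (fun i => g₁ i t) s
          - (E 1 t 0 - s * E 2 t 0) * cubic (fun i => deriv (g₀ i) t) s
          - cubic (fun i => g₁ i t) s * cubicDeriv (fun i => g₀ i t) s) := by
  subst hp
  have hd : ∀ {f : 𝕜 → 𝕜}, DifferentiableOn 𝕜 f U → DifferentiableAt 𝕜 f (p 0) := fun h =>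
    h.differentiableAt (hU.mem_nhds ht)
  have hd' : ∀ a, DifferentiableAt 𝕜 (E a) (p 0) := fun a =>
    (hE a).differentiableAt (hU.mem_nhds ht)
  have hnhds : ∀ᶠ r : Pt 𝕜 × 𝕜 in nhds (p, s), r.1 ∈ cyl U :=
    ((isOpen_cyl hU).preimage continuous_fst).mem_nhds (show p ∈ cyl U from ht)
  have hL : e.laxL f₀ =ᶠ[nhds (p, s)] fun r => (invField (E 3) r.1 - r.2 • invField (E 0) r.1,
      cubic (fun i => g₀ i (r.1 0)) r.2) := by
    filter_upwards [hnhds] with r hr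
    refine Prod.ext ?_ ?_
    · rw [← he 3 _ hr, ← he 0 _ hr]; rfl
    · simp [Tetrad.laxL, Fin.sum_univ_four, cubic, hf₀ _ _ hr]
  have hM : e.laxM f₁ =ᶠ[nhds (p, s)] fun r => (invField (E 1) r.1 - r.2 • invField (E 2) r.1,
      cubic (fun i => g₁ i (r.1 0)) r.2) := by
    filter_upwards [hnhds] with r hr
    refine Prod.ext ?_ ?_
    · rw [← he 1 _ hr, ← he 2 _ hr]; rfl
    · simp [Tetrad.laxM, Fin.sum_univ_four, cubic, hf₁ _ _ hr]
  rw [hL.lieBracket_vectorField_eq hM]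
  obtain ⟨A, hA, hA'⟩ := hasFDerivAt_laxField (q := (p, s)) (hd' 3) (hd' 0) (fun i => hd (hg₀ i))
  obtain ⟨B, hB, hB'⟩ := hasFDerivAt_laxField (q := (p, s)) (hd' 1) (hd' 2) (fun i => hd (hg₁ i))
  rw [VectorField.lieBracket, hA.fderiv, hB.fderiv, hA', hB']
  refine Prod.ext ?_ ?_
  · simp only [Prod.fst_sub, ← map_sub]
    congr 1
    ext i
    fin_cases i <;> simp [algBr, invField, lift_apply, Matrix.vecHead, Matrix.vecTail] <;> ring
  · simp [invField, lift_apply]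
    ring

end

/-! ### Structure functions and curvature of invariant frames -/

section

variable {𝕜 : Type*} [RCLike 𝕜]

theorem det_fin_four {R : Type*} [CommRing R] (A : Matrix (Fin 4) (Fin 4) R) : A.det =
    A 0 0 * (A 1 1 * (A 2 2 * A 3 3 - A 2 3 * A 3 2) - A 1 2 * (A 2 1 * A 3 3 - A 2 3 * A 3 1)
      + A 1 3 * (A 2 1 * A 3 2 - A 2 2 * A 3 1))
    - A 0 1 * (A 1 0 * (A 2 2 * A 3 3 - A 2 3 * A 3 2) - A 1 2 * (A 2 0 * A 3 3 - A 2 3 * A 3 0)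
      + A 1 3 * (A 2 0 * A 3 2 - A 2 2 * A 3 0))
    + A 0 2 * (A 1 0 * (A 2 1 * A 3 3 - A 2 3 * A 3 1) - A 1 1 * (A 2 0 * A 3 3 - A 2 3 * A 3 0)
      + A 1 3 * (A 2 0 * A 3 1 - A 2 1 * A 3 0))
    - A 0 3 * (A 1 0 * (A 2 1 * A 3 2 - A 2 2 * A 3 1) - A 1 1 * (A 2 0 * A 3 2 - A 2 2 * A 3 0)
      + A 1 2 * (A 2 0 * A 3 1 - A 2 1 * A 3 0)) := by
  simp [Matrix.det_succ_row_zero, Fin.sum_univ_succ, Fin.succAbove]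
  ring

/-- The Levi-Civita connection coefficients of a null tetrad with structure functions `c`. They are
linear in `c`, so that applied to `deriv c` the formula gives their derivatives. -/
def algConn (c : Fin 4 → Fin 4 → Fin 4 → 𝕜) (a b d : Fin 4) : 𝕜 :=
  ∑ k, ((∑ f, c a b f * eta 𝕜 f k) - (∑ f, c b k f * eta 𝕜 f a) + (∑ f, c k a f * eta 𝕜 f b)) / 2
    * eta 𝕜 k d

/-- The curvature at a fixed `t`, in terms of the structure functions `c`, their derivatives `dc`
and the `∂_t`-components `u` of the frame. -/
def algRiem (c dc : Fin 4 → Fin 4 → Fin 4 → 𝕜) (u : Fin 4 → 𝕜) (a b k d : Fin 4) : 𝕜 :=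
  u a * algConn dc b k d - u b * algConn dc a k d
    + ∑ f, (algConn c b k f * algConn c a f d - algConn c a k f * algConn c b f d)
    - ∑ f, c a b f * algConn c f k d

/-- The matrix whose columns are the components of the frame in `∂_t, L₁, L₂, L₃`. -/
def compMatrix (E : Fin 4 → 𝕜 → Fin 4 → 𝕜) (t : 𝕜) : Matrix (Fin 4) (Fin 4) 𝕜 :=
  Matrix.of fun i a => E a t i

/-- The structure functions of an invariant frame, as functions of `t`. -/
def structC (E : Fin 4 → 𝕜 → Fin 4 → 𝕜) (a b d : Fin 4) (t : 𝕜) : 𝕜 :=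
  ((compMatrix E t)⁻¹.mulVec (br (E a) (E b) t)) d

theorem compMatrix_mulVec (E : Fin 4 → 𝕜 → Fin 4 → 𝕜) (t : 𝕜) (v : Fin 4 → 𝕜) :
    (compMatrix E t).mulVec v = ∑ a, v a • E a t := by
  ext i
  simp [Matrix.mulVec, dotProduct, compMatrix, mul_comm]

theorem frameMatrix_mulVec (e : Tetrad 𝕜) (p : Pt 𝕜) (v : Fin 4 → 𝕜) :
    (e.frameMatrix p).mulVec v = ∑ a, v a • e.frame a p := by
  ext i
  simp [Matrix.mulVec, dotProduct, Tetrad.frameMatrix, mul_comm]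

theorem Tetrad.coords_eq {e : Tetrad 𝕜} {p : Pt 𝕜} (h : (e.frameMatrix p).det ≠ 0) {v : Pt 𝕜}
    {c : Fin 4 → 𝕜} (hv : v = ∑ a, c a • e.frame a p) : e.coords p v = c := by
  rw [Tetrad.coords, hv, ← frameMatrix_mulVec, Matrix.mulVec_mulVec,
    Matrix.nonsing_inv_mul _ (isUnit_iff_ne_zero.2 h), Matrix.one_mulVec]

variable {U : Set 𝕜} {e : Tetrad 𝕜} {E : Fin 4 → 𝕜 → Fin 4 → 𝕜}

theorem Tetrad.HasComponents.det_frameMatrix (he : e.HasComponents U E) {p : Pt 𝕜}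
    (hp : p ∈ cyl U) :
    (e.frameMatrix p).det = NormedSpace.exp (-(p 2)) * (compMatrix E (p 0)).det := by
  have h : e.frameMatrix p
      = Matrix.diagonal ![1, NormedSpace.exp (-(p 2)), 1, 1] * compMatrix E (p 0) := by
    ext i a
    rw [Matrix.diagonal_mul]
    simp only [Tetrad.frameMatrix, Matrix.of_apply, he a p hp, invField, lift_apply, compMatrix]
    fin_cases i <;> simp
  rw [h, Matrix.det_mul, Matrix.det_diagonal, Fin.prod_univ_four]
  simp

theorem structC_spec {t : 𝕜} (h : (compMatrix E t).det ≠ 0) (a b : Fin 4) :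
    br (E a) (E b) t = ∑ d, structC E a b d t • E d t := by
  rw [← compMatrix_mulVec]
  change _ = (compMatrix E t).mulVec ((compMatrix E t)⁻¹.mulVec (br (E a) (E b) t))
  rw [Matrix.mulVec_mulVec, Matrix.mul_nonsing_inv _ (isUnit_iff_ne_zero.2 h), Matrix.one_mulVec]

theorem br_swap (x y : 𝕜 → Fin 4 → 𝕜) (t : 𝕜) : br y x t = - br x y t := by
  ext i
  fin_cases i <;> simp [br, algBr]
  ring

theorem structC_swap (a b d : Fin 4) (t : 𝕜) : structC E b a d t = - structC E a b d t := by
  simp [structC, br_swap (E a) (E b), Matrix.mulVec_neg]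

theorem contDiffOn_det {n : ℕ} {A : 𝕜 → Matrix (Fin n) (Fin n) 𝕜}
    (hA : ∀ i j, ContDiffOn 𝕜 ∞ (fun t => A t i j) U) :
    ContDiffOn 𝕜 ∞ (fun t => (A t).det) U := by
  simp only [Matrix.det_apply]
  exact ContDiffOn.sum fun σ _ => ContDiffOn.const_smul _ (contDiffOn_prod fun i _ => hA _ _)

theorem contDiffOn_deriv {F : Type*} [NormedAddCommGroup F] [NormedSpace 𝕜 F] {f : 𝕜 → F}
    (hU : IsOpen U) (hf : ContDiffOn 𝕜 ∞ f U) : ContDiffOn 𝕜 ∞ (deriv f) U :=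
  hf.deriv_of_isOpen hU (by simp)

theorem contDiffOn_br {x y : 𝕜 → Fin 4 → 𝕜} (hU : IsOpen U) (hx : ContDiffOn 𝕜 ∞ x U)
    (hy : ContDiffOn 𝕜 ∞ y U) : ContDiffOn 𝕜 ∞ (br x y) U := by
  have hx' := contDiffOn_pi.1 hx
  have hy' := contDiffOn_pi.1 hy
  have hdx := contDiffOn_pi.1 (contDiffOn_deriv hU hx)
  have hdy := contDiffOn_pi.1 (contDiffOn_deriv hU hy)
  refine contDiffOn_pi.2 fun i => ?_
  fin_cases i
  · exact ((hx' 0).mul (hdy 0)).sub ((hy' 0).mul (hdx 0))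
  · exact (((hx' 0).mul (hdy 1)).sub ((hy' 0).mul (hdx 1))).add
      (((hx' 1).mul (hy' 2)).sub ((hx' 2).mul (hy' 1)))
  · exact ((hx' 0).mul (hdy 2)).sub ((hy' 0).mul (hdx 2))
  · exact ((hx' 0).mul (hdy 3)).sub ((hy' 0).mul (hdx 3))

theorem contDiffOn_structC (hU : IsOpen U) (hE : ∀ a, ContDiffOn 𝕜 ∞ (E a) U)
    (hdet : ∀ t ∈ U, (compMatrix E t).det ≠ 0) (a b d : Fin 4) :
    ContDiffOn 𝕜 ∞ (structC E a b d) U := by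
  have hE' : ∀ i j, ContDiffOn 𝕜 ∞ (fun t => compMatrix E t i j) U := fun i j =>
    contDiffOn_pi.1 (hE j) i
  have h1 : ∀ t, structC E a b d t = (compMatrix E t).det⁻¹ *
      ((compMatrix E t).updateCol d (br (E a) (E b) t)).det := fun t => by
    rw [structC, Matrix.inv_def, Matrix.smul_mulVec, ← Matrix.cramer_eq_adjugate_mulVec,
      Pi.smul_apply, Matrix.cramer_apply, Ring.inverse_eq_inv', smul_eq_mul]
  refine ContDiffOn.congr (ContDiffOn.mul ((contDiffOn_det hE').inv hdet)
    (contDiffOn_det fun i j => ?_)) fun t _ => h1 t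
  simp only [Matrix.updateCol_apply]
  split_ifs
  · exact contDiffOn_pi.1 (contDiffOn_br hU (hE a) (hE b)) i
  · exact hE' i j

theorem Tetrad.HasComponents.lieBracket_frame (hU : IsOpen U) (he : e.HasComponents U E)
    (hE : ∀ a, DifferentiableOn 𝕜 (E a) U) {p : Pt 𝕜} (hp : p ∈ cyl U) (a b : Fin 4) :
    VectorField.lieBracket 𝕜 (e.frame a) (e.frame b) p = lift p (br (E a) (E b) (p 0)) := by
  have h : ∀ a, e.frame a =ᶠ[nhds p] invField (E a) := fun a => by
    filter_upwards [(isOpen_cyl hU).mem_nhds hp] with q hq using he a q hq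
  rw [(h a).lieBracket_vectorField_eq (h b)]
  exact lieBracket_invField ((hE a).differentiableAt (hU.mem_nhds hp))
    ((hE b).differentiableAt (hU.mem_nhds hp))

theorem Tetrad.HasComponents.structFn_eq (hU : IsOpen U) (he : e.HasComponents U E)
    (hE : ∀ a, DifferentiableOn 𝕜 (E a) U) (hdet : ∀ t ∈ U, (compMatrix E t).det ≠ 0)
    {p : Pt 𝕜} (hp : p ∈ cyl U) (a b d : Fin 4) :
    e.structFn a b d p = structC E a b d (p 0) := by
  have hdet' : (e.frameMatrix p).det ≠ 0 := by
    rw [he.det_frameMatrix hp]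
    exact mul_ne_zero (exp_ne_zero' _) (hdet _ hp)
  refine congrFun (Tetrad.coords_eq hdet' (c := fun d => structC E a b d (p 0)) ?_) d
  rw [he.lieBracket_frame hU hE hp, structC_spec (hdet _ hp), map_sum]
  exact Finset.sum_congr rfl fun d _ => by rw [map_smul, he d p hp]; rfl

theorem Tetrad.HasComponents.conn_eq (hU : IsOpen U) (he : e.HasComponents U E)
    (hE : ∀ a, DifferentiableOn 𝕜 (E a) U) (hdet : ∀ t ∈ U, (compMatrix E t).det ≠ 0)
    {p : Pt 𝕜} (hp : p ∈ cyl U) (a b d : Fin 4) :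
    e.conn a b d p = algConn (fun a b d => structC E a b d (p 0)) a b d := by
  simp only [Tetrad.conn, Tetrad.connLow, Tetrad.structLow, he.structFn_eq hU hE hdet hp, algConn]

theorem fderiv_comp_time {f : 𝕜 → 𝕜} {p : Pt 𝕜} (hf : DifferentiableAt 𝕜 f (p 0)) (v : Pt 𝕜) :
    fderiv 𝕜 (fun q : Pt 𝕜 => f (q 0)) p v = v 0 * deriv f (p 0) := by
  have h : HasFDerivAt (fun q : Pt 𝕜 => f (q 0))
      (deriv f (p 0) • (ContinuousLinearMap.proj 0 : Pt 𝕜 →L[𝕜] 𝕜)) p :=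
    HasDerivAt.comp_hasFDerivAt (f := fun q : Pt 𝕜 => q 0) p hf.hasDerivAt
      (ContinuousLinearMap.proj (R := 𝕜) (φ := fun _ : Fin 4 => 𝕜) 0).hasFDerivAt
  rw [h.fderiv]
  simp [mul_comm]

theorem hasDerivAt_algConn {c : Fin 4 → Fin 4 → Fin 4 → 𝕜 → 𝕜} {t : 𝕜}
    (hc : ∀ a b d, DifferentiableAt 𝕜 (c a b d) t) (a b d : Fin 4) :
    HasDerivAt (fun s => algConn (fun a b d => c a b d s) a b d)
      (algConn (fun a b d => deriv (c a b d) t) a b d) t := by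
  have h : ∀ a b k, HasDerivAt (fun s => ∑ f, c a b f s * eta 𝕜 f k)
      (∑ f, deriv (c a b f) t * eta 𝕜 f k) t := fun a b k =>
    HasDerivAt.fun_sum fun f _ => (hc a b f).hasDerivAt.mul_const _
  exact HasDerivAt.fun_sum fun k _ => ((((h a b k).sub (h b k a)).add (h k a b)).div_const 2).mul_const _

theorem Tetrad.HasComponents.riem_eq (hU : IsOpen U) (he : e.HasComponents U E)
    (hE : ∀ a, ContDiffOn 𝕜 ∞ (E a) U) (hdet : ∀ t ∈ U, (compMatrix E t).det ≠ 0)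
    {p : Pt 𝕜} (hp : p ∈ cyl U) (a b k d : Fin 4) :
    e.riem a b k d p = algRiem (fun a b d => structC E a b d (p 0))
      (fun a b d => deriv (structC E a b d) (p 0)) (fun a => E a (p 0) 0) a b k d := by
  have hE' : ∀ a, DifferentiableOn 𝕜 (E a) U := fun a => (hE a).differentiableOn (by simp)
  have hC : ∀ a b d, DifferentiableAt 𝕜 (structC E a b d) (p 0) := fun a b d =>
    ((contDiffOn_structC hU hE hdet a b d).differentiableOn (by simp)).differentiableAt
      (hU.mem_nhds hp)
  have hder : ∀ a b k d, e.frameDeriv a (e.conn b k d) p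
      = E a (p 0) 0 * algConn (fun a b d => deriv (structC E a b d) (p 0)) b k d := by
    intro a b k d
    have h : e.conn b k d =ᶠ[nhds p]
        fun q => algConn (fun a b d => structC E a b d (q 0)) b k d := by
      filter_upwards [(isOpen_cyl hU).mem_nhds hp] with q hq using he.conn_eq hU hE' hdet hq b k d
    have h2 := hasDerivAt_algConn hC b k d
    rw [Tetrad.frameDeriv, h.fderiv_eq, fderiv_comp_time h2.differentiableAt, h2.deriv, he a p hp]
    rfl
  simp only [Tetrad.riem, hder, he.conn_eq hU hE' hdet hp, he.structFn_eq hU hE' hdet hp, algRiem]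

end

/-! ### The vertical integrability defect as a curvature component -/

section

variable {𝕜 : Type*} [RCLike 𝕜]

theorem sum_eta_zero (x : Fin 4 → 𝕜) : ∑ f, x f * eta 𝕜 f 0 = - x 1 := by
  simp [Fin.sum_univ_four, eta]

theorem sum_eta_one (x : Fin 4 → 𝕜) : ∑ f, x f * eta 𝕜 f 1 = - x 0 := by
  simp [Fin.sum_univ_four, eta]

theorem sum_eta_two (x : Fin 4 → 𝕜) : ∑ f, x f * eta 𝕜 f 2 = x 3 := by
  simp [Fin.sum_univ_four, eta]

theorem sum_eta_three (x : Fin 4 → 𝕜) : ∑ f, x f * eta 𝕜 f 3 = x 2 := by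
  simp [Fin.sum_univ_four, eta]

/-- The connection coefficients `g(∇_{e_a} e_b, e_k)`, in terms of the structure constants. -/
def algConnLow (c : Fin 4 → Fin 4 → Fin 4 → 𝕜) (a b k : Fin 4) : 𝕜 :=
  ((∑ f, c a b f * eta 𝕜 f k) - (∑ f, c b k f * eta 𝕜 f a) + (∑ f, c k a f * eta 𝕜 f b)) / 2

theorem algConn_zero (c : Fin 4 → Fin 4 → Fin 4 → 𝕜) (a b : Fin 4) :
    algConn c a b 0 = -algConnLow c a b 1 := sum_eta_zero fun k => algConnLow c a b k

theorem algConn_one (c : Fin 4 → Fin 4 → Fin 4 → 𝕜) (a b : Fin 4) :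
    algConn c a b 1 = -algConnLow c a b 0 := sum_eta_one fun k => algConnLow c a b k

theorem algConn_two (c : Fin 4 → Fin 4 → Fin 4 → 𝕜) (a b : Fin 4) :
    algConn c a b 2 = algConnLow c a b 3 := sum_eta_two fun k => algConnLow c a b k

theorem algConn_three (c : Fin 4 → Fin 4 → Fin 4 → 𝕜) (a b : Fin 4) :
    algConn c a b 3 = algConnLow c a b 2 := sum_eta_three fun k => algConnLow c a b k

/-- The connection is metric. -/
theorem algConnLow_antisymm {c : Fin 4 → Fin 4 → Fin 4 → 𝕜} (hc : ∀ a b d, c b a d = - c a b d)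
    (a b k : Fin 4) : algConnLow c a k b = -algConnLow c a b k := by
  simp only [algConnLow, hc a k, hc b a, hc b k, neg_mul, Finset.sum_neg_distrib]
  ring

/-- The connection is torsion free. -/
theorem sum_structure_eta {c : Fin 4 → Fin 4 → Fin 4 → 𝕜} (hc : ∀ a b d, c b a d = - c a b d)
    (a b k : Fin 4) : ∑ f, c a b f * eta 𝕜 f k = algConnLow c a b k - algConnLow c b a k := by
  simp only [algConnLow, hc a k, hc a b, hc b k, neg_mul, Finset.sum_neg_distrib]
  ring

/-- The components of the vector `[Z̃ - s W, W̃ - s Z]` for constant `s`. -/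
def twistG (c : Fin 4 → Fin 4 → Fin 4 → 𝕜) (s : 𝕜) (d : Fin 4) : 𝕜 :=
  c 3 1 d - s * (c 3 2 d + c 0 1 d) + s ^ 2 * c 0 2 d

/-- The `s`-derivative of `twistG`. -/
def twistGDeriv (c : Fin 4 → Fin 4 → Fin 4 → 𝕜) (s : 𝕜) (d : Fin 4) : 𝕜 :=
  -(c 3 2 d + c 0 1 d) + 2 * s * c 0 2 d

/-- The `∂_s`-component of `[l, m] - α l - β m`, where `f₀ = g₂ + s g₁`, `f₁ = -(g₀ + s g₃)`,
`α = g₃`, `β = g₁` in terms of `g = twistG c s`. These choices are forced by the other components of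
`[l, m] = 0 mod l, m`. The arguments `dc` and `u` are the derivatives of the structure functions and
the `∂_t`-components of the frame. -/
def vertDefect (c dc : Fin 4 → Fin 4 → Fin 4 → 𝕜) (u : Fin 4 → 𝕜) (s : 𝕜) : 𝕜 :=
  -(u 3 - s * u 0) * (twistG dc s 0 + s * twistG dc s 3)
    - (u 1 - s * u 2) * (twistG dc s 2 + s * twistG dc s 1)
    - (twistG c s 2 + s * twistG c s 1) * (twistGDeriv c s 0 + twistG c s 3 + s * twistGDeriv c s 3)
    + (twistG c s 0 + s * twistG c s 3) * (twistGDeriv c s 2 + twistG c s 1 + s * twistGDeriv c s 1)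
    - twistG c s 3 * (twistG c s 2 + s * twistG c s 1)
    + twistG c s 1 * (twistG c s 0 + s * twistG c s 3)

/-- The curvature with the last index lowered. -/
def algRiemLow (c dc : Fin 4 → Fin 4 → Fin 4 → 𝕜) (u : Fin 4 → 𝕜) (a b k d : Fin 4) : 𝕜 :=
  ∑ f, algRiem c dc u a b k f * eta 𝕜 f d

set_option maxHeartbeats 4000000 in
/-- The vertical part of the integrability condition is minus the curvature component
`g(R(l, m) l, m)` for the null vectors `l = Z̃ - s W`, `m = W̃ - s Z`. As these span an `α`-plane, only
the self-dual part of the Weyl tensor contributes. -/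
theorem vertDefect_eq {c dc : Fin 4 → Fin 4 → Fin 4 → 𝕜} (u : Fin 4 → 𝕜) (s : 𝕜)
    (hc : ∀ a b d, c b a d = - c a b d) (hdc : ∀ a b d, dc b a d = - dc a b d) :
    -vertDefect c dc u s =
      algRiemLow c dc u 3 1 3 1
      - s * (algRiemLow c dc u 3 1 3 2 + algRiemLow c dc u 3 1 0 1
        + algRiemLow c dc u 3 2 3 1 + algRiemLow c dc u 0 1 3 1)
      + s ^ 2 * (algRiemLow c dc u 3 1 0 2 + algRiemLow c dc u 0 2 3 1
        + algRiemLow c dc u 3 2 3 2 + algRiemLow c dc u 3 2 0 1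
        + algRiemLow c dc u 0 1 3 2 + algRiemLow c dc u 0 1 0 1)
      - s ^ 3 * (algRiemLow c dc u 0 2 3 2 + algRiemLow c dc u 0 2 0 1
        + algRiemLow c dc u 3 2 0 2 + algRiemLow c dc u 0 1 0 2)
      + s ^ 4 * algRiemLow c dc u 0 2 0 2 := by
  have c0 : ∀ a b, c a b 0 = -(algConnLow c a b 1 - algConnLow c b a 1) := fun a b => by
    rw [← sum_structure_eta hc, sum_eta_one, neg_neg]
  have c1 : ∀ a b, c a b 1 = -(algConnLow c a b 0 - algConnLow c b a 0) := fun a b => by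
    rw [← sum_structure_eta hc, sum_eta_zero, neg_neg]
  have c2 : ∀ a b, c a b 2 = algConnLow c a b 3 - algConnLow c b a 3 := fun a b => by
    rw [← sum_structure_eta hc, sum_eta_three]
  have c3 : ∀ a b, c a b 3 = algConnLow c a b 2 - algConnLow c b a 2 := fun a b => by
    rw [← sum_structure_eta hc, sum_eta_two]
  have d0 : ∀ a b, dc a b 0 = -(algConnLow dc a b 1 - algConnLow dc b a 1) := fun a b => by
    rw [← sum_structure_eta hdc, sum_eta_one, neg_neg]
  have d1 : ∀ a b, dc a b 1 = -(algConnLow dc a b 0 - algConnLow dc b a 0) := fun a b => by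
    rw [← sum_structure_eta hdc, sum_eta_zero, neg_neg]
  have d2 : ∀ a b, dc a b 2 = algConnLow dc a b 3 - algConnLow dc b a 3 := fun a b => by
    rw [← sum_structure_eta hdc, sum_eta_three]
  have d3 : ∀ a b, dc a b 3 = algConnLow dc a b 2 - algConnLow dc b a 2 := fun a b => by
    rw [← sum_structure_eta hdc, sum_eta_two]
  simp only [vertDefect, twistG, twistGDeriv, algRiemLow, sum_eta_one, sum_eta_two]
  simp only [algRiem, Fin.sum_univ_four, algConn_zero, algConn_one, algConn_two, algConn_three]
  simp only [c0, c1, c2, c3, d0, d1, d2, d3]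
  have hA := algConnLow_antisymm hc
  have hB := algConnLow_antisymm hdc
  have hz : ∀ a b, algConnLow c a b b = 0 := fun a b => self_eq_neg.1 (hA a b b)
  have hdz : ∀ a b, algConnLow dc a b b = 0 := fun a b => self_eq_neg.1 (hB a b b)
  simp only [hz, hdz, fun a => hA a 0 1, fun a => hA a 0 2, fun a => hA a 0 3, fun a => hA a 1 2,
    fun a => hA a 1 3, fun a => hA a 2 3, fun a => hB a 0 1, fun a => hB a 0 2,
    fun a => hB a 0 3, fun a => hB a 1 2, fun a => hB a 1 3, fun a => hB a 2 3]
  generalize algConnLow c = Γ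
  generalize algConnLow dc = Δ
  ring

end

/-! ### Anti-self-duality gives a Lax pair -/

section

variable {𝕜 : Type*} [RCLike 𝕜]

/-- A two-form `X` is anti-self-dual if and only if it vanishes on the bivectors `W ∧ Z`,
`Z̃ ∧ W̃` and `W ∧ W̃ + Z̃ ∧ Z`, which span the tangent bivectors of the `α`-planes. -/
theorem selfDual_part_eq_zero_iff {X : Fin 4 → Fin 4 → 𝕜} (hX : ∀ a b, X b a = - X a b) :
    (∀ a b, X a b + (∑ m, ∑ n, ∑ f, ∑ h, eps 𝕜 a b m n * eta 𝕜 m f * eta 𝕜 n h * X f h) / 2 = 0) ↔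
      X 0 2 = 0 ∧ X 3 1 = 0 ∧ X 0 1 + X 3 2 = 0 := by
  have hz : ∀ a, X a a = 0 := fun a => self_eq_neg.1 (hX a a)
  have e1 := hX 0 1
  have e2 := hX 0 2
  have e3 := hX 0 3
  have e4 := hX 1 2
  have e5 := hX 1 3
  have e6 := hX 2 3
  constructor
  · intro h
    have h1 := h 0 2
    have h2 := h 1 3
    have h3 := h 0 1
    simp [Fin.sum_univ_four, eta, eps, det_fin_four, e1, e2, e3, e4, e5, e6] at h1 h2 h3
    refine ⟨?_, ?_, ?_⟩
    · exact h1
    · linear_combination -h2 + e5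
    · linear_combination h3 + e6
  · rintro ⟨h1, h2, h3⟩ a b
    rw [e5, neg_eq_zero] at h2
    rw [e6] at h3
    fin_cases a <;> fin_cases b <;>
      simp [Fin.sum_univ_four, eta, eps, det_fin_four, hz, e1, e2, e3, e4, e5, e6, h1, h2] <;>
      first | linear_combination h3 | linear_combination -h3

theorem algRiem_antisymm {c dc : Fin 4 → Fin 4 → Fin 4 → 𝕜} (u : Fin 4 → 𝕜)
    (hc : ∀ a b d, c b a d = - c a b d) (a b k d : Fin 4) :
    algRiem c dc u b a k d = - algRiem c dc u a b k d := by
  simp only [algRiem, hc a b, neg_mul, Finset.sum_neg_distrib, Finset.sum_sub_distrib]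
  ring

variable {U : Set 𝕜} {e : Tetrad 𝕜} {E : Fin 4 → 𝕜 → Fin 4 → 𝕜}

theorem deriv_structC_swap (a b d : Fin 4) (t : 𝕜) :
    deriv (structC E b a d) t = - deriv (structC E a b d) t := by
  rw [show structC E b a d = fun t => - structC E a b d t from
    funext fun t => structC_swap a b d t, deriv.fun_neg]

theorem Tetrad.HasComponents.riem_antisymm (hU : IsOpen U) (he : e.HasComponents U E)
    (hE : ∀ a, ContDiffOn 𝕜 ∞ (E a) U) (hdet : ∀ t ∈ U, (compMatrix E t).det ≠ 0)
    {p : Pt 𝕜} (hp : p ∈ cyl U) (a b k d : Fin 4) : e.riem b a k d p = - e.riem a b k d p := by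
  rw [he.riem_eq hU hE hdet hp, he.riem_eq hU hE hdet hp]
  exact algRiem_antisymm _ (fun a b d => structC_swap a b d _) a b k d

theorem Tetrad.HasComponents.weyl_antisymm (hU : IsOpen U) (he : e.HasComponents U E)
    (hE : ∀ a, ContDiffOn 𝕜 ∞ (E a) U) (hdet : ∀ t ∈ U, (compMatrix E t).det ≠ 0)
    {p : Pt 𝕜} (hp : p ∈ cyl U) (a b k d : Fin 4) : e.weyl b a k d p = - e.weyl a b k d p := by
  simp only [Tetrad.weyl, Tetrad.riemLow, he.riem_antisymm hU hE hdet hp a b, neg_mul,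
    Finset.sum_neg_distrib]
  ring

/-- Anti-self-duality says that the Weyl tensor vanishes on the tangent bivectors of the
`α`-planes. -/
theorem Tetrad.HasComponents.isASD_iff (hU : IsOpen U) (he : e.HasComponents U E)
    (hE : ∀ a, ContDiffOn 𝕜 ∞ (E a) U) (hdet : ∀ t ∈ U, (compMatrix E t).det ≠ 0) :
    e.IsASD (cyl U) ↔ ∀ p ∈ cyl U, ∀ k d, e.weyl 0 2 k d p = 0 ∧ e.weyl 3 1 k d p = 0 ∧
      e.weyl 0 1 k d p + e.weyl 3 2 k d p = 0 := by
  refine forall₂_congr fun p hp => ?_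
  have h : ∀ k d, _ := fun k d => selfDual_part_eq_zero_iff
    (X := fun a b => e.weyl a b k d p) fun a b => he.weyl_antisymm hU hE hdet hp a b k d
  constructor
  · intro H k d
    refine (h k d).1 fun a b => ?_
    have := H a b k d
    rwa [Tetrad.weylSD, div_eq_zero_iff, or_iff_left two_ne_zero] at this
  · intro H a b k d
    have := (h k d).2 (H k d) a b
    rw [Tetrad.weylSD, div_eq_zero_iff, or_iff_left two_ne_zero]
    exact this

theorem Tetrad.HasComponents.riemLow_eq (hU : IsOpen U) (he : e.HasComponents U E)
    (hE : ∀ a, ContDiffOn 𝕜 ∞ (E a) U) (hdet : ∀ t ∈ U, (compMatrix E t).det ≠ 0)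
    {p : Pt 𝕜} (hp : p ∈ cyl U) (a b k d : Fin 4) :
    e.riemLow a b k d p = algRiemLow (fun a b d => structC E a b d (p 0))
      (fun a b d => deriv (structC E a b d) (p 0)) (fun a => E a (p 0) 0) a b k d := by
  simp only [Tetrad.riemLow, he.riem_eq hU hE hdet hp, algRiemLow]

/-- For an anti-self-dual class the vertical part of the integrability condition holds. -/
theorem Tetrad.HasComponents.vertDefect_eq_zero (hU : IsOpen U) (he : e.HasComponents U E)
    (hE : ∀ a, ContDiffOn 𝕜 ∞ (E a) U) (hdet : ∀ t ∈ U, (compMatrix E t).det ≠ 0)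
    (hasd : e.IsASD (cyl U)) {t : 𝕜} (ht : t ∈ U) (s : 𝕜) :
    vertDefect (fun a b d => structC E a b d t) (fun a b d => deriv (structC E a b d) t)
      (fun a => E a t 0) s = 0 := by
  have hp : (![t, 0, 0, 0] : Pt 𝕜) ∈ cyl U := ht
  have H := (he.isASD_iff hU hE hdet).1 hasd _ hp
  have hr : ∀ a b k d, algRiemLow (fun a b d => structC E a b d t)
      (fun a b d => deriv (structC E a b d) t) (fun a => E a t 0) a b k d
      = e.riemLow a b k d ![t, 0, 0, 0] := fun a b k d =>
    (he.riemLow_eq hU hE hdet hp a b k d).symm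
  rw [← neg_eq_zero, vertDefect_eq _ s (fun a b d => structC_swap a b d t)
    fun a b d => deriv_structC_swap a b d t]
  simp only [hr]
  have w : ∀ a b k d, e.riemLow a b k d ![t, 0, 0, 0] = e.weyl a b k d ![t, 0, 0, 0]
      + (eta 𝕜 a d * e.schouten b k ![t, 0, 0, 0] + eta 𝕜 b k * e.schouten a d ![t, 0, 0, 0]
      - eta 𝕜 a k * e.schouten b d ![t, 0, 0, 0] - eta 𝕜 b d * e.schouten a k ![t, 0, 0, 0]) :=
    fun a b k d => by simp only [Tetrad.weyl]; ring
  simp only [w]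
  simp [eta]
  linear_combination (H 3 1).2.1 - s * ((H 3 2).2.1 + (H 0 1).2.1 + (H 3 1).2.2)
    + s ^ 2 * ((H 0 2).2.1 + (H 3 1).1 + (H 3 2).2.2 + (H 0 1).2.2)
    - s ^ 3 * ((H 3 2).1 + (H 0 1).1 + (H 0 2).2.2) + s ^ 4 * (H 0 2).1

/-- The coefficients of the cubic `f₀` of an invariant anti-self-dual frame. -/
def laxCoeff₀ (c : Fin 4 → Fin 4 → Fin 4 → 𝕜) : Fin 4 → 𝕜 :=
  ![c 3 1 2, c 3 1 1 - (c 3 2 2 + c 0 1 2), c 0 2 2 - (c 3 2 1 + c 0 1 1), c 0 2 1]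

/-- The coefficients of the cubic `f₁` of an invariant anti-self-dual frame. -/
def laxCoeff₁ (c : Fin 4 → Fin 4 → Fin 4 → 𝕜) : Fin 4 → 𝕜 :=
  ![-c 3 1 0, -c 3 1 3 + (c 3 2 0 + c 0 1 0), -c 0 2 0 + (c 3 2 3 + c 0 1 3), -c 0 2 3]

theorem cubic_laxCoeff₀ (c : Fin 4 → Fin 4 → Fin 4 → 𝕜) (s : 𝕜) :
    cubic (laxCoeff₀ c) s = twistG c s 2 + s * twistG c s 1 := by
  simp [cubic, laxCoeff₀, twistG]; ring

theorem cubic_laxCoeff₁ (c : Fin 4 → Fin 4 → Fin 4 → 𝕜) (s : 𝕜) :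
    cubic (laxCoeff₁ c) s = -(twistG c s 0 + s * twistG c s 3) := by
  simp [cubic, laxCoeff₁, twistG]; ring

theorem cubicDeriv_laxCoeff₀ (c : Fin 4 → Fin 4 → Fin 4 → 𝕜) (s : 𝕜) :
    cubicDeriv (laxCoeff₀ c) s = twistGDeriv c s 2 + twistG c s 1 + s * twistGDeriv c s 1 := by
  simp [cubicDeriv, laxCoeff₀, twistG, twistGDeriv]; ring

theorem cubicDeriv_laxCoeff₁ (c : Fin 4 → Fin 4 → Fin 4 → 𝕜) (s : 𝕜) :
    cubicDeriv (laxCoeff₁ c) s = -(twistGDeriv c s 0 + twistG c s 3 + s * twistGDeriv c s 3) := by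
  simp [cubicDeriv, laxCoeff₁, twistG, twistGDeriv]; ring

/-- The bracket `[Z̃ - s W, W̃ - s Z]` in terms of the structure functions. -/
theorem algBr_twist {t : 𝕜} (h : (compMatrix E t).det ≠ 0) (s : 𝕜) :
    algBr (E 3 t - s • E 0 t) (deriv (E 3) t - s • deriv (E 0) t)
      (E 1 t - s • E 2 t) (deriv (E 1) t - s • deriv (E 2) t)
    = ∑ d, twistG (fun a b d => structC E a b d t) s d • E d t := by
  have h1 : ∑ d, twistG (fun a b d => structC E a b d t) s d • E d t
      = br (E 3) (E 1) t - s • (br (E 3) (E 2) t + br (E 0) (E 1) t) + s ^ 2 • br (E 0) (E 2) t := by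
    simp only [structC_spec h, twistG, Fin.sum_univ_four]
    module
  rw [h1]
  ext i
  fin_cases i <;> simp [br, algBr] <;> ring

/-- An invariant anti-self-dual frame has an integrable twistor distribution, with `f₀`, `f₁` read
off from the structure functions. -/
theorem Tetrad.HasComponents.isLaxPair (hU : IsOpen U) (he : e.HasComponents U E)
    (hE : ∀ a, ContDiffOn 𝕜 ∞ (E a) U) (hdet : ∀ t ∈ U, (compMatrix E t).det ≠ 0)
    (hasd : e.IsASD (cyl U)) :
    e.IsLaxPair (cyl U) (fun i p => laxCoeff₀ (fun a b d => structC E a b d (p 0)) i)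
      (fun i p => laxCoeff₁ (fun a b d => structC E a b d (p 0)) i) := by
  have hC := contDiffOn_structC hU hE hdet
  have hg₀ : ∀ i, ContDiffOn 𝕜 ∞ (fun t => laxCoeff₀ (fun a b d => structC E a b d t) i) U := by
    intro i
    fin_cases i
    · exact hC 3 1 2
    · exact (hC 3 1 1).sub ((hC 3 2 2).add (hC 0 1 2))
    · exact (hC 0 2 2).sub ((hC 3 2 1).add (hC 0 1 1))
    · exact hC 0 2 1
  have hg₁ : ∀ i, ContDiffOn 𝕜 ∞ (fun t => laxCoeff₁ (fun a b d => structC E a b d t) i) U := by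
    intro i
    fin_cases i
    · exact (hC 3 1 0).neg
    · exact (hC 3 1 3).neg.add ((hC 3 2 0).add (hC 0 1 0))
    · exact (hC 0 2 0).neg.add ((hC 3 2 3).add (hC 0 1 3))
    · exact (hC 0 2 3).neg
  refine ⟨fun i => ⟨contDiffOn_comp_time (hg₀ i), contDiffOn_comp_time (hg₁ i)⟩, ?_⟩
  rintro ⟨p, s⟩ hp
  have hd : ∀ a b d, DifferentiableAt 𝕜 (structC E a b d) (p 0) := fun a b d =>
    ((hC a b d).differentiableOn (by simp)).differentiableAt (hU.mem_nhds hp)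
  have hdg₀ : (fun i => deriv (fun t => laxCoeff₀ (fun a b d => structC E a b d t) i) (p 0))
      = laxCoeff₀ (fun a b d => deriv (structC E a b d) (p 0)) := by
    ext i
    have H := fun a b d => (hd a b d).hasDerivAt
    fin_cases i
    · exact (H 3 1 2).deriv
    · exact ((H 3 1 1).sub ((H 3 2 2).add (H 0 1 2))).deriv
    · exact ((H 0 2 2).sub ((H 3 2 1).add (H 0 1 1))).deriv
    · exact (H 0 2 1).deriv
  have hdg₁ : (fun i => deriv (fun t => laxCoeff₁ (fun a b d => structC E a b d t) i) (p 0))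
      = laxCoeff₁ (fun a b d => deriv (structC E a b d) (p 0)) := by
    ext i
    have H := fun a b d => (hd a b d).hasDerivAt
    fin_cases i
    · exact (H 3 1 0).neg.deriv
    · exact ((H 3 1 3).neg.add ((H 3 2 0).add (H 0 1 0))).deriv
    · exact ((H 0 2 0).neg.add ((H 3 2 3).add (H 0 1 3))).deriv
    · exact (H 0 2 3).neg.deriv
  rw [lieBracket_lax hU he (fun a => (hE a).differentiableOn (by simp)) (fun i p _ => rfl)
    (fun i p _ => rfl) (fun i => (hg₀ i).differentiableOn (by simp))
    (fun i => (hg₁ i).differentiableOn (by simp)) hp rfl, hdg₀, hdg₁, algBr_twist (hdet _ hp)]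
  have hv := he.vertDefect_eq_zero hU hE hdet hasd hp s
  set c : Fin 4 → Fin 4 → Fin 4 → 𝕜 := fun a b d => structC E a b d (p 0) with hc
  rw [Submodule.mem_span_pair]
  refine ⟨twistG c s 3, twistG c s 1, ?_⟩
  refine Prod.ext ?_ ?_
  · have h : ∀ a, e.frame a p = lift p (E a (p 0)) := fun a => he a p hp
    have hL : (e.laxL (fun i p => laxCoeff₀ (fun a b d => structC E a b d (p 0)) i) (p, s)).1
        = lift p (E 3 (p 0)) - s • lift p (E 0 (p 0)) := by rw [← h, ← h]; rfl
    have hM : (e.laxM (fun i p => laxCoeff₁ (fun a b d => structC E a b d (p 0)) i) (p, s)).1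
        = lift p (E 1 (p 0)) - s • lift p (E 2 (p 0)) := by rw [← h, ← h]; rfl
    simp only [Prod.fst_add, Prod.smul_fst, hL, hM, ← map_smul, ← map_sub, ← map_add]
    congr 1
    simp only [cubic_laxCoeff₀, cubic_laxCoeff₁, Fin.sum_univ_four]
    module
  · have hL : (e.laxL (fun i p => laxCoeff₀ (fun a b d => structC E a b d (p 0)) i) (p, s)).2
        = cubic (laxCoeff₀ c) s := by
      simp [Tetrad.laxL, cubic, Fin.sum_univ_four, hc]
    have hM : (e.laxM (fun i p => laxCoeff₁ (fun a b d => structC E a b d (p 0)) i) (p, s)).2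
        = cubic (laxCoeff₁ c) s := by
      simp [Tetrad.laxM, cubic, Fin.sum_univ_four, hc]
    simp only [Prod.snd_add, Prod.smul_snd, hL, hM, smul_eq_mul, cubic_laxCoeff₀,
      cubic_laxCoeff₁, cubicDeriv_laxCoeff₀, cubicDeriv_laxCoeff₁]
    rw [vertDefect] at hv
    linear_combination -hv

end

/-! ### Jacobi and Bianchi identities -/

section

variable {𝕜 : Type*} [RCLike 𝕜]
variable {U : Set 𝕜} {e : Tetrad 𝕜} {E : Fin 4 → 𝕜 → Fin 4 → 𝕜}

theorem br_jacobi {x y z : 𝕜 → Fin 4 → 𝕜} {t : 𝕜} (hU : IsOpen U) (ht : t ∈ U)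
    (hx : ContDiffOn 𝕜 ∞ x U) (hy : ContDiffOn 𝕜 ∞ y U) (hz : ContDiffOn 𝕜 ∞ z U) :
    br x (br y z) t + br y (br z x) t + br z (br x y) t = 0 := by
  have key : ∀ {x y : 𝕜 → Fin 4 → 𝕜}, ContDiffOn 𝕜 ∞ x U → ContDiffOn 𝕜 ∞ y U →
      deriv (br x y) t = ![
        x t 0 * deriv (deriv y) t 0 - y t 0 * deriv (deriv x) t 0,
        deriv x t 0 * deriv y t 1 + x t 0 * deriv (deriv y) t 1
          - (deriv y t 0 * deriv x t 1 + y t 0 * deriv (deriv x) t 1)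
          + (deriv x t 1 * y t 2 + x t 1 * deriv y t 2 - (deriv x t 2 * y t 1 + x t 2 * deriv y t 1)),
        deriv x t 0 * deriv y t 2 + x t 0 * deriv (deriv y) t 2
          - (deriv y t 0 * deriv x t 2 + y t 0 * deriv (deriv x) t 2),
        deriv x t 0 * deriv y t 3 + x t 0 * deriv (deriv y) t 3
          - (deriv y t 0 * deriv x t 3 + y t 0 * deriv (deriv x) t 3)] := by
    intro x y hx hy
    have hd : ∀ {f : 𝕜 → Fin 4 → 𝕜}, ContDiffOn 𝕜 ∞ f U → ∀ i,
        HasDerivAt (fun s => f s i) (deriv f t i) t := fun hf i =>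
      hasDerivAt_pi.1 ((hf.differentiableOn (by simp)).differentiableAt
        (hU.mem_nhds ht)).hasDerivAt i
    have hx0 := hd hx
    have hy0 := hd hy
    have hx1 := hd (contDiffOn_deriv hU hx)
    have hy1 := hd (contDiffOn_deriv hU hy)
    refine (hasDerivAt_pi.2 fun i => ?_).deriv
    fin_cases i
    · refine (((hx0 0).mul (hy1 0)).sub ((hy0 0).mul (hx1 0))).congr_deriv ?_
      change _ = x t 0 * deriv (deriv y) t 0 - y t 0 * deriv (deriv x) t 0
      ring
    · exact (((hx0 0).mul (hy1 1)).sub ((hy0 0).mul (hx1 1))).add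
        (((hx0 1).mul (hy0 2)).sub ((hx0 2).mul (hy0 1)))
    · exact ((hx0 0).mul (hy1 2)).sub ((hy0 0).mul (hx1 2))
    · exact ((hx0 0).mul (hy1 3)).sub ((hy0 0).mul (hx1 3))
  change algBr (x t) (deriv x t) (br y z t) (deriv (br y z) t)
    + algBr (y t) (deriv y t) (br z x t) (deriv (br z x) t)
    + algBr (z t) (deriv z t) (br x y t) (deriv (br x y) t) = 0
  rw [key hy hz, key hz hx, key hx hy]
  ext i
  fin_cases i <;> simp [br, algBr] <;> ring

/-- The Jacobi identity for the structure functions of an invariant frame. -/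
theorem structC_jacobi (hU : IsOpen U) (hE : ∀ a, ContDiffOn 𝕜 ∞ (E a) U)
    (hdet : ∀ t ∈ U, (compMatrix E t).det ≠ 0) {t : 𝕜} (ht : t ∈ U) (a b k d : Fin 4) :
    (E a t 0 * deriv (structC E b k d) t + ∑ f, structC E b k f t * structC E a f d t)
    + (E b t 0 * deriv (structC E k a d) t + ∑ f, structC E k a f t * structC E b f d t)
    + (E k t 0 * deriv (structC E a b d) t + ∑ f, structC E a b f t * structC E k f d t) = 0 := by
  have key : ∀ a b k, br (E a) (br (E b) (E k)) t = ∑ d, (E a t 0 * deriv (structC E b k d) t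
      + ∑ f, structC E b k f t * structC E a f d t) • E d t := by
    intro a b k
    have h1 : br (E b) (E k) =ᶠ[nhds t] fun s => ∑ f, structC E b k f s • E f s := by
      filter_upwards [hU.mem_nhds ht] with s hs using structC_spec (hdet s hs) b k
    have h2 : HasDerivAt (br (E b) (E k)) (∑ f, (structC E b k f t • deriv (E f) t
        + deriv (structC E b k f) t • E f t)) t := by
      refine HasDerivAt.congr_of_eventuallyEq (HasDerivAt.fun_sum fun f _ => ?_) h1
      exact HasDerivAt.smul (((contDiffOn_structC hU hE hdet b k f).differentiableOn
        (by simp)).differentiableAt (hU.mem_nhds ht)).hasDerivAt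
        (((hE f).differentiableOn (by simp)).differentiableAt (hU.mem_nhds ht)).hasDerivAt
    have h3 : br (E a) (br (E b) (E k)) t = ∑ f, (structC E b k f t • br (E a) (E f) t
        + (E a t 0 * deriv (structC E b k f) t) • E f t) := by
      rw [br, h2.deriv, h1.self_of_nhds]
      ext i
      fin_cases i <;> simp [br, algBr, Fin.sum_univ_four, Matrix.vecHead, Matrix.vecTail] <;> ring
    rw [h3]
    simp only [structC_spec (hdet t ht), Fin.sum_univ_four]
    module
  have hJ := br_jacobi hU ht (hE a) (hE b) (hE k)
  rw [key, key, key, ← Finset.sum_add_distrib, ← Finset.sum_add_distrib] at hJ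
  simp only [← add_smul] at hJ
  rw [← compMatrix_mulVec] at hJ
  exact congrFun (Matrix.eq_zero_of_mulVec_eq_zero (hdet t ht) hJ) d

theorem algConn_torsion {c : Fin 4 → Fin 4 → Fin 4 → 𝕜} (hc : ∀ a b d, c b a d = - c a b d)
    (a b d : Fin 4) : algConn c a b d - algConn c b a d = c a b d := by
  have h := sum_structure_eta hc a b
  fin_cases d
  · have := h 1
    rw [sum_eta_one] at this
    simp only [Fin.zero_eta, algConn_zero]
    linear_combination this
  · have := h 0
    rw [sum_eta_zero] at this
    simp only [Fin.mk_one, algConn_one]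
    linear_combination this
  · have := h 3
    rw [sum_eta_three] at this
    simp only [Fin.reduceFinMk, algConn_two]
    linear_combination -this
  · have := h 2
    rw [sum_eta_two] at this
    simp only [Fin.reduceFinMk, algConn_three]
    linear_combination -this

/-- The first Bianchi identity, as a consequence of the Jacobi identity. -/
theorem algRiem_bianchi {c dc : Fin 4 → Fin 4 → Fin 4 → 𝕜} {u : Fin 4 → 𝕜}
    (hc : ∀ a b d, c b a d = - c a b d) (hdc : ∀ a b d, dc b a d = - dc a b d) {a b k d : Fin 4}
    (hJ : (u a * dc b k d + ∑ f, c b k f * c a f d) + (u b * dc k a d + ∑ f, c k a f * c b f d)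
      + (u k * dc a b d + ∑ f, c a b f * c k f d) = 0) :
    algRiem c dc u a b k d + algRiem c dc u b k a d + algRiem c dc u k a b d = 0 := by
  have h1 := algConn_torsion hc
  have h2 := algConn_torsion hdc
  simp only [← h1, ← h2, Fin.sum_univ_four] at hJ
  simp only [algRiem, Fin.sum_univ_four, ← h1]
  linear_combination hJ

theorem algRiemLow_antisymm_right {c dc : Fin 4 → Fin 4 → Fin 4 → 𝕜} {u : Fin 4 → 𝕜}
    (hc : ∀ a b d, c b a d = - c a b d) (hdc : ∀ a b d, dc b a d = - dc a b d) (a b k d : Fin 4) :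
    algRiemLow c dc u a b d k = - algRiemLow c dc u a b k d := by
  have hA := algConnLow_antisymm hc
  have hB := algConnLow_antisymm hdc
  have hlow : ∀ (x : Fin 4 → Fin 4 → Fin 4 → 𝕜) (k d : Fin 4) (a : Fin 4),
      ∑ f, algConn x a k f * eta 𝕜 f d = algConnLow x a k d := by
    intro x k d a
    fin_cases d
    · simp [sum_eta_zero, algConn_one]
    · simp [sum_eta_one, algConn_zero]
    · simp [sum_eta_two, algConn_three]
    · simp [sum_eta_three, algConn_two]
  have h : ∀ k d, algRiemLow c dc u a b k d = u a * algConnLow dc b k d - u b * algConnLow dc a k d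
      + ∑ f, (algConn c b k f * algConnLow c a f d - algConn c a k f * algConnLow c b f d)
      - ∑ f, c a b f * algConnLow c f k d := by
    intro k d
    simp only [← hlow, algRiemLow, algRiem, Fin.sum_univ_four]
    ring
  rw [h, h]
  simp only [Fin.sum_univ_four, algConn_zero, algConn_one, algConn_two, algConn_three, hA _ k d, hB _ k d,
    hA _ d 0, hA _ d 1, hA _ d 2, hA _ d 3, hA _ k 0, hA _ k 1, hA _ k 2, hA _ k 3]
  ring

end

/-! ### From the vertical defect to anti-self-duality -/

section

variable {𝕜 : Type*} [RCLike 𝕜]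
variable {U : Set 𝕜} {e : Tetrad 𝕜} {E : Fin 4 → 𝕜 → Fin 4 → 𝕜}

theorem quartic_coeff_eq_zero {a₀ a₁ a₂ a₃ a₄ : 𝕜}
    (h : ∀ s : 𝕜, a₀ + a₁ * s + a₂ * s ^ 2 + a₃ * s ^ 3 + a₄ * s ^ 4 = 0) :
    a₀ = 0 ∧ a₁ = 0 ∧ a₂ = 0 ∧ a₃ = 0 ∧ a₄ = 0 := by
  have h0 := h 0
  have h1 := h 1
  have h2 := h (-1)
  have h3 := h 2
  have h4 := h (-2)
  refine ⟨?_, ?_, ?_, ?_, ?_⟩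
  · linear_combination h0
  · linear_combination 2 / 3 * h1 - 2 / 3 * h2 - 1 / 12 * h3 + 1 / 12 * h4
  · linear_combination -5 / 4 * h0 + 2 / 3 * h1 + 2 / 3 * h2 - 1 / 24 * h3 - 1 / 24 * h4
  · linear_combination -1 / 6 * h1 + 1 / 6 * h2 + 1 / 12 * h3 - 1 / 12 * h4
  · linear_combination 1 / 4 * h0 - 1 / 6 * h1 - 1 / 6 * h2 + 1 / 24 * h3 + 1 / 24 * h4

/-- The pair symmetry of the curvature tensor, from its antisymmetries and the first Bianchi
identity. -/
theorem pair_symm_of_bianchi {R : Fin 4 → Fin 4 → Fin 4 → Fin 4 → 𝕜}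
    (h₁ : ∀ a b k d, R b a k d = - R a b k d) (h₂ : ∀ a b k d, R a b d k = - R a b k d)
    (h₃ : ∀ a b k d, R a b k d + R b k a d + R k a b d = 0) (a b k d : Fin 4) :
    R a b k d = R k d a b := by
  linear_combination (1 / 2) * (h₃ b k a d + h₃ k a d b + h₃ a d b k + h₃ d b k a)
    - (1 / 2) * (h₂ k a b d + h₂ a d k b + h₂ d b a k + h₂ b k a d + h₁ k d a b + h₁ a b d k
      - h₂ a b k d + h₂ k d a b)

set_option maxHeartbeats 1000000 in
/-- Conversely, the vertical part of the integrability condition implies anti-self-duality: by the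
symmetries of the curvature tensor the self-dual part of the Weyl tensor has only five independent
components, and these are the coefficients of `vertDefect`. -/
theorem Tetrad.HasComponents.isASD_of_vertDefect (hU : IsOpen U) (he : e.HasComponents U E)
    (hE : ∀ a, ContDiffOn 𝕜 ∞ (E a) U) (hdet : ∀ t ∈ U, (compMatrix E t).det ≠ 0)
    (h : ∀ t ∈ U, ∀ s, vertDefect (fun a b d => structC E a b d t)
      (fun a b d => deriv (structC E a b d) t) (fun a => E a t 0) s = 0) :
    e.IsASD (cyl U) := by
  rw [he.isASD_iff hU hE hdet]
  intro p hp
  have hc := fun a b d => structC_swap (E := E) a b d (p 0)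
  have hdc := fun a b d => deriv_structC_swap (E := E) a b d (p 0)
  obtain ⟨R, hR⟩ : ∃ R, R = algRiemLow (fun a b d => structC E a b d (p 0))
      (fun a b d => deriv (structC E a b d) (p 0)) (fun a => E a (p 0) 0) := ⟨_, rfl⟩
  have h₁ : ∀ a b k d, R b a k d = - R a b k d := fun a b k d => by
    simp only [hR, algRiemLow, algRiem_antisymm _ hc a b, neg_mul, Finset.sum_neg_distrib]
  have h₂ : ∀ a b k d, R a b d k = - R a b k d := fun a b k d => by
    rw [hR]; exact algRiemLow_antisymm_right hc hdc a b k d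
  have h₃ : ∀ a b k d, R a b k d + R b k a d + R k a b d = 0 := fun a b k d => by
    simp only [hR, algRiemLow, ← Finset.sum_add_distrib, ← add_mul]
    refine Finset.sum_eq_zero fun f _ => ?_
    rw [algRiem_bianchi hc hdc (structC_jacobi hU hE hdet hp a b k f), zero_mul]
  have h₄ := pair_symm_of_bianchi h₁ h₂ h₃
  have hrl : ∀ a b k d, e.riemLow a b k d p = R a b k d := fun a b k d => by
    rw [he.riemLow_eq hU hE hdet hp, hR]
  have r0 : ∀ a b k, e.riem a b k 0 p = - R a b k 1 := fun a b k => by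
    rw [← hrl, Tetrad.riemLow, sum_eta_one, neg_neg]
  have r1 : ∀ a b k, e.riem a b k 1 p = - R a b k 0 := fun a b k => by
    rw [← hrl, Tetrad.riemLow, sum_eta_zero, neg_neg]
  have r2 : ∀ a b k, e.riem a b k 2 p = R a b k 3 := fun a b k => by
    rw [← hrl, Tetrad.riemLow, sum_eta_three]
  have r3 : ∀ a b k, e.riem a b k 3 p = R a b k 2 := fun a b k => by
    rw [← hrl, Tetrad.riemLow, sum_eta_two]
  have hpsi : ∀ s : 𝕜, R 3 1 3 1 + (-(R 3 1 3 2 + R 3 1 0 1 + R 3 2 3 1 + R 0 1 3 1)) * s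
      + (R 3 1 0 2 + R 0 2 3 1 + R 3 2 3 2 + R 3 2 0 1 + R 0 1 3 2 + R 0 1 0 1) * s ^ 2
      + (-(R 0 2 3 2 + R 0 2 0 1 + R 3 2 0 2 + R 0 1 0 2)) * s ^ 3 + R 0 2 0 2 * s ^ 4 = 0 := by
    intro s
    have := vertDefect_eq (fun a => E a (p 0) 0) s hc hdc
    rw [h _ hp s, ← hR] at this
    linear_combination -this
  obtain ⟨q0, q1, q2, q3, q4⟩ := quartic_coeff_eq_zero hpsi
  clear hpsi hR
  have z1 : ∀ a k d, R a a k d = 0 := fun a k d => self_eq_neg.1 (h₁ a a k d)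
  have z2 : ∀ a b k, R a b k k = 0 := fun a b k => self_eq_neg.1 (h₂ a b k k)
  -- the symmetries express all components of `R` in terms of twenty of them
  have n1 := h₁ 0 1
  have n2 := h₁ 0 2
  have n3 := h₁ 0 3
  have n4 := h₁ 1 2
  have n5 := h₁ 1 3
  have n6 := h₁ 2 3
  have m1 := fun a b => h₂ a b 0 1
  have m2 := fun a b => h₂ a b 0 2
  have m3 := fun a b => h₂ a b 0 3
  have m4 := fun a b => h₂ a b 1 2
  have m5 := fun a b => h₂ a b 1 3
  have m6 := fun a b => h₂ a b 2 3
  have l1 := h₄ 0 2 0 1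
  have l2 := h₄ 0 3 0 1
  have l3 := h₄ 1 2 0 1
  have l4 := h₄ 1 3 0 1
  have l5 := h₄ 2 3 0 1
  have l6 := h₄ 0 3 0 2
  have l7 := h₄ 1 2 0 2
  have l8 := h₄ 1 3 0 2
  have l9 := h₄ 2 3 0 2
  have l10 := h₄ 1 2 0 3
  have l11 := h₄ 1 3 0 3
  have l12 := h₄ 2 3 0 3
  have l13 := h₄ 1 3 1 2
  have l14 := h₄ 2 3 1 2
  have l15 := h₄ 2 3 1 3
  have b1 : R 0 3 1 2 = R 0 2 1 3 - R 0 1 2 3 := by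
    linear_combination h₃ 0 1 2 3 - l10 - n2 1 3
  simp only [n5, n6, m5, m6, l1, l4, l5, l8, l9, l15] at q0 q1 q2 q3 q4
  have p0 : R 1 3 1 3 = 0 := by linear_combination q0
  have p1 : R 1 3 2 3 = R 0 1 1 3 := by linear_combination -q1 / 2
  have p2 : R 0 2 1 3 = R 0 1 0 1 / 2 + R 2 3 2 3 / 2 - R 0 1 2 3 := by linear_combination -q2 / 2
  have p3 : R 0 2 2 3 = R 0 1 0 2 := by linear_combination q3 / 2
  have p4 : R 0 2 0 2 = 0 := by linear_combination q4
  intro k d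
  refine ⟨?_, ?_, ?_⟩ <;> fin_cases k <;> fin_cases d <;>
  · simp only [Tetrad.weyl, hrl, Tetrad.schouten, Tetrad.scal, Tetrad.ricci, Fin.sum_univ_four,
      r0, r1, r2, r3, eta]
    simp [z1, z2, n1, n2, n3, n4, n5, n6, m1, m2, m3, m4, m5, m6, l1, l2, l3, l4, l5, l6, l7, l8,
      l9, l10, l11, l12, l13, l14, l15, b1, p0, p1, p2, p3, p4]
    try ring

end

/-! ### The reduced equations -/

section

variable {𝕜 : Type*} [RCLike 𝕜] {U : Set 𝕜}

/-- The components of the tetrad `W = -P`, `W̃ = Q`, `Z = T - R`, `Z̃ = T + R`. -/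
def compOf (T P Q R : 𝕜 → Fin 4 → 𝕜) : Fin 4 → 𝕜 → Fin 4 → 𝕜 := ![-P, Q, T - R, T + R]

/-- The components of invariant fields `T`, `P`, `Q`, `R` of which the last three are tangent to
the orbits, while `T` is transversal to them. -/
structure IsSplit (U : Set 𝕜) (T P Q R : 𝕜 → Fin 4 → 𝕜) : Prop where
  smooth_T : ContDiffOn 𝕜 ∞ T U
  smooth_P : ContDiffOn 𝕜 ∞ P U
  smooth_Q : ContDiffOn 𝕜 ∞ Q U
  smooth_R : ContDiffOn 𝕜 ∞ R U
  T_ne : ∀ t ∈ U, T t 0 ≠ 0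
  P_zero : ∀ t ∈ U, P t 0 = 0
  Q_zero : ∀ t ∈ U, Q t 0 = 0
  R_zero : ∀ t ∈ U, R t 0 = 0

/-- The reduced equations `[T, Q] = [Q, R] + P`, `2 [T, R] = [Q, P]`, `[T, P] = [R, P]`. -/
def ReducedEqs (U : Set 𝕜) (T P Q R : 𝕜 → Fin 4 → 𝕜) : Prop :=
  ∀ t ∈ U, br T Q t = br Q R t + P t ∧ (2 : 𝕜) • br T R t = br Q P t ∧ br T P t = br R P t

variable {T P Q R : 𝕜 → Fin 4 → 𝕜}

theorem IsSplit.smooth_compOf (h : IsSplit U T P Q R) (a : Fin 4) :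
    ContDiffOn 𝕜 ∞ (compOf T P Q R a) U := by
  fin_cases a
  · exact h.smooth_P.neg
  · exact h.smooth_Q
  · exact h.smooth_T.sub h.smooth_R
  · exact h.smooth_T.add h.smooth_R

theorem differentiableAt_of_contDiffOn {F : Type*} [NormedAddCommGroup F] [NormedSpace 𝕜 F]
    {f : 𝕜 → F} (hU : IsOpen U) (hf : ContDiffOn 𝕜 ∞ f U) {t : 𝕜} (ht : t ∈ U) :
    DifferentiableAt 𝕜 f t :=
  (hf.differentiableOn (by simp)).differentiableAt (hU.mem_nhds ht)

theorem deriv_apply_eq_zero {x : 𝕜 → Fin 4 → 𝕜} (hU : IsOpen U) (hx : ContDiffOn 𝕜 ∞ x U)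
    {i : Fin 4} (h0 : ∀ t ∈ U, x t i = 0) {t : 𝕜} (ht : t ∈ U) : deriv x t i = 0 := by
  have h1 := hasDerivAt_pi.1 (differentiableAt_of_contDiffOn hU hx ht).hasDerivAt i
  have h2 : (fun s => x s i) =ᶠ[nhds t] fun _ => 0 := by
    filter_upwards [hU.mem_nhds ht] with s hs using h0 s hs
  rw [← h1.deriv, h2.deriv_eq, deriv_const]

theorem br_apply_zero_eq_zero {x y : 𝕜 → Fin 4 → 𝕜} (hU : IsOpen U) (hy : ContDiffOn 𝕜 ∞ y U)
    (hy0 : ∀ t ∈ U, y t 0 = 0) {t : 𝕜} (ht : t ∈ U) : br x y t 0 = 0 := by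
  simp [br, algBr, hy0 t ht, deriv_apply_eq_zero hU hy hy0 ht]

/-- The bracket `[Z̃ - s W, W̃ - s Z]` as a polynomial in `s`. -/
theorem algBr_compOf (hU : IsOpen U) (h : IsSplit U T P Q R) {t : 𝕜} (ht : t ∈ U) (s : 𝕜) :
    algBr (compOf T P Q R 3 t - s • compOf T P Q R 0 t)
      (deriv (compOf T P Q R 3) t - s • deriv (compOf T P Q R 0) t)
      (compOf T P Q R 1 t - s • compOf T P Q R 2 t)
      (deriv (compOf T P Q R 1) t - s • deriv (compOf T P Q R 2) t)
    = (br T Q t - br Q R t) + s • ((2 : 𝕜) • br T R t - br Q P t) + s ^ 2 • (br T P t - br R P t) := by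
  have dT := differentiableAt_of_contDiffOn hU h.smooth_T ht
  have dR := differentiableAt_of_contDiffOn hU h.smooth_R ht
  have h0 : deriv (compOf T P Q R 0) t = - deriv P t := deriv.neg
  have h2 : deriv (compOf T P Q R 2) t = deriv T t - deriv R t := deriv_sub dT dR
  have h3 : deriv (compOf T P Q R 3) t = deriv T t + deriv R t := deriv_add dT dR
  have h1 : deriv (compOf T P Q R 1) t = deriv Q t := rfl
  rw [h0, h1, h2, h3]
  ext i
  fin_cases i <;> simp [compOf, br, algBr, Matrix.vecHead, Matrix.vecTail] <;> ring

theorem constCubic_lax {e : Tetrad 𝕜} (hU : IsOpen U) (h : IsSplit U T P Q R)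
    (he : e.HasComponents U (compOf T P Q R)) {p : Pt 𝕜} (hp : p ∈ cyl U) (s : 𝕜) :
    VectorField.lieBracket 𝕜 (e.laxL (Tetrad.constCubic 0)) (e.laxM (Tetrad.constCubic 1)) (p, s)
      = (lift p ((br T Q (p 0) - br Q R (p 0) - P (p 0))
        + s • ((2 : 𝕜) • br T R (p 0) - br Q P (p 0)) + s ^ 2 • (br T P (p 0) - br R P (p 0))), 0) := by
  rw [lieBracket_lax hU he (fun a => (h.smooth_compOf a).differentiableOn (by simp))
    (f₀ := Tetrad.constCubic 0) (f₁ := Tetrad.constCubic 1)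
    (g₀ := fun i _ => if i = 0 then 0 else 0) (g₁ := fun i _ => if i = 0 then 1 else 0)
    (fun i p _ => rfl) (fun i p _ => rfl) (fun i => differentiableOn_const _)
    (fun i => differentiableOn_const _) hp rfl, algBr_compOf hU h hp]
  refine Prod.ext ?_ ?_
  · simp only
    congr 1
    simp [cubic, compOf]
    abel
  · simp [cubic, cubicDeriv]

/-- For a tetrad `W = -P`, `W̃ = Q`, `Z = T - R`, `Z̃ = T + R`, integrability with `f₀ = 0`, `f₁ = 1`
amounts to the reduced equations: `[l, m]` has no `∂_s`-component and is tangent to the orbits, hence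
it must vanish. -/
theorem isLaxPair_constCubic_iff {e : Tetrad 𝕜} (hU : IsOpen U) (h : IsSplit U T P Q R)
    (he : e.HasComponents U (compOf T P Q R)) :
    e.IsLaxPair (cyl U) (Tetrad.constCubic 0) (Tetrad.constCubic 1) ↔ ReducedEqs U T P Q R := by
  have hL : ∀ p ∈ cyl U, ∀ s, e.laxL (Tetrad.constCubic 0) (p, s)
      = (lift p (T (p 0) + R (p 0) + s • P (p 0)), 0) := by
    intro p hp s
    refine Prod.ext ?_ ?_
    · change e.frame 3 p - s • e.frame 0 p = _
      rw [he 3 p hp, he 0 p hp, invField, invField, ← map_smul, ← map_sub]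
      simp [compOf]
    · simp [Tetrad.laxL, Tetrad.constCubic]
  have hM : ∀ p s, (e.laxM (Tetrad.constCubic 1) (p, s)).2 = 1 := fun p s => by
    simp [Tetrad.laxM, Tetrad.constCubic]
  constructor
  · rintro ⟨-, H⟩ t ht
    have hp : (![t, 0, 0, 0] : Pt 𝕜) ∈ cyl U := ht
    have key : ∀ s : 𝕜, (br T Q t - br Q R t - P t) + s • ((2 : 𝕜) • br T R t - br Q P t)
        + s ^ 2 • (br T P t - br R P t) = 0 := by
      intro s
      have H1 := H (![t, 0, 0, 0], s) hp
      rw [constCubic_lax hU h he hp, Submodule.mem_span_pair] at H1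
      obtain ⟨α, β, H2⟩ := H1
      have h2 := congrArg Prod.snd H2
      rw [hL _ hp] at h2
      have hβ : β = 0 := by simpa [hM] using h2
      rw [hβ, zero_smul, add_zero, hL _ hp] at H2
      have h1 := congrArg Prod.fst H2
      simp only [Prod.smul_fst, ← map_smul] at h1
      have h1 := lift_injective _ h1
      have hα : α = 0 := by
        have h3 := congrFun h1 0
        have e1 := br_apply_zero_eq_zero (x := T) hU h.smooth_Q h.Q_zero ht
        have e2 := br_apply_zero_eq_zero (x := Q) hU h.smooth_R h.R_zero ht
        have e3 := br_apply_zero_eq_zero (x := T) hU h.smooth_R h.R_zero ht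
        have e4 := br_apply_zero_eq_zero (x := Q) hU h.smooth_P h.P_zero ht
        have e5 := br_apply_zero_eq_zero (x := T) hU h.smooth_P h.P_zero ht
        have e6 := br_apply_zero_eq_zero (x := R) hU h.smooth_P h.P_zero ht
        simpa [e1, e2, e3, e4, e5, e6, h.P_zero t ht, h.R_zero t ht, h.T_ne t ht] using h3
      rw [hα, zero_smul] at h1
      exact h1.symm
    have c : ∀ i, _ := fun i => quartic_coeff_eq_zero (𝕜 := 𝕜)
      (a₀ := (br T Q t - br Q R t - P t) i)
      (a₁ := ((2 : 𝕜) • br T R t - br Q P t) i) (a₂ := (br T P t - br R P t) i) (a₃ := 0) (a₄ := 0)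
      fun s => by
        have := congrFun (key s) i
        simp only [Pi.add_apply, Pi.smul_apply, smul_eq_mul, Pi.zero_apply] at this
        linear_combination this
    refine ⟨?_, ?_, ?_⟩
    · ext i
      have := (c i).1
      simp only [Pi.sub_apply, Pi.add_apply] at this ⊢
      linear_combination this
    · ext i
      have := (c i).2.1
      rw [Pi.sub_apply] at this
      linear_combination this
    · ext i
      have := (c i).2.2.1
      rw [Pi.sub_apply] at this
      linear_combination this
  · intro H
    refine ⟨fun i => ⟨contDiffOn_const, contDiffOn_const⟩, ?_⟩
    rintro ⟨p, s⟩ hp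
    obtain ⟨h1, h2, h3⟩ := H (p 0) hp
    rw [constCubic_lax hU h he hp, h1, h2, h3]
    simp only [add_sub_cancel_left, sub_self, smul_zero, add_zero, map_zero]
    exact Submodule.zero_mem _

end

section

variable {𝕜 : Type*} [RCLike 𝕜] {U : Set 𝕜} {T P Q R : 𝕜 → Fin 4 → 𝕜}

/-- For a tetrad `W = -P`, `W̃ = Q`, `Z = T - R`, `Z̃ = T + R` the reduced equations imply
anti-self-duality. -/
theorem ReducedEqs.isASD {e : Tetrad 𝕜} (hU : IsOpen U) (h : IsSplit U T P Q R)
    (he : e.HasComponents U (compOf T P Q R)) (hdet : ∀ t ∈ U, (compMatrix (compOf T P Q R) t).det ≠ 0)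
    (hred : ReducedEqs U T P Q R) : e.IsASD (cyl U) := by
  set E := compOf T P Q R with hE
  have hg : ∀ t ∈ U, ∀ s, twistG (fun a b d => structC E a b d t) s = ![-1, 0, 0, 0] := by
    intro t ht s
    have h1 := algBr_twist (hdet t ht) s
    obtain ⟨e1, e2, e3⟩ := hred t ht
    rw [algBr_compOf hU h ht, e1, e2, e3, ← compMatrix_mulVec] at h1
    have h2 : (compMatrix E t).mulVec ![-1, 0, 0, 0] = P t := by
      rw [compMatrix_mulVec]
      simp [Fin.sum_univ_four, hE, compOf]
    simp only [add_sub_cancel_left, sub_self, smul_zero, add_zero] at h1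
    rw [← sub_eq_zero]
    refine Matrix.eq_zero_of_mulVec_eq_zero (hdet t ht) ?_
    rw [Matrix.mulVec_sub, ← h1, h2, sub_self]
  -- hence the three brackets making up `[Z̃ - s W, W̃ - s Z]` have constant components
  have hcoef : ∀ t ∈ U, ∀ d, structC E 3 1 d t = (![-1, 0, 0, 0] : Fin 4 → 𝕜) d ∧
      structC E 3 2 d t + structC E 0 1 d t = 0 ∧ structC E 0 2 d t = 0 := by
    intro t ht d
    have := quartic_coeff_eq_zero (a₀ := structC E 3 1 d t - (![-1, 0, 0, 0] : Fin 4 → 𝕜) d)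
      (a₁ := -(structC E 3 2 d t + structC E 0 1 d t)) (a₂ := structC E 0 2 d t) (a₃ := 0) (a₄ := 0)
      fun s => by
        have := congrFun (hg t ht s) d
        rw [twistG] at this
        linear_combination this
    exact ⟨sub_eq_zero.1 this.1, neg_eq_zero.1 this.2.1, this.2.2.1⟩
  refine he.isASD_of_vertDefect hU h.smooth_compOf hdet fun t ht s => ?_
  have hev : ∀ᶠ r in nhds t, r ∈ U := hU.mem_nhds ht
  have hd : ∀ a b d, DifferentiableAt 𝕜 (structC E a b d) t := fun a b d =>
    differentiableAt_of_contDiffOn hU (contDiffOn_structC hU h.smooth_compOf hdet a b d) ht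
  have d1 : ∀ d, deriv (structC E 3 1 d) t = 0 := fun d => by
    rw [Filter.EventuallyEq.deriv_eq (hev.mono fun r hr => (hcoef r hr d).1), deriv_const]
  have d2 : ∀ d, deriv (structC E 3 2 d) t + deriv (structC E 0 1 d) t = 0 := fun d => by
    have : (fun r => structC E 3 2 d r + structC E 0 1 d r) =ᶠ[nhds t] fun _ => 0 :=
      hev.mono fun r hr => (hcoef r hr d).2.1
    rw [← deriv_fun_add (hd 3 2 d) (hd 0 1 d), this.deriv_eq, deriv_const]
  have d3 : ∀ d, deriv (structC E 0 2 d) t = 0 := fun d => by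
    have : structC E 0 2 d =ᶠ[nhds t] fun _ => 0 := hev.mono fun r hr => (hcoef r hr d).2.2
    rw [this.deriv_eq, deriv_const]
  have hdg : ∀ d, twistG (fun a b d => deriv (structC E a b d) t) s d = 0 := fun d => by
    simp [twistG, d1, d2, d3]
  have hgd : ∀ d, twistGDeriv (fun a b d => structC E a b d t) s d = 0 := fun d => by
    simp [twistGDeriv, (hcoef t ht d).2.1, (hcoef t ht d).2.2]
  simp [vertDefect, hdg, hgd, hg t ht]

/-- The twistor quartic is `f₀ dt(m) - f₁ dt(l)`, up to the determinant of the frame. -/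
theorem twistorQuartic_eq (e : Tetrad 𝕜) (f₀ f₁ : Fin 4 → Pt 𝕜 → 𝕜) (p : Pt 𝕜) (s : 𝕜) :
    e.twistorQuartic f₀ f₁ p s = (e.frameMatrix p).det⁻¹ *
      ((∑ i : Fin 4, f₀ i p * s ^ (i : ℕ)) * (e.Wt p 0 - s * e.Z p 0)
        - (∑ i : Fin 4, f₁ i p * s ^ (i : ℕ)) * (e.Zt p 0 - s * e.W p 0)) := by
  have key : ∀ w : Fin 4 → Pt 𝕜, Matrix.det (Matrix.of fun i j => e.coords p (w i) j)
      = (e.frameMatrix p).det⁻¹ * Matrix.det (Matrix.of w) := by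
    intro w
    have : Matrix.of (fun i j => e.coords p (w i) j)
        = Matrix.of w * ((e.frameMatrix p)⁻¹).transpose := by
      ext i j
      simp [Tetrad.coords, Matrix.mulVec, dotProduct, Matrix.mul_apply, mul_comm]
    rw [this, Matrix.det_mul, Matrix.det_transpose, Matrix.det_nonsing_inv, Ring.inverse_eq_inv',
      mul_comm]
  have k1 := key ![(e.laxM f₁ (p, s)).1, rightField 0 p, rightField 1 p, rightField 2 p]
  have k2 := key ![(e.laxL f₀ (p, s)).1, rightField 0 p, rightField 1 p, rightField 2 p]
  have r1 : Matrix.det (Matrix.of ![(e.laxM f₁ (p, s)).1, rightField 0 p, rightField 1 p,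
      rightField 2 p]) = (e.laxM f₁ (p, s)).1 0 := by
    simp [det_fin_four, rightField]
  have r2 : Matrix.det (Matrix.of ![(e.laxL f₀ (p, s)).1, rightField 0 p, rightField 1 p,
      rightField 2 p]) = (e.laxL f₀ (p, s)).1 0 := by
    simp [det_fin_four, rightField]
  rw [r1] at k1
  rw [r2] at k2
  simp only [Tetrad.twistorQuartic]
  rw [Matrix.det_succ_column_zero, Fin.sum_univ_succ, Fin.sum_univ_succ, Finset.sum_eq_zero]
  · have m1 : ∀ A B : Pt 𝕜 × 𝕜, (Matrix.of fun i j : Fin 5 =>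
        (Fin.cons ((![A, B, (rightField 0 p, 0), (rightField 1 p, 0), (rightField 2 p, 0)] :
          Fin 5 → Pt 𝕜 × 𝕜) i).2 (e.coords p ((![A, B, (rightField 0 p, 0), (rightField 1 p, 0),
          (rightField 2 p, 0)] : Fin 5 → Pt 𝕜 × 𝕜) i).1) : Fin 5 → 𝕜) j).submatrix
          (Fin.succAbove 0) Fin.succ = Matrix.of fun i j => e.coords p
            ((![B.1, rightField 0 p, rightField 1 p, rightField 2 p] : Fin 4 → Pt 𝕜) i) j := by
      intro A B
      ext i j
      fin_cases i <;> rfl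
    have m2 : ∀ A B : Pt 𝕜 × 𝕜, (Matrix.of fun i j : Fin 5 =>
        (Fin.cons ((![A, B, (rightField 0 p, 0), (rightField 1 p, 0), (rightField 2 p, 0)] :
          Fin 5 → Pt 𝕜 × 𝕜) i).2 (e.coords p ((![A, B, (rightField 0 p, 0), (rightField 1 p, 0),
          (rightField 2 p, 0)] : Fin 5 → Pt 𝕜 × 𝕜) i).1) : Fin 5 → 𝕜) j).submatrix
          (Fin.succAbove (Fin.succ 0)) Fin.succ = Matrix.of fun i j => e.coords p
            ((![A.1, rightField 0 p, rightField 1 p, rightField 2 p] : Fin 4 → Pt 𝕜) i) j := by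
      intro A B
      ext i j
      fin_cases i <;> rfl
    rw [m1, m2, k1, k2]
    simp [Tetrad.laxL, Tetrad.laxM]
    ring
  · intro i _
    fin_cases i <;> simp

theorem Tetrad.sum_coords {e : Tetrad 𝕜} {p : Pt 𝕜} (h : (e.frameMatrix p).det ≠ 0) (v : Pt 𝕜) :
    ∑ a, e.coords p v a • e.frame a p = v := by
  rw [← frameMatrix_mulVec, Tetrad.coords, Matrix.mulVec_mulVec,
    Matrix.mul_nonsing_inv _ (isUnit_iff_ne_zero.2 h), Matrix.one_mulVec]

/-! ### The normal form -/

/-- The components of `∂_t`. -/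
def compT : 𝕜 → Fin 4 → 𝕜 := fun _ => ![1, 0, 0, 0]

/-- The components of `P` in the normal form. -/
def compP (F : 𝕜 → 𝕜) : 𝕜 → Fin 4 → 𝕜 := fun t => ![0, 1 / 2 * F t, 1, 0]

/-- The components of `Q` in the normal form. -/
def compQ (c₁ c₂ : 𝕜) (F : 𝕜 → 𝕜) : 𝕜 → Fin 4 → 𝕜 := fun t =>
  ![0, 1 / 2 * (c₁ ^ 2 + t) * F t + c₁ * deriv F t + deriv (deriv F) t, c₁ ^ 2 + t, c₂]

/-- The components of `R` in the normal form. -/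
def compR (c₁ : 𝕜) (F : 𝕜 → 𝕜) : 𝕜 → Fin 4 → 𝕜 := fun t =>
  ![0, 1 / 2 * (c₁ * F t + deriv F t), c₁, 1]

theorem dtField_eq_invField : (dtField : VField 𝕜) = invField compT := by
  funext p; exact dtField_eq p

theorem fieldP_eq_invField (F : 𝕜 → 𝕜) : fieldP F id leftField = invField (compP F) := by
  funext p
  rw [fieldP, leftField_zero_eq, leftField_one_eq, ← map_smul, ← map_add, invField]
  congr 1
  ext i; fin_cases i <;> simp [compP]

theorem fieldQ_eq_invField (c₁ c₂ : 𝕜) (F : 𝕜 → 𝕜) :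
    fieldQ c₁ c₂ F id leftField = invField (compQ c₁ c₂ F) := by
  funext p
  rw [fieldQ, leftField_zero_eq, leftField_one_eq, leftField_two_eq, ← map_smul, ← map_smul,
    ← map_smul, ← map_add, ← map_add, invField]
  congr 1
  ext i; fin_cases i <;> simp [compQ]

theorem fieldR_eq_invField (c₁ : 𝕜) (F : 𝕜 → 𝕜) :
    fieldR c₁ F id leftField = invField (compR c₁ F) := by
  funext p
  rw [fieldR, leftField_zero_eq, leftField_one_eq, leftField_two_eq, ← map_smul, ← map_smul,
    ← map_add, ← map_add, invField]
  congr 1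
  ext i; fin_cases i <;> simp [compR]

/-- The tetrad built from invariant fields. -/
theorem tetradOf_frame {T' P' Q' R' : VField 𝕜} {p : Pt 𝕜} (hT : T' p = invField T p)
    (hP : P' p = invField P p) (hQ : Q' p = invField Q p) (hR : R' p = invField R p) (a : Fin 4) :
    (tetradOf T' P' Q' R').frame a p = invField (compOf T P Q R a) p := by
  have h1 : ∀ x y : 𝕜 → Fin 4 → 𝕜, invField (x + y) p = invField x p + invField y p := fun x y =>
    map_add (lift p) _ _
  have h2 : ∀ x y : 𝕜 → Fin 4 → 𝕜, invField (x - y) p = invField x p - invField y p := fun x y =>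
    map_sub (lift p) _ _
  have h3 : ∀ x : 𝕜 → Fin 4 → 𝕜, invField (-x) p = -invField x p := fun x => map_neg (lift p) _
  fin_cases a
  · change (-P') p = invField (-P) p
    rw [h3, Pi.neg_apply, hP]
  · exact hQ
  · change (T' - R') p = invField (T - R) p
    rw [h2, Pi.sub_apply, hT, hR]
  · change (T' + R') p = invField (T + R) p
    rw [h1, Pi.add_apply, hT, hR]

theorem normalTetrad_frame (c₁ c₂ : 𝕜) (F : 𝕜 → 𝕜) (a : Fin 4) :
    (normalTetrad c₁ c₂ F id dtField leftField).frame a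
      = invField (compOf compT (compP F) (compQ c₁ c₂ F) (compR c₁ F) a) := by
  funext p
  exact tetradOf_frame (by rw [dtField_eq_invField]) (by rw [fieldP_eq_invField])
    (by rw [fieldQ_eq_invField]) (by rw [fieldR_eq_invField]) a

theorem isSplit_comp (hU : IsOpen U) {F : 𝕜 → 𝕜} (hF : ContDiffOn 𝕜 ∞ F U) (c₁ c₂ : 𝕜) :
    IsSplit U compT (compP F) (compQ c₁ c₂ F) (compR c₁ F) where
  smooth_T := contDiffOn_const
  smooth_P := contDiffOn_pi.2 fun i => by
    fin_cases i
    · exact contDiffOn_const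
    · exact contDiffOn_const.mul hF
    · exact contDiffOn_const
    · exact contDiffOn_const
  smooth_Q := contDiffOn_pi.2 fun i => by
    have h1 := contDiffOn_deriv hU hF
    have h2 := contDiffOn_deriv hU h1
    have h3 : ContDiffOn 𝕜 ∞ (fun t : 𝕜 => c₁ ^ 2 + t) U := contDiffOn_const.add contDiffOn_id
    fin_cases i
    · exact contDiffOn_const
    · exact (((contDiffOn_const.mul h3).mul hF).add (contDiffOn_const.mul h1)).add h2
    · exact h3
    · exact contDiffOn_const
  smooth_R := contDiffOn_pi.2 fun i => by
    have h1 := contDiffOn_deriv hU hF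
    fin_cases i
    · exact contDiffOn_const
    · exact contDiffOn_const.mul ((contDiffOn_const.mul hF).add h1)
    · exact contDiffOn_const
    · exact contDiffOn_const
  T_ne := fun t _ => one_ne_zero
  P_zero := fun t _ => rfl
  Q_zero := fun t _ => rfl
  R_zero := fun t _ => rfl

/-- All components of the reduced equations hold identically for the normal form, except for the
`L₁`-component of the equation for `Q`, which is the Airy equation. -/
theorem reducedEqs_iff_isAiryOn (hU : IsOpen U) {F : 𝕜 → 𝕜} (hF : ContDiffOn 𝕜 ∞ F U)
    (c₁ c₂ : 𝕜) :
    ReducedEqs U compT (compP F) (compQ c₁ c₂ F) (compR c₁ F) ↔ IsAiryOn (deriv F) U := by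
  refine forall₂_congr fun t ht => ?_
  have f0 := (differentiableAt_of_contDiffOn hU hF ht).hasDerivAt
  have f1 := (differentiableAt_of_contDiffOn hU (contDiffOn_deriv hU hF) ht).hasDerivAt
  have f2 := (differentiableAt_of_contDiffOn hU
    (contDiffOn_deriv hU (contDiffOn_deriv hU hF)) ht).hasDerivAt
  have dP : deriv (compP F) t = ![0, 1 / 2 * deriv F t, 0, 0] := by
    refine (hasDerivAt_pi.2 fun i => ?_).deriv
    fin_cases i
    · exact hasDerivAt_const _ _
    · exact f0.const_mul _
    · exact hasDerivAt_const _ _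
    · exact hasDerivAt_const _ _
  have h3 : HasDerivAt (fun t : 𝕜 => c₁ ^ 2 + t) 1 t := (hasDerivAt_id t).const_add _
  have dQ : deriv (compQ c₁ c₂ F) t = ![0, 1 / 2 * F t + 1 / 2 * (c₁ ^ 2 + t) * deriv F t
      + c₁ * deriv (deriv F) t + deriv (deriv (deriv F)) t, 1, 0] := by
    refine (hasDerivAt_pi.2 fun i => ?_).deriv
    fin_cases i
    · exact hasDerivAt_const _ _
    · refine ((((h3.const_mul (1 / 2)).mul f0).add (f1.const_mul _)).add f2).congr_deriv ?_
      simp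
    · exact h3
    · exact hasDerivAt_const _ _
  have dR : deriv (compR c₁ F) t = ![0, 1 / 2 * (c₁ * deriv F t + deriv (deriv F) t), 0, 0] := by
    refine (hasDerivAt_pi.2 fun i => ?_).deriv
    fin_cases i
    · exact hasDerivAt_const _ _
    · exact ((f0.const_mul _).add f1).const_mul _
    · exact hasDerivAt_const _ _
    · exact hasDerivAt_const _ _
  constructor
  · rintro ⟨h, -, -⟩
    have := congrFun h 1
    simp [br, algBr, dQ, dR, compT, compP, compQ, compR] at this
    linear_combination this
  · intro h
    refine ⟨?_, ?_, ?_⟩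
    · ext i
      fin_cases i <;> simp [br, algBr, dQ, dR, compT, compP, compQ, compR]
      linear_combination h
    · ext i
      fin_cases i <;> simp [br, algBr, dP, dQ, dR, compT, compP, compQ, compR]
      ring
    · ext i
      fin_cases i <;> simp [br, algBr, dP, dR, compT, compP, compR]
      ring

theorem reducedASD_iff (hU : IsOpen U) {F : 𝕜 → 𝕜} (hF : ContDiffOn 𝕜 ∞ F U) (c₁ c₂ : 𝕜) :
    ReducedASD U (fieldP F id leftField) (fieldQ c₁ c₂ F id leftField) (fieldR c₁ F id leftField)
      ↔ ReducedEqs U compT (compP F) (compQ c₁ c₂ F) (compR c₁ F) := by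
  have hs := isSplit_comp hU hF c₁ c₂
  have hder : ∀ {x : 𝕜 → Fin 4 → 𝕜}, ContDiffOn 𝕜 ∞ x U → ∀ p ∈ cyl U,
      fderiv 𝕜 (invField x) p (dtField p) = lift p (br compT x (p 0)) := by
    intro x hx p hp
    obtain ⟨A, hA, hA'⟩ := hasFDerivAt_invField (differentiableAt_of_contDiffOn hU hx hp)
    rw [hA.fderiv, hA']
    congr 1
    have : deriv (compT : 𝕜 → Fin 4 → 𝕜) (p 0) = 0 := deriv_const _ _
    ext i
    fin_cases i <;> simp [dtField, br, algBr, compT, this]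
  have hbr : ∀ {x y : 𝕜 → Fin 4 → 𝕜}, ContDiffOn 𝕜 ∞ x U → ContDiffOn 𝕜 ∞ y U → ∀ p ∈ cyl U,
      VectorField.lieBracket 𝕜 (invField x) (invField y) p = lift p (br x y (p 0)) :=
    fun hx hy p hp => lieBracket_invField (differentiableAt_of_contDiffOn hU hx hp)
      (differentiableAt_of_contDiffOn hU hy hp)
  rw [fieldP_eq_invField, fieldQ_eq_invField, fieldR_eq_invField]
  have key : ∀ p ∈ cyl U, (_ ↔ _) := fun p hp => by
    have e1 := hder hs.smooth_Q p hp
    have e2 := hder hs.smooth_R p hp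
    have e3 := hder hs.smooth_P p hp
    have b1 := hbr hs.smooth_Q hs.smooth_R p hp
    have b2 := hbr hs.smooth_Q hs.smooth_P p hp
    have b3 := hbr hs.smooth_R hs.smooth_P p hp
    have hP : invField (compP F) p = lift p (compP F (p 0)) := rfl
    have : (fderiv 𝕜 (invField (compQ c₁ c₂ F)) p (dtField p)
          = VectorField.lieBracket 𝕜 (invField (compQ c₁ c₂ F)) (invField (compR c₁ F)) p
            + invField (compP F) p ∧
        fderiv 𝕜 (invField (compR c₁ F)) p (dtField p) = (1 / 2 : 𝕜) •
          VectorField.lieBracket 𝕜 (invField (compQ c₁ c₂ F)) (invField (compP F)) p ∧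
        fderiv 𝕜 (invField (compP F)) p (dtField p) =
          VectorField.lieBracket 𝕜 (invField (compR c₁ F)) (invField (compP F)) p) ↔
        (br compT (compQ c₁ c₂ F) (p 0) = br (compQ c₁ c₂ F) (compR c₁ F) (p 0) + compP F (p 0) ∧
          (2 : 𝕜) • br compT (compR c₁ F) (p 0) = br (compQ c₁ c₂ F) (compP F) (p 0) ∧
          br compT (compP F) (p 0) = br (compR c₁ F) (compP F) (p 0)) := by
      rw [e1, e2, e3, b1, b2, b3, hP, ← map_add, ← map_smul, (lift_injective p).eq_iff,
        (lift_injective p).eq_iff, (lift_injective p).eq_iff, one_div,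
        eq_inv_smul_iff₀ (two_ne_zero' 𝕜)]
    exact this
  exact ⟨fun h t ht => (key ![t, 0, 0, 0] ht).1 (h _ ht), fun h p hp => (key p hp).2 (h _ hp)⟩

end

/-! ### The normal form: curvature, quartic and general position -/

section

variable {𝕜 : Type*} [RCLike 𝕜] {U : Set 𝕜}

theorem hasComponents_normalTetrad (U : Set 𝕜) (c₁ c₂ : 𝕜) (F : 𝕜 → 𝕜) :
    (normalTetrad c₁ c₂ F id dtField leftField).HasComponents U
      (compOf compT (compP F) (compQ c₁ c₂ F) (compR c₁ F)) := fun a p _ => by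
  rw [normalTetrad_frame]

theorem det_compMatrix_normal (c₁ c₂ : 𝕜) (F : 𝕜 → 𝕜) (t : 𝕜) :
    (compMatrix (compOf compT (compP F) (compQ c₁ c₂ F) (compR c₁ F)) t).det
      = 2 * (deriv (deriv F) t + (c₁ - c₂ / 2) * deriv F t) := by
  rw [det_fin_four]
  simp [compMatrix, compOf, compT, compP, compQ, compR]
  ring

theorem Tetrad.HasComponents.linearIndependent {e : Tetrad 𝕜} {E : Fin 4 → 𝕜 → Fin 4 → 𝕜}
    (he : e.HasComponents U E) (hdet : ∀ t ∈ U, (compMatrix E t).det ≠ 0) {p : Pt 𝕜}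
    (hp : p ∈ cyl U) : LinearIndependent 𝕜 fun a => e.frame a p := by
  refine (Matrix.linearIndependent_cols_iff_isUnit (A := e.frameMatrix p)).2 ?_
  rw [Matrix.isUnit_iff_isUnit_det, isUnit_iff_ne_zero, he.det_frameMatrix hp]
  exact mul_ne_zero (exp_ne_zero' _) (hdet _ hp)

theorem isInvariantTetrad_normalTetrad (hU : IsOpen U) {F : 𝕜 → 𝕜} (hF : ContDiffOn 𝕜 ∞ F U)
    {c₁ c₂ : 𝕜} (hdet : ∀ t ∈ U, deriv (deriv F) t + (c₁ - c₂ / 2) * deriv F t ≠ 0) :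
    (normalTetrad c₁ c₂ F id dtField leftField).IsInvariantTetrad U where
  smooth := fun a => by
    rw [normalTetrad_frame]
    exact contDiffOn_invField ((isSplit_comp hU hF c₁ c₂).smooth_compOf a)
  indep := fun p hp => (hasComponents_normalTetrad U c₁ c₂ F).linearIndependent (fun t ht => by
    rw [det_compMatrix_normal]
    exact mul_ne_zero two_ne_zero (hdet t ht)) hp
  invariant := fun a => by
    rw [normalTetrad_frame]
    exact isInvariant_invField U _
  nonnull := fun p _ => by
    simp [Tetrad.cometric, normalTetrad, tetradOf, fieldP, fieldQ, fieldR, dtField, leftField]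

/-- For the normal form the quartic is constant in the affine coordinate, hence vanishes to order
four at infinity. -/
theorem quadrupleZeroAt_normalTetrad {F : 𝕜 → 𝕜} {c₁ c₂ : 𝕜}
    (hdet : ∀ t ∈ U, deriv (deriv F) t + (c₁ - c₂ / 2) * deriv F t ≠ 0) {p : Pt 𝕜}
    (hp : p ∈ cyl U) :
    (normalTetrad c₁ c₂ F id dtField leftField).QuadrupleZeroAt
      (Tetrad.constCubic 0) (Tetrad.constCubic 1) p 0 1 := by
  have hd := (hasComponents_normalTetrad U c₁ c₂ F).det_frameMatrix hp
  rw [det_compMatrix_normal] at hd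
  refine ⟨Or.inr one_ne_zero,
    -((normalTetrad c₁ c₂ F id dtField leftField).frameMatrix p).det⁻¹, ?_, fun s => ?_⟩
  · rw [hd]
    exact neg_ne_zero.2 (inv_ne_zero (mul_ne_zero (exp_ne_zero' _)
      (mul_ne_zero two_ne_zero (hdet _ hp))))
  · rw [twistorQuartic_eq]
    generalize (Tetrad.frameMatrix _ p).det⁻¹ = δ
    simp [Tetrad.constCubic, normalTetrad, tetradOf, fieldP, fieldR,
      dtField, leftField]
    ring

/-- The `α`-plane at infinity is spanned by `W = -P` and `Z`, and it meets the orbits in the line of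
`P`. -/
theorem genericAt_normalTetrad {F : 𝕜 → 𝕜} {c₁ c₂ : 𝕜}
    (hdet : ∀ t ∈ U, deriv (deriv F) t + (c₁ - c₂ / 2) * deriv F t ≠ 0) {p : Pt 𝕜}
    (hp : p ∈ cyl U) :
    (normalTetrad c₁ c₂ F id dtField leftField).GenericAt p 0 1 := by
  set e := normalTetrad c₁ c₂ F id dtField leftField with he
  have hd : (e.frameMatrix p).det ≠ 0 := by
    rw [(hasComponents_normalTetrad U c₁ c₂ F).det_frameMatrix hp, det_compMatrix_normal]
    exact mul_ne_zero (exp_ne_zero' _) (mul_ne_zero two_ne_zero (hdet _ hp))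
  have hf : ∀ a, e.frame a p = _ := fun a => congrFun (normalTetrad_frame c₁ c₂ F a) p
  intro X hX hX0 hXne
  obtain ⟨x, y, rfl⟩ := Submodule.mem_span_pair.1 hX
  have hy : y = 0 := by
    simpa [he, normalTetrad, tetradOf, fieldP, fieldR, dtField, leftField] using hX0
  subst hy
  have hx : x ≠ 0 := by
    rintro rfl
    simp at hXne
  refine ⟨fun h => hx ?_, ?_⟩
  · obtain ⟨u, v, h⟩ := Submodule.mem_span_pair.1 h
    have := congrFun h 2
    simpa [he, normalTetrad, tetradOf, fieldP, leftField] using this.symm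
  · have hc : e.coords p (x • ((0 : 𝕜) • e.Zt p - (1 : 𝕜) • e.W p)
        + (0 : 𝕜) • ((0 : 𝕜) • e.Wt p - (1 : 𝕜) • e.Z p)) = ![-x, 0, 0, 0] :=
      Tetrad.coords_eq hd (by simp [Fin.sum_univ_four, Tetrad.frame])
    -- the product of `P` with `L₁` is a multiple of the `Q`-coefficient of `L₁`, which cannot vanish
    -- because the `L₂`- and `L₃`-coefficients of `P`, `R` are independent
    have hl := Tetrad.sum_coords hd (leftField 0 p)
    set l := e.coords p (leftField 0 p) with hl'
    rw [leftField_zero_eq] at hl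
    simp only [hf, invField, ← map_smul, ← map_sum] at hl
    have hl := lift_injective p hl
    have h0 := congrFun hl 0
    have h1 := congrFun hl 1
    have h2 := congrFun hl 2
    have h3 := congrFun hl 3
    simp [Fin.sum_univ_four, compOf, compT, compP, compQ, compR] at h0 h1 h2 h3
    have hm : e.metric p (x • ((0 : 𝕜) • e.Zt p - (1 : 𝕜) • e.W p)
        + (0 : 𝕜) • ((0 : 𝕜) • e.Wt p - (1 : 𝕜) • e.Z p)) (leftField 0 p) = x * l 1 := by
      rw [Tetrad.metric, hc, ← hl']
      simp [Fin.sum_univ_four, eta]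
    rw [hm]
    refine mul_ne_zero hx fun h => ?_
    rw [h] at h1 h2 h3
    have e3 : l 3 = 0 := by linear_combination (h0 + h3) / 2
    have e2 : l 2 = 0 := by linear_combination (h0 - h3) / 2
    rw [e2, e3] at h1 h2
    have e0 : l 0 = 0 := by linear_combination -h2
    rw [e0] at h1
    simp at h1

/-- Every solution of the Airy equation gives an anti-self-dual class. -/
theorem isASD_normalTetrad (hU : IsOpen U) {F : 𝕜 → 𝕜} (hF : ContDiffOn 𝕜 ∞ F U)
    {c₁ c₂ : 𝕜} (hA : IsAiryOn (deriv F) U)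
    (hdet : ∀ t ∈ U, deriv (deriv F) t + (c₁ - c₂ / 2) * deriv F t ≠ 0) :
    (normalTetrad c₁ c₂ F id dtField leftField).IsASD (cyl U) :=
  ReducedEqs.isASD hU (isSplit_comp hU hF c₁ c₂) (hasComponents_normalTetrad U c₁ c₂ F)
    (fun t ht => by
      rw [det_compMatrix_normal]
      exact mul_ne_zero two_ne_zero (hdet t ht)) ((reducedEqs_iff_isAiryOn hU hF c₁ c₂).2 hA)

theorem isLaxPair_normalTetrad_iff (hU : IsOpen U) {F : 𝕜 → 𝕜} (hF : ContDiffOn 𝕜 ∞ F U)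
    (c₁ c₂ : 𝕜) :
    (normalTetrad c₁ c₂ F id dtField leftField).IsLaxPair (cyl U) (Tetrad.constCubic 0)
      (Tetrad.constCubic 1) ↔ ReducedEqs U compT (compP F) (compQ c₁ c₂ F) (compR c₁ F) :=
  isLaxPair_constCubic_iff hU (isSplit_comp hU hF c₁ c₂) (hasComponents_normalTetrad U c₁ c₂ F)

end

/-! ### Frames adapted to the orbits -/

section

variable {𝕜 : Type*} [RCLike 𝕜] {U : Set 𝕜} {E : Fin 4 → 𝕜 → Fin 4 → 𝕜}

/-- The factor `Z₀ Z̃₀ - W₀ W̃₀`, half the squared length of `dt`. -/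
def splitFactor (E : Fin 4 → 𝕜 → Fin 4 → 𝕜) (t : 𝕜) : 𝕜 :=
  E 2 t 0 * E 3 t 0 - E 0 t 0 * E 1 t 0

/-- The matrix taking the frame `E` to a conformal frame whose vectors `W`, `W̃` are tangent to the
orbits and whose vectors `Z`, `Z̃` have the same `∂_t`-component. -/
def splitMatrix (E : Fin 4 → 𝕜 → Fin 4 → 𝕜) (t : 𝕜) : Matrix (Fin 4) (Fin 4) 𝕜 :=
  !![E 2 t 0, 0, -E 0 t 0, 0;
     0, E 3 t 0, 0, -E 1 t 0;
     -E 1 t 0, 0, E 3 t 0, 0;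
     0, -E 0 t 0, 0, E 2 t 0]

/-- The frame obtained from `E` by `splitMatrix`. -/
def splitFrame (E : Fin 4 → 𝕜 → Fin 4 → 𝕜) : Fin 4 → 𝕜 → Fin 4 → 𝕜 :=
  ![fun t => E 2 t 0 • E 0 t - E 0 t 0 • E 2 t, fun t => E 3 t 0 • E 1 t - E 1 t 0 • E 3 t,
    fun t => E 3 t 0 • E 2 t - E 1 t 0 • E 0 t, fun t => E 2 t 0 • E 3 t - E 0 t 0 • E 1 t]

theorem splitFrame_eq_sum (t : 𝕜) (a : Fin 4) :
    splitFrame E a t = ∑ b, splitMatrix E t a b • E b t := by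
  fin_cases a <;> simp [splitFrame, splitMatrix, Fin.sum_univ_four] <;> module

theorem det_splitMatrix (t : 𝕜) : (splitMatrix E t).det = splitFactor E t ^ 2 := by
  rw [det_fin_four]
  simp [splitMatrix, splitFactor]
  ring

theorem compMatrix_splitFrame (t : 𝕜) :
    compMatrix (splitFrame E) t = compMatrix E t * (splitMatrix E t).transpose := by
  ext i a
  rw [compMatrix, Matrix.of_apply, splitFrame_eq_sum]
  simp [Matrix.mul_apply, compMatrix, mul_comm]

theorem det_compMatrix_splitFrame (t : 𝕜) :
    (compMatrix (splitFrame E) t).det = splitFactor E t ^ 2 * (compMatrix E t).det := by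
  rw [compMatrix_splitFrame, Matrix.det_mul, Matrix.det_transpose, det_splitMatrix, mul_comm]

theorem contDiffOn_apply {x : 𝕜 → Fin 4 → 𝕜} (hx : ContDiffOn 𝕜 ∞ x U) (i : Fin 4) :
    ContDiffOn 𝕜 ∞ (fun t => x t i) U := contDiffOn_pi.1 hx i

theorem contDiffOn_splitFrame (hE : ∀ a, ContDiffOn 𝕜 ∞ (E a) U) (a : Fin 4) :
    ContDiffOn 𝕜 ∞ (splitFrame E a) U := by
  have h := fun a => contDiffOn_apply (hE a) 0
  fin_cases a
  · exact ((h 2).smul (hE 0)).sub ((h 0).smul (hE 2))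
  · exact ((h 3).smul (hE 1)).sub ((h 1).smul (hE 3))
  · exact ((h 3).smul (hE 2)).sub ((h 1).smul (hE 0))
  · exact ((h 2).smul (hE 3)).sub ((h 0).smul (hE 1))

/-- The bracket of two combinations of vector fields with coefficients depending on `t`. -/
theorem algBr_comb (l dl m dm : Fin 4 → 𝕜) (a b c d da db dc dd : 𝕜) :
    algBr (a • l + b • m) (a • dl + b • dm + (da • l + db • m))
      (c • l + d • m) (c • dl + d • dm + (dc • l + dd • m))
    = (a * d - b * c) • algBr l dl m dm + (a * l 0 + b * m 0) • (dc • l + dd • m)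
      - (c * l 0 + d * m 0) • (da • l + db • m) := by
  ext i
  fin_cases i <;> simp [algBr, Matrix.vecHead, Matrix.vecTail] <;> ring

theorem deriv_smul_sub_smul {x y : 𝕜 → Fin 4 → 𝕜} {f g : 𝕜 → 𝕜} {t : 𝕜}
    (hx : DifferentiableAt 𝕜 x t) (hy : DifferentiableAt 𝕜 y t) (hf : DifferentiableAt 𝕜 f t)
    (hg : DifferentiableAt 𝕜 g t) :
    deriv (fun t => f t • x t - g t • y t) t
      = f t • deriv x t + deriv f t • x t - (g t • deriv y t + deriv g t • y t) :=
  ((hf.hasDerivAt.smul hx.hasDerivAt).sub (hg.hasDerivAt.smul hy.hasDerivAt)).deriv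

/-- How the components of `[Z̃ - s W, W̃ - s Z]` change under the change of frame: in the first two
equations, the cubics `f₀`, `f₁` are transformed by the two-by-two blocks of `splitMatrix`, because
the parameter `s` of the `α`-planes is unchanged. -/
theorem twistG_splitFrame (hU : IsOpen U) (hE : ∀ a, ContDiffOn 𝕜 ∞ (E a) U)
    (hdet : ∀ t ∈ U, (compMatrix E t).det ≠ 0) (hD : ∀ t ∈ U, splitFactor E t ≠ 0) {t : 𝕜}
    (ht : t ∈ U) (s : 𝕜) (g g' : Fin 4 → 𝕜) (v : Fin 4 → 𝕜)
    (hg : g = twistG (fun a b d => structC E a b d t) s)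
    (hg' : g' = twistG (fun a b d => structC (splitFrame E) a b d t) s)
    (hv : v = fun a => deriv (fun r => E a r 0) t) :
    g' 2 + s * g' 1 = E 2 t 0 * (g 2 + s * g 1) + E 0 t 0 * (g 0 + s * g 3) ∧
    g' 0 + s * g' 3 = E 3 t 0 * (g 0 + s * g 3) + E 1 t 0 * (g 2 + s * g 1) ∧
    g' 1 = E 2 t 0 * (g 1 + v 3 - s * v 0) + E 0 t 0 * (g 3 - v 1 + s * v 2) ∧
    g' 3 = E 1 t 0 * (g 1 + v 3 - s * v 0) + E 3 t 0 * (g 3 - v 1 + s * v 2) := by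
  have hd' : (compMatrix (splitFrame E) t).det ≠ 0 := by
    rw [det_compMatrix_splitFrame]
    exact mul_ne_zero (pow_ne_zero _ (hD t ht)) (hdet t ht)
  have h1 := algBr_twist (hdet t ht) s
  have h2 := algBr_twist hd' s
  rw [← hg] at h1
  rw [← hg'] at h2
  have dE : ∀ a, DifferentiableAt 𝕜 (E a) t := fun a => differentiableAt_of_contDiffOn hU (hE a) ht
  have d0 : ∀ a, DifferentiableAt 𝕜 (fun r => E a r 0) t := fun a =>
    differentiableAt_of_contDiffOn hU (contDiffOn_apply (hE a) 0) ht
  have v' : ∀ a, deriv (fun r => E a r 0) t = v a := fun a => by rw [hv]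
  have e0 : deriv (splitFrame E 0) t = _ := deriv_smul_sub_smul (dE 0) (dE 2) (d0 2) (d0 0)
  have e1 : deriv (splitFrame E 1) t = _ := deriv_smul_sub_smul (dE 1) (dE 3) (d0 3) (d0 1)
  have e2 : deriv (splitFrame E 2) t = _ := deriv_smul_sub_smul (dE 2) (dE 0) (d0 3) (d0 1)
  have e3 : deriv (splitFrame E 3) t = _ := deriv_smul_sub_smul (dE 3) (dE 1) (d0 2) (d0 0)
  simp only [v'] at e0 e1 e2 e3
  have h3 := algBr_comb (E 3 t - s • E 0 t) (deriv (E 3) t - s • deriv (E 0) t)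
      (E 1 t - s • E 2 t) (deriv (E 1) t - s • deriv (E 2) t)
      (E 2 t 0) (-E 0 t 0) (-E 1 t 0) (E 3 t 0) (v 2) (-v 0) (-v 1) (v 3)
  rw [h1] at h3
  have w1 : splitFrame E 3 t - s • splitFrame E 0 t = E 2 t 0 • (E 3 t - s • E 0 t)
      + -E 0 t 0 • (E 1 t - s • E 2 t) := by
    simp only [splitFrame, Matrix.cons_val]; module
  have w2 : splitFrame E 1 t - s • splitFrame E 2 t = -E 1 t 0 • (E 3 t - s • E 0 t)
      + E 3 t 0 • (E 1 t - s • E 2 t) := by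
    simp only [splitFrame, Matrix.cons_val]; module
  have w3 : deriv (splitFrame E 3) t - s • deriv (splitFrame E 0) t
      = E 2 t 0 • (deriv (E 3) t - s • deriv (E 0) t)
      + -E 0 t 0 • (deriv (E 1) t - s • deriv (E 2) t)
      + (v 2 • (E 3 t - s • E 0 t) + -v 0 • (E 1 t - s • E 2 t)) := by
    rw [e3, e0]; module
  have w4 : deriv (splitFrame E 1) t - s • deriv (splitFrame E 2) t
      = -E 1 t 0 • (deriv (E 3) t - s • deriv (E 0) t)
      + E 3 t 0 • (deriv (E 1) t - s • deriv (E 2) t)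
      + (-v 1 • (E 3 t - s • E 0 t) + v 3 • (E 1 t - s • E 2 t)) := by
    rw [e1, e2]; module
  rw [w1, w2, w3, w4, h3] at h2
  set D := splitFactor E t with hDdef
  have hDt : D ≠ 0 := hD t ht
  rw [splitFactor] at hDdef
  -- comparison of the coefficients in the frame `E`
  have h4 : (compMatrix E t).mulVec ![
      E 2 t 0 * g' 0 - E 1 t 0 * g' 2 - D * (g 0 - s * (-v 1 + s * v 2)),
      E 3 t 0 * g' 1 - E 0 t 0 * g' 3 - D * (g 1 + (v 3 - s * v 0)),
      -E 0 t 0 * g' 0 + E 3 t 0 * g' 2 - D * (g 2 - s * (v 3 - s * v 0)),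
      -E 1 t 0 * g' 1 + E 2 t 0 * g' 3 - D * (g 3 + (-v 1 + s * v 2))] = 0 := by
    rw [compMatrix_mulVec]
    simp only [Fin.sum_univ_four, Matrix.cons_val, Pi.sub_apply, Pi.smul_apply, smul_eq_mul,
      splitFrame] at h2 ⊢
    rw [← sub_eq_zero] at h2
    rw [← neg_eq_zero, ← h2, hDdef]
    module
  have h5 := Matrix.eq_zero_of_mulVec_eq_zero (hdet t ht) h4
  have k0 := congrFun h5 0
  have k1 := congrFun h5 1
  have k2 := congrFun h5 2
  have k3 := congrFun h5 3
  simp only [Matrix.cons_val, Pi.zero_apply] at k0 k1 k2 k3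
  refine ⟨?_, ?_, ?_, ?_⟩ <;> refine mul_left_cancel₀ hDt ?_
  · linear_combination E 0 t 0 * k0 + E 2 t 0 * k2 + s * (E 2 t 0 * k1 + E 0 t 0 * k3)
      + (g' 2 + s * g' 1) * hDdef
  · linear_combination E 3 t 0 * k0 + E 1 t 0 * k2 + s * (E 1 t 0 * k1 + E 3 t 0 * k3)
      + (g' 0 + s * g' 3) * hDdef
  · linear_combination E 2 t 0 * k1 + E 0 t 0 * k3 + g' 1 * hDdef
  · linear_combination E 1 t 0 * k1 + E 3 t 0 * k3 + g' 3 * hDdef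

theorem hasDerivAt_twistG_time {c : Fin 4 → Fin 4 → Fin 4 → 𝕜 → 𝕜} {t : 𝕜}
    (hc : ∀ a b d, DifferentiableAt 𝕜 (c a b d) t) (s : 𝕜) (d : Fin 4) :
    HasDerivAt (fun r => twistG (fun a b d => c a b d r) s d)
      (twistG (fun a b d => deriv (c a b d) t) s d) t :=
  (((hc 3 1 d).hasDerivAt.sub (((hc 3 2 d).hasDerivAt.add (hc 0 1 d).hasDerivAt).const_mul s))).add
    ((hc 0 2 d).hasDerivAt.const_mul (s ^ 2))

theorem hasDerivAt_twistG (c : Fin 4 → Fin 4 → Fin 4 → 𝕜) (s : 𝕜) (d : Fin 4) :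
    HasDerivAt (fun r => twistG c r d) (twistGDeriv c s d) s := by
  refine (((hasDerivAt_const s (c 3 1 d)).sub ((hasDerivAt_id s).mul_const _)).add
    ((hasDerivAt_pow 2 s).mul_const _)).congr_deriv ?_
  simp [twistGDeriv]

/-- The vertical integrability condition is preserved by the change of frame. -/
theorem vertDefect_splitFrame (hU : IsOpen U) (hE : ∀ a, ContDiffOn 𝕜 ∞ (E a) U)
    (hdet : ∀ t ∈ U, (compMatrix E t).det ≠ 0) (hD : ∀ t ∈ U, splitFactor E t ≠ 0) {t : 𝕜}
    (ht : t ∈ U) (s : 𝕜)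
    (hV : vertDefect (fun a b d => structC E a b d t) (fun a b d => deriv (structC E a b d) t)
      (fun a => E a t 0) s = 0) :
    vertDefect (fun a b d => structC (splitFrame E) a b d t)
      (fun a b d => deriv (structC (splitFrame E) a b d) t) (fun a => splitFrame E a t 0) s = 0 := by
  have hdet' : ∀ t ∈ U, (compMatrix (splitFrame E) t).det ≠ 0 := fun t ht => by
    rw [det_compMatrix_splitFrame]
    exact mul_ne_zero (pow_ne_zero _ (hD t ht)) (hdet t ht)
  have hC : ∀ a b d, DifferentiableAt 𝕜 (structC E a b d) t := fun a b d =>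
    differentiableAt_of_contDiffOn hU (contDiffOn_structC hU hE hdet a b d) ht
  have hC' : ∀ a b d, DifferentiableAt 𝕜 (structC (splitFrame E) a b d) t := fun a b d =>
    differentiableAt_of_contDiffOn hU
      (contDiffOn_structC hU (contDiffOn_splitFrame hE) hdet' a b d) ht
  have d0 : ∀ a, HasDerivAt (fun r => E a r 0) (deriv (fun r => E a r 0) t) t := fun a =>
    (differentiableAt_of_contDiffOn hU (contDiffOn_apply (hE a) 0) ht).hasDerivAt
  have key := fun r (hr : r ∈ U) s => twistG_splitFrame hU hE hdet hD hr s _ _ _ rfl rfl rfl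
  have hev : ∀ᶠ r in nhds t, r ∈ U := hU.mem_nhds ht
  -- derivatives of the two cubics along `t`
  have t0 := ((hasDerivAt_twistG_time hC' s 2).add
    ((hasDerivAt_twistG_time hC' s 1).const_mul s)).unique
    ((((d0 2).mul ((hasDerivAt_twistG_time hC s 2).add
      ((hasDerivAt_twistG_time hC s 1).const_mul s))).add
      ((d0 0).mul ((hasDerivAt_twistG_time hC s 0).add
      ((hasDerivAt_twistG_time hC s 3).const_mul s)))).congr_of_eventuallyEq
      (hev.mono fun r hr => (key r hr s).1))
  have t1 := ((hasDerivAt_twistG_time hC' s 0).add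
    ((hasDerivAt_twistG_time hC' s 3).const_mul s)).unique
    ((((d0 3).mul ((hasDerivAt_twistG_time hC s 0).add
      ((hasDerivAt_twistG_time hC s 3).const_mul s))).add
      ((d0 1).mul ((hasDerivAt_twistG_time hC s 2).add
      ((hasDerivAt_twistG_time hC s 1).const_mul s)))).congr_of_eventuallyEq
      (hev.mono fun r hr => (key r hr s).2.1))
  -- derivatives of the two cubics along the fibre
  have hs := fun c d => hasDerivAt_twistG (𝕜 := 𝕜) c s d
  have s0 := ((hs (fun a b d => structC (splitFrame E) a b d t) 2).add
    ((hasDerivAt_id s).mul (hs (fun a b d => structC (splitFrame E) a b d t) 1))).unique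
    (((((hs (fun a b d => structC E a b d t) 2).add
      ((hasDerivAt_id s).mul (hs (fun a b d => structC E a b d t) 1))).const_mul (E 2 t 0)).add
      (((hs (fun a b d => structC E a b d t) 0).add
      ((hasDerivAt_id s).mul (hs (fun a b d => structC E a b d t) 3))).const_mul
      (E 0 t 0))).congr_of_eventuallyEq (Filter.Eventually.of_forall fun r => (key t ht r).1))
  have s1 := ((hs (fun a b d => structC (splitFrame E) a b d t) 0).add
    ((hasDerivAt_id s).mul (hs (fun a b d => structC (splitFrame E) a b d t) 3))).unique
    (((((hs (fun a b d => structC E a b d t) 0).add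
      ((hasDerivAt_id s).mul (hs (fun a b d => structC E a b d t) 3))).const_mul (E 3 t 0)).add
      (((hs (fun a b d => structC E a b d t) 2).add
      ((hasDerivAt_id s).mul (hs (fun a b d => structC E a b d t) 1))).const_mul
      (E 1 t 0))).congr_of_eventuallyEq (Filter.Eventually.of_forall fun r => (key t ht r).2.1))
  obtain ⟨k0, k1, k2, k3⟩ := key t ht s
  simp only [id, one_mul, Pi.add_apply] at t0 t1 s0 s1
  simp only [vertDefect] at hV ⊢
  generalize twistG (fun a b d => structC (splitFrame E) a b d t) s = G' at *
  generalize twistG (fun a b d => structC E a b d t) s = G at *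
  generalize twistG (fun a b d => deriv (structC (splitFrame E) a b d) t) s = H' at *
  generalize twistG (fun a b d => deriv (structC E a b d) t) s = H at *
  generalize twistGDeriv (fun a b d => structC (splitFrame E) a b d t) s = K' at *
  generalize twistGDeriv (fun a b d => structC E a b d t) s = K at *
  have u0 : splitFrame E 3 t 0 - s * splitFrame E 0 t 0 = splitFactor E t := by
    simp only [splitFrame, splitFactor, Matrix.cons_val, Pi.sub_apply, Pi.smul_apply, smul_eq_mul]
    ring
  have u1 : splitFrame E 1 t 0 - s * splitFrame E 2 t 0 = -s * splitFactor E t := by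
    simp only [splitFrame, splitFactor, Matrix.cons_val, Pi.sub_apply, Pi.smul_apply, smul_eq_mul]
    ring
  rw [u0, u1]
  simp only [splitFactor]
  linear_combination (E 2 t 0 * E 3 t 0 - E 0 t 0 * E 1 t 0) * hV
    - (E 2 t 0 * E 3 t 0 - E 0 t 0 * E 1 t 0) * t1
    + s * (E 2 t 0 * E 3 t 0 - E 0 t 0 * E 1 t 0) * t0
    - (K' 0 + G' 3 + s * K' 3) * k0
    - (E 2 t 0 * (G 2 + s * G 1) + E 0 t 0 * (G 0 + s * G 3)) * s1
    + (K' 2 + G' 1 + s * K' 1) * k1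
    + (E 3 t 0 * (G 0 + s * G 3) + E 1 t 0 * (G 2 + s * G 1)) * s0
    - G' 3 * k0 - (E 2 t 0 * (G 2 + s * G 1) + E 0 t 0 * (G 0 + s * G 3)) * k3
    + G' 1 * k1 + (E 3 t 0 * (G 0 + s * G 3) + E 1 t 0 * (G 2 + s * G 1)) * k2

end

/-! ### The anti-self-duality equations of an adapted frame -/

section

variable {𝕜 : Type*} [RCLike 𝕜] {U : Set 𝕜} {T P Q R : 𝕜 → Fin 4 → 𝕜}

/-- The value at the parameter `s` of the quadratic polynomial with coefficients `c`. -/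
def quad (c : Fin 3 → 𝕜) (s : 𝕜) : 𝕜 := c 0 + c 1 * s + c 2 * s ^ 2

/-- The derivative at the parameter `s` of the quadratic polynomial with coefficients `c`. -/
def quadDeriv (c : Fin 3 → 𝕜) (s : 𝕜) : 𝕜 := c 1 + 2 * c 2 * s

/-- The anti-self-duality equations for a tetrad `W = -P`, `W̃ = Q`, `Z = T - R`, `Z̃ = T + R` with
`P`, `Q`, `R` tangent to the orbits. The three brackets are the coefficients of the powers of `s` in
`[T + R + s P, Q - s (T - R)]`; the quadratic polynomials `σ`, `ρ`, `θ` in `s` give the components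
of this vector, `s² σ + 2 s ρ - θ` is the quartic of the tetrad, and `vert` is the vertical part of
the integrability condition. -/
structure RedSys (U : Set 𝕜) (T P Q R : 𝕜 → Fin 4 → 𝕜) (σ ρ θ : Fin 3 → 𝕜 → 𝕜) : Prop where
  smooth_σ : ∀ i, ContDiffOn 𝕜 ∞ (σ i) U
  smooth_ρ : ∀ i, ContDiffOn 𝕜 ∞ (ρ i) U
  smooth_θ : ∀ i, ContDiffOn 𝕜 ∞ (θ i) U
  eqQ : ∀ t ∈ U, br T Q t - br Q R t = σ 0 t • Q t - (2 * ρ 0 t) • R t - θ 0 t • P t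
  eqR : ∀ t ∈ U, (2 : 𝕜) • br T R t - br Q P t
    = σ 1 t • Q t - (2 * ρ 1 t) • R t - θ 1 t • P t
  eqP : ∀ t ∈ U, br T P t - br R P t = σ 2 t • Q t - (2 * ρ 2 t) • R t - θ 2 t • P t
  vert : ∀ t ∈ U, ∀ s, T t 0 * (s ^ 2 * quad (fun i => deriv (σ i) t) s
        + 2 * s * quad (fun i => deriv (ρ i) t) s - quad (fun i => deriv (θ i) t) s)
      + (s * quad (fun i => σ i t) s + quad (fun i => ρ i t) s)
        * (2 * s * quad (fun i => σ i t) s + s ^ 2 * quadDeriv (fun i => σ i t) s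
          + 2 * quad (fun i => ρ i t) s + 2 * s * quadDeriv (fun i => ρ i t) s
          - quadDeriv (fun i => θ i t) s)
      - (s ^ 2 * quad (fun i => σ i t) s + 2 * s * quad (fun i => ρ i t) s
          - quad (fun i => θ i t) s)
        * (2 * quad (fun i => σ i t) s + s * quadDeriv (fun i => σ i t) s
          + quadDeriv (fun i => ρ i t) s) = 0

variable {σ ρ θ : Fin 3 → 𝕜 → 𝕜}

/-- The coefficients of the vertical equation. -/
theorem RedSys.vert_coeff (h : RedSys U T P Q R σ ρ θ) {t : 𝕜} (ht : t ∈ U) :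
    T t 0 * (-deriv (θ 0) t) + ρ 0 t * (2 * ρ 0 t - θ 1 t) - (σ 0 t + ρ 1 t) * (-θ 0 t) -
      σ 0 t * (-θ 0 t) = 0 ∧
    T t 0 * (2 * deriv (ρ 0) t - deriv (θ 1) t) + 2 * ρ 0 t * (σ 0 t + 2 * ρ 1 t - θ 2 t)
      - 2 * (σ 1 t + ρ 2 t) * (-θ 0 t) - σ 0 t * (2 * ρ 0 t - θ 1 t) - σ 1 t * (-θ 0 t) = 0 ∧
    T t 0 * (deriv (σ 0) t + 2 * deriv (ρ 1) t - deriv (θ 2) t) + 3 * ρ 0 t * (σ 1 t + 2 *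
      ρ 2 t) + (σ 0 t + ρ 1 t) * (σ 0 t + 2 * ρ 1 t - θ 2 t) - (σ 1 t + ρ 2 t) * (2 * ρ 0
      t - θ 1 t) - 3 * σ 2 t * (-θ 0 t) - σ 0 t * (σ 0 t + 2 * ρ 1 t - θ 2 t) - σ 1 t * (2
      * ρ 0 t - θ 1 t) - σ 2 t * (-θ 0 t) = 0 ∧
    T t 0 * (deriv (σ 1) t + 2 * deriv (ρ 2) t) + 4 * ρ 0 t * σ 2 t + 2 * (σ 0 t + ρ 1 t)
      * (σ 1 t + 2 * ρ 2 t) - 2 * σ 2 t * (2 * ρ 0 t - θ 1 t) - σ 0 t * (σ 1 t + 2 * ρ 2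
      t) - σ 1 t * (σ 0 t + 2 * ρ 1 t - θ 2 t) - σ 2 t * (2 * ρ 0 t - θ 1 t) = 0 ∧
    T t 0 * deriv (σ 2) t + 3 * (σ 0 t + ρ 1 t) * σ 2 t + (σ 1 t + ρ 2 t) * (σ 1 t + 2 * ρ
      2 t) - σ 2 t * (σ 0 t + 2 * ρ 1 t - θ 2 t) - σ 0 t * σ 2 t - σ 1 t * (σ 1 t + 2 * ρ
      2 t) - σ 2 t * (σ 0 t + 2 * ρ 1 t - θ 2 t) = 0 :=
  quartic_coeff_eq_zero fun s => by
    have := h.vert t ht s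
    simp only [quad, quadDeriv] at this
    linear_combination this

/-- The effect of the change of parameter `s ↦ -1 / s` on the twistor line. -/
theorem RedSys.inversion (h : RedSys U T P Q R σ ρ θ) :
    RedSys U T Q P (-R) ![-θ 2, θ 1, -θ 0] ![-ρ 2, ρ 1, -ρ 0] ![-σ 2, σ 1, -σ 0] where
  smooth_σ := fun i => by
    fin_cases i
    exacts [(h.smooth_θ 2).neg, h.smooth_θ 1, (h.smooth_θ 0).neg]
  smooth_ρ := fun i => by
    fin_cases i
    exacts [(h.smooth_ρ 2).neg, h.smooth_ρ 1, (h.smooth_ρ 0).neg]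
  smooth_θ := fun i => by
    fin_cases i
    exacts [(h.smooth_σ 2).neg, h.smooth_σ 1, (h.smooth_σ 0).neg]
  eqQ := fun t ht => by
    have h1 := h.eqP t ht
    have h2 : br P (-R) t = br R P t := by
      have : deriv (-R) t = - deriv R t := deriv.neg
      ext i
      fin_cases i <;> simp [br, algBr, this] <;> ring
    rw [h2, h1]
    simp only [Matrix.cons_val, Pi.neg_apply]
    module
  eqR := fun t ht => by
    have h1 := h.eqR t ht
    have h2 : br T (-R) t = -br T R t := by
      have : deriv (-R) t = - deriv R t := deriv.neg
      ext i
      fin_cases i <;> simp [br, algBr, this] <;> ring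
    rw [h2, br_swap P Q] at *
    rw [← neg_inj] at h1
    simp only [Matrix.cons_val, Pi.neg_apply]
    rw [show (2 : 𝕜) • -br T R t - br P Q t = -((2 : 𝕜) • br T R t - -br P Q t) by module, h1]
    module
  eqP := fun t ht => by
    have h1 := h.eqQ t ht
    have h2 : br (-R) Q t = br Q R t := by
      have : deriv (-R) t = - deriv R t := deriv.neg
      ext i
      fin_cases i <;> simp [br, algBr, this] <;> ring
    rw [h2, h1]
    simp only [Matrix.cons_val, Pi.neg_apply]
    module
  vert := fun t ht s => by
    obtain ⟨v0, v1, v2, v3, v4⟩ := h.vert_coeff ht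
    have d : ∀ f : 𝕜 → 𝕜, deriv (-f) t = -deriv f t := fun f => deriv.neg
    simp only [quad, quadDeriv, Matrix.cons_val, Pi.neg_apply, d]
    linear_combination v4 - s * v3 + s ^ 2 * v2 - s ^ 3 * v1 + s ^ 4 * v0

/-- The coefficients of the components of `[Z̃ - s W, W̃ - s Z]`. -/
def twistCoeff (E : Fin 4 → 𝕜 → Fin 4 → 𝕜) (d : Fin 4) : Fin 3 → 𝕜 → 𝕜 :=
  ![structC E 3 1 d, fun t => -(structC E 3 2 d t + structC E 0 1 d t), structC E 0 2 d]

theorem quad_twistCoeff (E : Fin 4 → 𝕜 → Fin 4 → 𝕜) (d : Fin 4) (t s : 𝕜) :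
    quad (fun i => twistCoeff E d i t) s = twistG (fun a b d => structC E a b d t) s d := by
  simp [quad, twistCoeff, twistG]; ring

theorem quadDeriv_twistCoeff (E : Fin 4 → 𝕜 → Fin 4 → 𝕜) (d : Fin 4) (t s : 𝕜) :
    quadDeriv (fun i => twistCoeff E d i t) s
      = twistGDeriv (fun a b d => structC E a b d t) s d := by
  simp [quadDeriv, twistCoeff, twistGDeriv]; ring

/-- The bracket `[Z̃ - s W, W̃ - s Z]` is tangent to the orbits. -/
theorem IsSplit.twistG_two_add_three (hU : IsOpen U) (h : IsSplit U T P Q R) {t : 𝕜} (ht : t ∈ U)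
    (hdet : (compMatrix (compOf T P Q R) t).det ≠ 0) (s : 𝕜) :
    twistG (fun a b d => structC (compOf T P Q R) a b d t) s 2
      + twistG (fun a b d => structC (compOf T P Q R) a b d t) s 3 = 0 := by
  have h1 := congrFun (algBr_twist hdet s) 0
  rw [algBr_compOf hU h ht] at h1
  have hz : ∀ {x y : 𝕜 → Fin 4 → 𝕜}, ContDiffOn 𝕜 ∞ y U → (∀ t ∈ U, y t 0 = 0) →
      br x y t 0 = 0 := fun hy h0 => br_apply_zero_eq_zero hU hy h0 ht
  refine (mul_eq_zero.1 (?_ : T t 0 * _ = 0)).resolve_left (h.T_ne t ht)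
  generalize twistG (fun a b d => structC (compOf T P Q R) a b d t) s = g at h1 ⊢
  simp only [Pi.add_apply, Pi.sub_apply, Pi.smul_apply, hz h.smooth_P h.P_zero,
    hz h.smooth_Q h.Q_zero, hz h.smooth_R h.R_zero, Fin.sum_univ_four] at h1
  simp [compOf, h.P_zero t ht, h.Q_zero t ht, h.R_zero t ht] at h1
  linear_combination -h1

/-- The vertical integrability condition for a split frame, in the form of a system of equations for
`T`, `P`, `Q`, `R`. -/
theorem redSys_of_vertDefect (hU : IsOpen U) (h : IsSplit U T P Q R)
    (hdet : ∀ t ∈ U, (compMatrix (compOf T P Q R) t).det ≠ 0)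
    (hV : ∀ t ∈ U, ∀ s, vertDefect (fun a b d => structC (compOf T P Q R) a b d t)
      (fun a b d => deriv (structC (compOf T P Q R) a b d) t)
      (fun a => compOf T P Q R a t 0) s = 0) :
    RedSys U T P Q R (twistCoeff (compOf T P Q R) 1) (twistCoeff (compOf T P Q R) 2)
      (twistCoeff (compOf T P Q R) 0) := by
  set E := compOf T P Q R with hE
  have hC := contDiffOn_structC hU h.smooth_compOf hdet
  have hsm : ∀ d i, ContDiffOn 𝕜 ∞ (twistCoeff E d i) U := fun d i => by
    fin_cases i
    exacts [hC 3 1 d, ((hC 3 2 d).add (hC 0 1 d)).neg, hC 0 2 d]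
  have hd : ∀ a b d, ∀ t ∈ U, DifferentiableAt 𝕜 (structC E a b d) t := fun a b d t ht =>
    differentiableAt_of_contDiffOn hU (hC a b d) ht
  -- the `s ^ i`-coefficients of the bracket
  have hcoef : ∀ t ∈ U, ∀ k,
      (br T Q t - br Q R t) k = (∑ d, twistCoeff E d 0 t • E d t) k ∧
      ((2 : 𝕜) • br T R t - br Q P t) k = (∑ d, twistCoeff E d 1 t • E d t) k ∧
      (br T P t - br R P t) k = (∑ d, twistCoeff E d 2 t • E d t) k := by
    intro t ht k
    have := quartic_coeff_eq_zero (a₀ := (br T Q t - br Q R t) k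
      - (∑ d, twistCoeff E d 0 t • E d t) k) (a₁ := ((2 : 𝕜) • br T R t - br Q P t) k
      - (∑ d, twistCoeff E d 1 t • E d t) k) (a₂ := (br T P t - br R P t) k
      - (∑ d, twistCoeff E d 2 t • E d t) k) (a₃ := 0) (a₄ := 0) fun s => by
        have h1 := algBr_twist (hdet t ht) s
        rw [algBr_compOf hU h ht] at h1
        have h2 := congrFun h1 k
        simp only [← quad_twistCoeff, quad, Finset.sum_apply, Pi.smul_apply, Pi.add_apply,
          smul_eq_mul, Fin.sum_univ_four] at h2 ⊢
        linear_combination h2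
    exact ⟨sub_eq_zero.1 this.1, sub_eq_zero.1 this.2.1, sub_eq_zero.1 this.2.2.1⟩
  have hsum : ∀ i, ∀ t ∈ U, twistCoeff E 2 i t + twistCoeff E 3 i t = 0 := by
    intro i t ht
    have := quartic_coeff_eq_zero (a₀ := twistCoeff E 2 0 t + twistCoeff E 3 0 t)
      (a₁ := twistCoeff E 2 1 t + twistCoeff E 3 1 t)
      (a₂ := twistCoeff E 2 2 t + twistCoeff E 3 2 t) (a₃ := 0) (a₄ := 0) fun s => by
        have h1 := h.twistG_two_add_three hU ht (hdet t ht) s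
        simp only [← quad_twistCoeff, quad] at h1
        linear_combination h1
    fin_cases i
    exacts [this.1, this.2.1, this.2.2.1]
  have hvec : ∀ i, ∀ t ∈ U, ∑ d, twistCoeff E d i t • E d t
      = twistCoeff E 1 i t • Q t - (2 * twistCoeff E 2 i t) • R t - twistCoeff E 0 i t • P t := by
    intro i t ht
    rw [Fin.sum_univ_four, eq_neg_of_add_eq_zero_right (hsum i t ht)]
    simp only [hE, compOf, Matrix.cons_val, Pi.neg_apply, Pi.sub_apply, Pi.add_apply]
    module
  refine ⟨hsm 1, hsm 2, hsm 0, fun t ht => ?_, fun t ht => ?_, fun t ht => ?_, fun t ht s => ?_⟩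
  · rw [← hvec 0 t ht]
    exact funext fun k => (hcoef t ht k).1
  · rw [← hvec 1 t ht]
    exact funext fun k => (hcoef t ht k).2.1
  · rw [← hvec 2 t ht]
    exact funext fun k => (hcoef t ht k).2.2
  · have hder : ∀ d, quad (fun i => deriv (twistCoeff E d i) t) s
        = twistG (fun a b d => deriv (structC E a b d) t) s d := by
      intro d
      have : deriv (fun t => -(structC E 3 2 d t + structC E 0 1 d t)) t
          = -(deriv (structC E 3 2 d) t + deriv (structC E 0 1 d) t) :=
        ((hd 3 2 d t ht).hasDerivAt.add (hd 0 1 d t ht).hasDerivAt).neg.deriv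
      simp only [quad, twistCoeff, twistG, Matrix.cons_val, this]
      ring
    have hev : ∀ᶠ r in nhds t, r ∈ U := hU.mem_nhds ht
    have z0 : ∀ s, twistG (fun a b d => structC E a b d t) s 3
        = -twistG (fun a b d => structC E a b d t) s 2 := fun s => by
      simp only [← quad_twistCoeff, quad]
      linear_combination hsum 0 t ht + s * hsum 1 t ht + s ^ 2 * hsum 2 t ht
    have z1 : twistGDeriv (fun a b d => structC E a b d t) s 3
        = -twistGDeriv (fun a b d => structC E a b d t) s 2 := by
      simp only [← quadDeriv_twistCoeff, quadDeriv]
      linear_combination hsum 1 t ht + 2 * s * hsum 2 t ht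
    have z2 : twistG (fun a b d => deriv (structC E a b d) t) s 3
        = -twistG (fun a b d => deriv (structC E a b d) t) s 2 := by
      have : ∀ i, deriv (twistCoeff E 2 i) t + deriv (twistCoeff E 3 i) t = 0 := fun i => by
        rw [← deriv_fun_add (differentiableAt_of_contDiffOn hU (hsm 2 i) ht)
          (differentiableAt_of_contDiffOn hU (hsm 3 i) ht),
          Filter.EventuallyEq.deriv_eq (hev.mono fun r hr => hsum i r hr), deriv_const]
      rw [← hder, ← hder]
      simp only [quad]
      linear_combination this 0 + s * this 1 + s ^ 2 * this 2
    have := hV t ht s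
    have u0 : E 3 t 0 - s * E 0 t 0 = T t 0 := by
      simp [hE, compOf, h.R_zero t ht, h.P_zero t ht]
    have u1 : E 1 t 0 - s * E 2 t 0 = -s * T t 0 := by
      simp [hE, compOf, h.R_zero t ht, h.Q_zero t ht]
    rw [vertDefect, u0, u1, z0, z1, z2] at this
    simp only [quad_twistCoeff, quadDeriv_twistCoeff, hder]
    linear_combination this

end

/-! ### Algebra of the changes of frame -/

section

variable {𝕜 : Type*} [RCLike 𝕜] {U : Set 𝕜} {T P Q R : 𝕜 → Fin 4 → 𝕜}

/-- The bracket of the Lie algebra of the group. -/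
def cr (u v : Fin 4 → 𝕜) : Fin 4 → 𝕜 := ![0, u 1 * v 2 - u 2 * v 1, 0, 0]

theorem cr_add_left (u v w : Fin 4 → 𝕜) : cr (u + v) w = cr u w + cr v w := by
  ext i; fin_cases i <;> simp [cr]; ring

theorem cr_smul_left (c : 𝕜) (u v : Fin 4 → 𝕜) : cr (c • u) v = c • cr u v := by
  ext i; fin_cases i <;> simp [cr]; ring

theorem cr_swap (u v : Fin 4 → 𝕜) : cr u v = -cr v u := by
  ext i; fin_cases i <;> simp [cr]; ring

theorem cr_add_right (u v w : Fin 4 → 𝕜) : cr u (v + w) = cr u v + cr u w := by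
  ext i; fin_cases i <;> simp [cr]; ring

theorem cr_smul_right (c : 𝕜) (u v : Fin 4 → 𝕜) : cr u (c • v) = c • cr u v := by
  ext i; fin_cases i <;> simp [cr]; ring

theorem cr_self (u : Fin 4 → 𝕜) : cr u u = 0 := by
  ext i; fin_cases i <;> simp [cr]; ring

theorem br_eq_cr {x y : 𝕜 → Fin 4 → 𝕜} {t : 𝕜} (hx : x t 0 = 0) (hy : y t 0 = 0) :
    br x y t = cr (x t) (y t) := by
  ext i; fin_cases i <;> simp [br, algBr, cr, hx, hy]

theorem br_smul_left {x : 𝕜 → Fin 4 → 𝕜} {t : 𝕜} (h : 𝕜 → 𝕜) (hx : x t 0 = 0) :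
    br (fun r => h r • T r) x t = h t • br T x t := by
  ext i; fin_cases i <;> simp [br, algBr, hx] <;> ring

theorem br_add_right {x y : 𝕜 → Fin 4 → 𝕜} {t : 𝕜} (hx : DifferentiableAt 𝕜 x t)
    (hy : DifferentiableAt 𝕜 y t) : br T (fun r => x r + y r) t = br T x t + br T y t := by
  have : deriv (fun r => x r + y r) t = deriv x t + deriv y t := deriv_fun_add hx hy
  ext i; fin_cases i <;> simp [br, algBr, this] <;> ring

theorem br_smul_right {x : 𝕜 → Fin 4 → 𝕜} {k : 𝕜 → 𝕜} {k' t : 𝕜} (hk : HasDerivAt k k' t)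
    (hx : DifferentiableAt 𝕜 x t) :
    br T (fun r => k r • x r) t = k t • br T x t + (T t 0 * k') • x t := by
  have : deriv (fun r => k r • x r) t = k t • deriv x t + k' • x t :=
    (hk.smul hx.hasDerivAt).deriv
  ext i; fin_cases i <;> simp [br, algBr, this] <;> ring

/-- Moving a quadruple zero of the quartic from the point `1 / ν` to infinity: the pointwise
algebra. Here `δ` stands for the bracket with `T`. -/
theorem translate_algebra {p q r δp δq δr : Fin 4 → 𝕜} {σ₀ ρ₀ ρ₁ ρ₂ K ν n : 𝕜}
    (hQ : δq - cr q r = σ₀ • q - (2 * ρ₀) • r + K • p)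
    (hR : (2 : 𝕜) • δr - cr q p = (-4 * K * ν ^ 3 - 2 * ρ₂) • q - (2 * ρ₁) • r
      - (2 * ρ₀ + 4 * K * ν) • p)
    (hP : δp - cr r p = (K * ν ^ 4) • q - (2 * ρ₂) • r - (σ₀ + 2 * ρ₁ - 6 * K * ν ^ 2) • p)
    (hn : n = -ν ^ 2 * ρ₀ - ν * σ₀ - ν * ρ₁ + 3 * K * ν ^ 3 + ρ₂) :
    δq - cr q (r + ν • q) = (σ₀ + 2 * ν * ρ₀ + ν ^ 2 * K) • q
        - (2 * (ρ₀ + ν * K)) • (r + ν • q) + K • (p + (2 * ν) • r + ν ^ 2 • q) ∧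
    (2 : 𝕜) • (δr + (ν • δq + n • q)) - cr q (p + (2 * ν) • r + ν ^ 2 • q)
      = (2 * ((σ₀ + 2 * ν * ρ₀ + ν ^ 2 * K) - (2 * ν * ρ₀ + ρ₁ + σ₀ - ν ^ 2 * K))) • (r + ν • q)
        - (2 * (ρ₀ + ν * K)) • (p + (2 * ν) • r + ν ^ 2 • q) ∧
    (δp + ((2 * ν) • δr + (2 * n) • r) + (ν ^ 2 • δq + (2 * ν * n) • q))
        - cr (r + ν • q) (p + (2 * ν) • r + ν ^ 2 • q)
      = ((σ₀ + 2 * ν * ρ₀ + ν ^ 2 * K) - 2 * (2 * ν * ρ₀ + ρ₁ + σ₀ - ν ^ 2 * K))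
        • (p + (2 * ν) • r + ν ^ 2 • q) := by
  subst hn
  simp only [cr_add_left, cr_add_right, cr_smul_left, cr_smul_right, cr_self, cr_swap r q]
  refine ⟨?_, ?_, ?_⟩
  · linear_combination (norm := module) hQ
  · linear_combination (norm := module) hR + (2 * ν) • hQ
  · linear_combination (norm := module) hP + ν • hR + ν ^ 2 • hQ

/-- The rescaling that turns the translated equations into the reduced ones: the pointwise
algebra. -/
theorem gauge_algebra {p q r δp δq δr : Fin 4 → 𝕜} {A B E K h κ n : 𝕜} (hκ : κ ≠ 0)
    (hK : h * K = κ ^ 2)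
    (hQ : δq - cr q r = E • q - (2 * A) • r + K • p)
    (hR : (2 : 𝕜) • δr - cr q p = (2 * (E - B)) • r - (2 * A) • p)
    (hP : δp - cr r p = (E - 2 * B) • p) :
    h • ((h / κ) • (δq + ((2 * n) • δr + (2 * (A + B * n)) • r)
        + (n ^ 2 • δp + (2 * n * (A + B * n)) • p))
        + (-(h / κ * E)) • (q + (2 * n) • r + n ^ 2 • p))
      = cr ((h / κ) • (q + (2 * n) • r + n ^ 2 • p)) (h • (r + n • p)) + (h * κ) • p ∧
    (2 : 𝕜) • (h • (h • (δr + (n • δp + (A + B * n) • p)) + (h * (B - E)) • (r + n • p)))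
      = cr ((h / κ) • (q + (2 * n) • r + n ^ 2 • p)) ((h * κ) • p) ∧
    h • ((h * κ) • δp + (h * κ * (2 * B - E)) • p) = cr (h • (r + n • p)) ((h * κ) • p) := by
  have e1 : δq = cr q r + (E • q - (2 * A) • r + K • p) := by rw [← hQ]; module
  have e2 : δr = (1 / 2 : 𝕜) • (cr q p + ((2 * (E - B)) • r - (2 * A) • p)) := by
    rw [← hR]; module
  have e3 : δp = cr r p + (E - 2 * B) • p := by rw [← hP]; module
  have hK' : K * h ^ 2 / κ = h * κ := by
    field_simp
    linear_combination h * hK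
  simp only [e1, e2, e3, cr_add_left, cr_add_right, cr_smul_left, cr_smul_right, cr_self,
    cr_swap p r]
  refine ⟨?_, ?_, ?_⟩
  · rw [← hK']
    match_scalars <;> field_simp <;> ring
  · match_scalars <;> field_simp <;> ring
  · match_scalars <;> ring

end

/-! ### Moving the quadruple zero to infinity -/

section

variable {𝕜 : Type*} [RCLike 𝕜] {U V : Set 𝕜} {T P Q R : 𝕜 → Fin 4 → 𝕜}

/-- Cube roots exist in both fields, also for negative real numbers. -/
theorem exists_pow_three_eq (c : 𝕜) : ∃ x : 𝕜, x ^ 3 = c := by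
  rcases RCLike.I_eq_zero_or_im_I_eq_one (K := 𝕜) with h | h
  · let f := RCLike.realRingEquiv h
    have key : ∀ y : ℝ, 0 ≤ y → ∃ x : ℝ, x ^ 3 = y := fun y hy =>
      ⟨y ^ ((3 : ℕ) : ℝ)⁻¹, Real.rpow_inv_natCast_pow hy (by norm_num)⟩
    obtain ⟨x, hx⟩ : ∃ x : ℝ, x ^ 3 = f c := by
      rcases le_total 0 (f c) with hc | hc
      · exact key _ hc
      · obtain ⟨x, hx⟩ := key (-f c) (neg_nonneg.2 hc)
        exact ⟨-x, by rw [Odd.neg_pow (by decide), hx, neg_neg]⟩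
    exact ⟨f.symm x, f.injective (by simpa using hx)⟩
  · let f := RCLike.complexRingEquiv h
    obtain ⟨x, hx⟩ := IsAlgClosed.exists_pow_nat_eq (f c) (n := 3) (by norm_num)
    exact ⟨f.symm x, f.injective (by simpa using hx)⟩

/-- In the complex case this is Cauchy's theorem for convex domains. -/
theorem exists_primitive (hV : IsOpen V) (hc : Convex ℝ V) {f : 𝕜 → 𝕜}
    (hf : ContDiffOn 𝕜 ∞ f V) : ∃ g : 𝕜 → 𝕜, ContDiffOn 𝕜 ∞ g V ∧ ∀ t ∈ V, HasDerivAt g (f t) t := by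
  obtain ⟨g, hg⟩ := hc.exists_forall_hasDerivWithinAt (hf.differentiableOn (by simp))
  have hg' : ∀ t ∈ V, HasDerivAt g (f t) t := fun t ht => (hg t ht).hasDerivAt (hV.mem_nhds ht)
  refine ⟨g, ?_, hg'⟩
  rw [contDiffOn_infty_iff_deriv_of_isOpen hV]
  exact ⟨fun t ht => (hg' t ht).differentiableAt.differentiableWithinAt,
    hf.congr fun t ht => (hg' t ht).deriv⟩

/-- Solutions of the linear equations `D u' = a u` and `D v' = a v + b` on a convex set. -/
theorem exists_linear_ode (hV : IsOpen V) (hc : Convex ℝ V) {D a b : 𝕜 → 𝕜}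
    (hD : ContDiffOn 𝕜 ∞ D V) (hD0 : ∀ t ∈ V, D t ≠ 0) (ha : ContDiffOn 𝕜 ∞ a V)
    (hb : ContDiffOn 𝕜 ∞ b V) (t₀ : 𝕜) {c : 𝕜} (hc0 : c ≠ 0) :
    ∃ u v : 𝕜 → 𝕜, ContDiffOn 𝕜 ∞ u V ∧ ContDiffOn 𝕜 ∞ v V ∧ (∀ t, u t ≠ 0) ∧ u t₀ = c ∧
      (∀ t ∈ V, D t * deriv u t = a t * u t) ∧
      ∀ t ∈ V, D t * deriv v t = a t * v t + b t := by
  obtain ⟨g, hg, hg'⟩ := exists_primitive hV hc (ha.div hD hD0)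
  have hexp : ContDiff 𝕜 ∞ (NormedSpace.exp : 𝕜 → 𝕜) :=
    AnalyticOnNhd.contDiff fun x _ => NormedSpace.exp_analytic (𝕂 := 𝕜) x
  set u : 𝕜 → 𝕜 := fun t => c * NormedSpace.exp (g t - g t₀) with hu
  have hu0 : ∀ t, u t ≠ 0 := fun t => mul_ne_zero hc0 (exp_ne_zero' _)
  have hus : ContDiffOn 𝕜 ∞ u V :=
    contDiffOn_const.mul (hexp.comp_contDiffOn (hg.sub contDiffOn_const))
  have hud : ∀ t ∈ V, HasDerivAt u (a t / D t * u t) t := fun t ht => by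
    have h1 : HasDerivAt (NormedSpace.exp : 𝕜 → 𝕜) _ (g t - g t₀) := hasDerivAt_exp (𝕂 := 𝕜)
    refine ((h1.comp t ((hg' t ht).sub_const (g t₀))).const_mul c).congr_deriv ?_
    simp only [hu, Pi.div_apply]
    ring
  obtain ⟨m, hm, hm'⟩ := exists_primitive hV hc
    (hb.div (hD.mul hus) fun t ht => mul_ne_zero (hD0 t ht) (hu0 t))
  refine ⟨u, fun t => u t * m t, hus, hus.mul hm, hu0, by simp [hu], fun t ht => ?_, fun t ht => ?_⟩
  · rw [(hud t ht).deriv]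
    field_simp [hD0 t ht]
  · rw [show deriv (fun t => u t * m t) t = _ from ((hud t ht).mul (hm' t ht)).deriv]
    have := hu0 t
    have := hD0 t ht
    simp only [Pi.div_apply]
    field_simp

theorem exists_eq_const (hV : IsOpen V) (hc : Convex ℝ V) {f : 𝕜 → 𝕜} (hf : ContDiffOn 𝕜 ∞ f V)
    (h0 : ∀ t ∈ V, deriv f t = 0) : ∃ c, ∀ t ∈ V, f t = c :=
  hV.exists_is_const_of_fderiv_eq_zero hc.isPreconnected (hf.differentiableOn (by simp))
    fun t ht => by
      ext
      simp [h0 t ht]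

/-! ### Moving the quadruple zero to infinity -/

/-- General position at `b / a`, in terms of the components of `P`, `Q`, `R` in the basis
`∂_t, L₁, L₂, L₃`: the vector `a² Q + 2 a b R + b² P` spanning the null line is not in `⟨L₁, L₃⟩`, and
its orthogonal complement in the orbit, spanned by `a Q + b R` and `a R + b P`, does not contain
`L₁`. -/
structure IsGeneral (p q r : Fin 4 → 𝕜) (a b : 𝕜) : Prop where
  two_ne : (a ^ 2 • q + (2 * a * b) • r + b ^ 2 • p) 2 ≠ 0
  minor_ne : (a • q + b • r) 2 * (a • r + b • p) 3 - (a • q + b • r) 3 * (a • r + b • p) 2 ≠ 0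

theorem IsGeneral.inversion {p q r : Fin 4 → 𝕜} {a b : 𝕜} (h : IsGeneral p q r a b) :
    IsGeneral q p (-r) b (-a) where
  two_ne := by
    have := h.two_ne
    simp only [Pi.add_apply, Pi.smul_apply, Pi.neg_apply, smul_eq_mul] at this ⊢
    convert this using 1
    ring
  minor_ne := by
    have := h.minor_ne
    simp only [Pi.add_apply, Pi.smul_apply, Pi.neg_apply, smul_eq_mul] at this ⊢
    convert this using 1
    ring

/-- The quartic of the system vanishes to order four at `b / a`, and the system is in general
position there. -/
structure IsGeneralZero (σ ρ θ : Fin 3 → 𝕜) (p q r : Fin 4 → 𝕜) (a b : 𝕜) : Prop where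
  ne_zero : a ≠ 0 ∨ b ≠ 0
  exists_quartic : ∃ k : 𝕜, k ≠ 0 ∧ ∀ s, s ^ 2 * quad σ s + 2 * s * quad ρ s - quad θ s
    = k * (a * s - b) ^ 4
  isGeneral : IsGeneral p q r a b

theorem IsGeneralZero.coeff {σ ρ θ : Fin 3 → 𝕜} {p q r : Fin 4 → 𝕜} {a b : 𝕜}
    (h : IsGeneralZero σ ρ θ p q r a b) : ∃ k : 𝕜, k ≠ 0 ∧ -θ 0 = k * b ^ 4 ∧
      2 * ρ 0 - θ 1 = -4 * k * a * b ^ 3 ∧ σ 0 + 2 * ρ 1 - θ 2 = 6 * k * a ^ 2 * b ^ 2 ∧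
      σ 1 + 2 * ρ 2 = -4 * k * a ^ 3 * b ∧ σ 2 = k * a ^ 4 := by
  obtain ⟨k, hk, h⟩ := h.exists_quartic
  have := quartic_coeff_eq_zero (a₀ := -θ 0 - k * b ^ 4)
    (a₁ := 2 * ρ 0 - θ 1 - -4 * k * a * b ^ 3)
    (a₂ := σ 0 + 2 * ρ 1 - θ 2 - 6 * k * a ^ 2 * b ^ 2)
    (a₃ := σ 1 + 2 * ρ 2 - -4 * k * a ^ 3 * b) (a₄ := σ 2 - k * a ^ 4) fun s => by
      have := h s
      simp only [quad] at this
      linear_combination this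
  simp only [sub_eq_zero] at this
  exact ⟨k, hk, sub_eq_zero.1 (by linear_combination this.1), this.2.1 ▸ rfl, by
    linear_combination this.2.2.1, this.2.2.2.1, this.2.2.2.2⟩

theorem IsGeneralZero.inversion {σ ρ θ : Fin 3 → 𝕜} {p q r : Fin 4 → 𝕜} {a b : 𝕜}
    (h : IsGeneralZero σ ρ θ p q r a b) :
    IsGeneralZero ![-θ 2, θ 1, -θ 0] ![-ρ 2, ρ 1, -ρ 0] ![-σ 2, σ 1, -σ 0] q p (-r) b (-a) where
  ne_zero := h.ne_zero.symm.imp id neg_ne_zero.2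
  exists_quartic := by
    obtain ⟨k, hk, k0, k1, k2, k3, k4⟩ := h.coeff
    refine ⟨k, hk, fun s => ?_⟩
    simp only [quad, Matrix.cons_val]
    linear_combination k4 - s * k3 + s ^ 2 * k2 - s ^ 3 * k1 + s ^ 4 * k0
  isGeneral := h.isGeneral.inversion

/-- The equations of a tetrad whose quartic is a constant `K` in the affine coordinate, so that it
vanishes to order four at infinity. The functions `A`, `B`, `E` are the coefficients that remain
free. -/
structure InftySys (U : Set 𝕜) (T P Q R : 𝕜 → Fin 4 → 𝕜) (A B E K : 𝕜 → 𝕜) : Prop where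
  smooth_A : ContDiffOn 𝕜 ∞ A U
  smooth_B : ContDiffOn 𝕜 ∞ B U
  smooth_E : ContDiffOn 𝕜 ∞ E U
  smooth_K : ContDiffOn 𝕜 ∞ K U
  K_ne : ∀ t ∈ U, K t ≠ 0
  K_deriv : ∀ t ∈ U, T t 0 * deriv K t = K t * (B t + E t)
  eqQ : ∀ t ∈ U, br T Q t - cr (Q t) (R t) = E t • Q t - (2 * A t) • R t + K t • P t
  eqR : ∀ t ∈ U, (2 : 𝕜) • br T R t - cr (Q t) (P t)
    = (2 * (E t - B t)) • R t - (2 * A t) • P t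
  eqP : ∀ t ∈ U, br T P t - cr (R t) (P t) = (E t - 2 * B t) • P t
  P_two : ∀ t ∈ U, P t 2 ≠ 0
  minor_ne : ∀ t ∈ U, R t 2 * P t 3 - R t 3 * P t 2 ≠ 0

/-- A quadruple zero `1 / ν` other than the origin is moved to infinity by a rotation of the frame
which fixes the null direction `Q`, the one belonging to the origin. -/
theorem RedSys.exists_inftySys {σ ρ θ : Fin 3 → 𝕜 → 𝕜} (hU : IsOpen U) (hs : IsSplit U T P Q R)
    (h : RedSys U T P Q R σ ρ θ) (hθ : ∀ t ∈ U, θ 0 t ≠ 0)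
    (hz : ∀ t ∈ U, ∃ a b, IsGeneralZero (fun i => σ i t) (fun i => ρ i t) (fun i => θ i t)
      (P t) (Q t) (R t) a b) :
    ∃ ν A B E K : 𝕜 → 𝕜, ContDiffOn 𝕜 ∞ ν U ∧
      IsSplit U T (fun t => P t + (2 * ν t) • R t + ν t ^ 2 • Q t) Q (fun t => R t + ν t • Q t) ∧
      InftySys U T (fun t => P t + (2 * ν t) • R t + ν t ^ 2 • Q t) Q (fun t => R t + ν t • Q t)
        A B E K := by
  set K : 𝕜 → 𝕜 := fun t => -θ 0 t with hK
  set ν : 𝕜 → 𝕜 := fun t => (θ 1 t - 2 * ρ 0 t) / (4 * K t) with hν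
  have sK : ContDiffOn 𝕜 ∞ K U := (h.smooth_θ 0).neg
  have K0 : ∀ t ∈ U, K t ≠ 0 := fun t ht => neg_ne_zero.2 (hθ t ht)
  have sν : ContDiffOn 𝕜 ∞ ν U :=
    ((h.smooth_θ 1).sub (contDiffOn_const.mul (h.smooth_ρ 0))).div (contDiffOn_const.mul sK)
      fun t ht => mul_ne_zero (by norm_num) (K0 t ht)
  have sρ := h.smooth_ρ
  have sσ := h.smooth_σ
  -- the quartic is `K (ν s - 1) ^ 4`
  have hq : ∀ t ∈ U, 2 * ρ 0 t - θ 1 t = -4 * K t * ν t ∧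
      σ 0 t + 2 * ρ 1 t - θ 2 t = 6 * K t * ν t ^ 2 ∧ σ 1 t + 2 * ρ 2 t = -4 * K t * ν t ^ 3 ∧
      σ 2 t = K t * ν t ^ 4 ∧ IsGeneral (P t) (Q t) (R t) (ν t) 1 := by
    intro t ht
    obtain ⟨a, b, hab⟩ := hz t ht
    obtain ⟨k, hk, k0, k1, k2, k3, k4⟩ := hab.coeff
    have hKt : K t = k * b ^ 4 := k0
    have hb : b ≠ 0 := by
      rintro rfl
      exact K0 t ht (by rw [hKt]; ring)
    have hνt : ν t = a / b := by
      simp only [hν]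
      rw [hKt, div_eq_div_iff (mul_ne_zero (by norm_num) (mul_ne_zero hk (pow_ne_zero _ hb))) hb]
      linear_combination (-b) * k1
    rw [hKt, hνt]
    refine ⟨?_, ?_, ?_, ?_, ?_, ?_⟩
    · rw [k1]; field_simp
    · rw [k2]; field_simp
    · rw [k3]; field_simp
    · rw [k4]; field_simp
    · have := hab.isGeneral.two_ne
      have e : (a ^ 2 • Q t + (2 * a * b) • R t + b ^ 2 • P t) 2
        = b ^ 2 * ((a / b) ^ 2 • Q t + (2 * (a / b) * 1) • R t + (1 : 𝕜) ^ 2 • P t) 2 := by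
        simp; field_simp
      rw [e] at this
      exact right_ne_zero_of_mul this
    · have := hab.isGeneral.minor_ne
      have e : (a • Q t + b • R t) 2 * (a • R t + b • P t) 3
          - (a • Q t + b • R t) 3 * (a • R t + b • P t) 2 = b ^ 2 *
          (((a / b) • Q t + (1 : 𝕜) • R t) 2 * ((a / b) • R t + (1 : 𝕜) • P t) 3
          - ((a / b) • Q t + (1 : 𝕜) • R t) 3 * ((a / b) • R t + (1 : 𝕜) • P t) 2) := by
        simp; field_simp
      rw [e] at this
      exact right_ne_zero_of_mul this
  have dK : ∀ t ∈ U, HasDerivAt K (deriv K t) t := fun t ht =>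
    (differentiableAt_of_contDiffOn hU sK ht).hasDerivAt
  have dν : ∀ t ∈ U, HasDerivAt ν (deriv ν t) t := fun t ht =>
    (differentiableAt_of_contDiffOn hU sν ht).hasDerivAt
  have hKd : ∀ t ∈ U, T t 0 * deriv K t = K t * (4 * ν t * ρ 0 t + 2 * σ 0 t + ρ 1 t) := by
    intro t ht
    obtain ⟨q1, q2, q3, q4, -⟩ := hq t ht
    have v0 := (h.vert_coeff ht).1
    have e : deriv K t = -deriv (θ 0) t := deriv.fun_neg
    rw [q1] at v0
    rw [e]
    simp only [hK] at v0 ⊢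
    linear_combination v0
  have hνd : ∀ t ∈ U, T t 0 * deriv ν t = -ν t ^ 2 * ρ 0 t - ν t * σ 0 t - ν t * ρ 1 t
      + 3 * K t * ν t ^ 3 + ρ 2 t := by
    intro t ht
    obtain ⟨q1, q2, q3, q4, -⟩ := hq t ht
    have v1 := (h.vert_coeff ht).2.1
    have e : 2 * deriv (ρ 0) t - deriv (θ 1) t = -4 * (deriv K t * ν t + K t * deriv ν t) := by
      have h1 := (((differentiableAt_of_contDiffOn hU (sρ 0) ht).hasDerivAt.const_mul 2).sub
        (differentiableAt_of_contDiffOn hU (h.smooth_θ 1) ht).hasDerivAt)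
      have h2 := ((dK t ht).mul (dν t ht)).const_mul (-4)
      refine h1.unique (h2.congr_of_eventuallyEq ?_)
      filter_upwards [hU.mem_nhds ht] with r hr
      have := (hq r hr).1
      simp only [Pi.sub_apply, Pi.mul_apply] at this ⊢
      linear_combination this
    rw [e, q1, q2] at v1
    have q0 : -θ 0 t = K t := rfl
    rw [q0] at v1
    refine mul_left_cancel₀ (K0 t ht) ?_
    linear_combination (-1 / 4) * v1 - ν t * hKd t ht - 3 / 4 * K t * q3
  refine ⟨ν, fun t => ρ 0 t + ν t * K t,
    fun t => 2 * ν t * ρ 0 t + ρ 1 t + σ 0 t - ν t ^ 2 * K t,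
    fun t => σ 0 t + 2 * ν t * ρ 0 t + ν t ^ 2 * K t, K, sν, ?_, ?_⟩
  · exact {
      smooth_T := hs.smooth_T
      smooth_P := (hs.smooth_P.add ((contDiffOn_const.mul sν).smul hs.smooth_R)).add
        ((sν.pow 2).smul hs.smooth_Q)
      smooth_Q := hs.smooth_Q
      smooth_R := hs.smooth_R.add (sν.smul hs.smooth_Q)
      T_ne := hs.T_ne
      P_zero := fun t ht => by simp [hs.P_zero t ht, hs.Q_zero t ht, hs.R_zero t ht]
      Q_zero := hs.Q_zero
      R_zero := fun t ht => by simp [hs.Q_zero t ht, hs.R_zero t ht] }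
  · have halg : ∀ t ∈ U, _ := fun t ht => by
      obtain ⟨q1, q2, q3, q4, -⟩ := hq t ht
      have eQ := h.eqQ t ht
      have eR := h.eqR t ht
      have eP := h.eqP t ht
      rw [br_eq_cr (hs.Q_zero t ht) (hs.R_zero t ht)] at eQ
      rw [br_eq_cr (hs.Q_zero t ht) (hs.P_zero t ht)] at eR
      rw [br_eq_cr (hs.R_zero t ht) (hs.P_zero t ht)] at eP
      have r1 : θ 0 t = -K t := by simp [hK]
      have r2 : θ 1 t = 2 * ρ 0 t + 4 * K t * ν t := by linear_combination -q1
      have r3 : θ 2 t = σ 0 t + 2 * ρ 1 t - 6 * K t * ν t ^ 2 := by linear_combination -q2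
      have r4 : σ 1 t = -4 * K t * ν t ^ 3 - 2 * ρ 2 t := by linear_combination q3
      rw [r1, neg_smul, sub_neg_eq_add] at eQ
      rw [r2, r4] at eR
      rw [r3, q4] at eP
      exact translate_algebra eQ eR eP (hνd t ht)
    have dP := fun t ht => differentiableAt_of_contDiffOn hU hs.smooth_P (t := t) ht
    have dQ := fun t ht => differentiableAt_of_contDiffOn hU hs.smooth_Q (t := t) ht
    have dR := fun t ht => differentiableAt_of_contDiffOn hU hs.smooth_R (t := t) ht
    have bR : ∀ t ∈ U, br T (fun t => R t + ν t • Q t) t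
        = br T R t + (ν t • br T Q t + (T t 0 * deriv ν t) • Q t) := fun t ht => by
      rw [br_add_right (dR t ht) ((dν t ht).differentiableAt.fun_smul (dQ t ht)),
        br_smul_right (dν t ht) (dQ t ht)]
    have bP : ∀ t ∈ U, br T (fun t => P t + (2 * ν t) • R t + ν t ^ 2 • Q t) t
        = (br T P t + ((2 * ν t) • br T R t + (2 * (T t 0 * deriv ν t)) • R t))
          + (ν t ^ 2 • br T Q t + (2 * ν t * (T t 0 * deriv ν t)) • Q t) := fun t ht => by
      have d1 := (dν t ht).const_mul 2
      have d2 : HasDerivAt (fun r => ν r ^ 2) (2 * ν t * deriv ν t) t := by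
        simpa using (dν t ht).fun_pow 2
      rw [br_add_right ((dP t ht).fun_add (d1.differentiableAt.fun_smul (dR t ht)))
        (d2.differentiableAt.fun_smul (dQ t ht)), br_add_right (dP t ht)
        (d1.differentiableAt.fun_smul (dR t ht)), br_smul_right d1 (dR t ht),
        br_smul_right d2 (dQ t ht)]
      module
    exact {
      smooth_A := (sρ 0).add (sν.mul sK)
      smooth_B := ((((contDiffOn_const.mul sν).mul (sρ 0)).add (sρ 1)).add (sσ 0)).sub
        ((sν.pow 2).mul sK)
      smooth_E := ((sσ 0).add ((contDiffOn_const.mul sν).mul (sρ 0))).add ((sν.pow 2).mul sK)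
      smooth_K := sK
      K_ne := K0
      K_deriv := fun t ht => by rw [hKd t ht]; ring
      eqQ := fun t ht => (halg t ht).1
      eqR := fun t ht => by rw [bR t ht]; exact (halg t ht).2.1
      eqP := fun t ht => by rw [bP t ht]; exact (halg t ht).2.2
      P_two := fun t ht => by
        have := (hq t ht).2.2.2.2.two_ne
        simp only [Pi.add_apply, Pi.smul_apply, smul_eq_mul] at this ⊢
        convert this using 1
        ring
      minor_ne := fun t ht => by
        have := (hq t ht).2.2.2.2.minor_ne
        simp only [Pi.add_apply, Pi.smul_apply, smul_eq_mul] at this ⊢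
        convert this using 1
        ring }

end

/-! ### Rescaling to the reduced equations -/

section

variable {𝕜 : Type*} [RCLike 𝕜] {V : Set 𝕜} {T P Q R : 𝕜 → Fin 4 → 𝕜} {A B E K : 𝕜 → 𝕜}

/-- A tetrad whose quartic is constant can be rescaled, and moved by a transformation fixing the
point at infinity, so that it satisfies the reduced equations. -/
theorem InftySys.exists_reducedEqs (hV : IsOpen V) (hc : Convex ℝ V) (hs : IsSplit V T P Q R)
    (h : InftySys V T P Q R A B E K) {t₀ : 𝕜} (ht₀ : t₀ ∈ V) :
    ∃ h κ n : 𝕜 → 𝕜, ContDiffOn 𝕜 ∞ h V ∧ (∀ t ∈ V, h t ≠ 0) ∧ (∀ t ∈ V, κ t ≠ 0) ∧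
      ∃ T' P' Q' R' : 𝕜 → Fin 4 → 𝕜, IsSplit V T' P' Q' R' ∧ ReducedEqs V T' P' Q' R' ∧
        (∀ t ∈ V, P' t 2 = 1) ∧ (∀ t ∈ V, R' t 2 * P' t 3 - R' t 3 * P' t 2 ≠ 0) ∧
        ∀ t, T' t = h t • T t ∧ P' t = (h t * κ t) • P t ∧ R' t = h t • (R t + n t • P t) ∧
          Q' t = (h t / κ t) • (Q t + (2 * n t) • R t + n t ^ 2 • P t) := by
  have hT0 := contDiffOn_apply hs.smooth_T 0
  -- `κ` and `n` solve `T κ = B κ`, `T n = B n + A`, which removes the coefficients `A`, `B`, and the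
  -- factor `κ² / K` removes `E`; the initial value of `κ` normalizes `P'`
  obtain ⟨x, hx⟩ := exists_pow_three_eq (K t₀ / P t₀ 2)
  have hx0 : x ≠ 0 := by
    rintro rfl
    exact div_ne_zero (h.K_ne t₀ ht₀) (h.P_two t₀ ht₀) (by rw [← hx]; simp)
  obtain ⟨κ, n, sκ, sn, κ0, hκ0, dκ, dn⟩ :=
    exists_linear_ode hV hc hT0 hs.T_ne h.smooth_B h.smooth_A t₀ hx0
  set g : 𝕜 → 𝕜 := fun t => κ t ^ 2 / K t with hg
  have sg : ContDiffOn 𝕜 ∞ g V := (sκ.pow 2).div h.smooth_K h.K_ne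
  have g0 : ∀ t ∈ V, g t ≠ 0 := fun t ht => div_ne_zero (pow_ne_zero _ (κ0 t)) (h.K_ne t ht)
  have hder : ∀ {f : 𝕜 → 𝕜}, ContDiffOn 𝕜 ∞ f V → ∀ t ∈ V, HasDerivAt f (deriv f t) t :=
    fun hf t ht => (differentiableAt_of_contDiffOn hV hf ht).hasDerivAt
  have dg : ∀ t ∈ V, T t 0 * deriv g t = g t * (B t - E t) := by
    intro t ht
    have h1 := ((hder sκ t ht).fun_pow 2).fun_div (hder h.smooth_K t ht) (h.K_ne t ht)
    have hK := h.K_ne t ht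
    rw [show deriv g t = _ from h1.deriv]
    have e1 := dκ t ht
    have e2 := h.K_deriv t ht
    simp only [hg]
    field_simp
    simp only [Nat.cast_ofNat, Nat.add_one_sub_one, pow_one]
    linear_combination 2 * K t * κ t * e1 - κ t ^ 2 * e2
  set T' : 𝕜 → Fin 4 → 𝕜 := fun t => g t • T t with hT'
  set P' : 𝕜 → Fin 4 → 𝕜 := fun t => (g t * κ t) • P t with hP'
  set R' : 𝕜 → Fin 4 → 𝕜 := fun t => g t • (R t + n t • P t) with hR'
  set Q' : 𝕜 → Fin 4 → 𝕜 := fun t => (g t / κ t) • (Q t + (2 * n t) • R t + n t ^ 2 • P t) with hQ'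
  have sQ := hs.smooth_Q
  have sR := hs.smooth_R
  have sP := hs.smooth_P
  have sR1 : ContDiffOn 𝕜 ∞ (fun t => R t + n t • P t) V := sR.add (sn.smul sP)
  have sQ1 : ContDiffOn 𝕜 ∞ (fun t => Q t + (2 * n t) • R t) V :=
    sQ.add ((contDiffOn_const.mul sn).smul sR)
  have sQ2 : ContDiffOn 𝕜 ∞ (fun t => Q t + (2 * n t) • R t + n t ^ 2 • P t) V :=
    sQ1.add ((sn.pow 2).smul sP)
  have hsplit : IsSplit V T' P' Q' R' := {
    smooth_T := sg.smul hs.smooth_T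
    smooth_P := (sg.mul sκ).smul sP
    smooth_Q := (sg.div sκ fun t _ => κ0 t).smul sQ2
    smooth_R := sg.smul sR1
    T_ne := fun t ht => by simpa [hT'] using ⟨g0 t ht, hs.T_ne t ht⟩
    P_zero := fun t ht => by simp [hP', hs.P_zero t ht]
    Q_zero := fun t ht => by simp [hQ', hs.P_zero t ht, hs.Q_zero t ht, hs.R_zero t ht]
    R_zero := fun t ht => by simp [hR', hs.P_zero t ht, hs.R_zero t ht] }
  have hred : ReducedEqs V T' P' Q' R' := by
    intro t ht
    have hd : ∀ {x : 𝕜 → Fin 4 → 𝕜}, ContDiffOn 𝕜 ∞ x V → DifferentiableAt 𝕜 x t := fun hx =>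
      differentiableAt_of_contDiffOn hV hx ht
    have hdn := hder sn t ht
    have d1 := hdn.const_mul 2
    have d2 : HasDerivAt (fun r => n r ^ 2) (2 * n t * deriv n t) t := by
      simpa using hdn.fun_pow 2
    have bR1 : br T (fun t => R t + n t • P t) t = br T R t + (n t • br T P t
        + (A t + B t * n t) • P t) := by
      rw [br_add_right (hd sR) (hdn.differentiableAt.fun_smul (hd sP)),
        br_smul_right hdn (hd sP), dn t ht]
      module
    have bQ2 : br T (fun t => Q t + (2 * n t) • R t + n t ^ 2 • P t) t
        = br T Q t + ((2 * n t) • br T R t + (2 * (A t + B t * n t)) • R t)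
          + (n t ^ 2 • br T P t + (2 * n t * (A t + B t * n t)) • P t) := by
      rw [br_add_right (hd sQ1) (d2.differentiableAt.fun_smul (hd sP)),
        br_add_right (hd sQ) (d1.differentiableAt.fun_smul (hd sR)),
        br_smul_right d1 (hd sR), br_smul_right d2 (hd sP),
        show T t 0 * (2 * deriv n t) = 2 * (A t + B t * n t) by linear_combination 2 * dn t ht,
        show T t 0 * (2 * n t * deriv n t) = 2 * n t * (A t + B t * n t) by
          linear_combination 2 * n t * dn t ht]
    have bP' : br T' P' t = g t • ((g t * κ t) • br T P t
        + (g t * κ t * (2 * B t - E t)) • P t) := by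
      rw [br_smul_left g (hsplit.P_zero t ht),
        br_smul_right ((hder sg t ht).fun_mul (hder sκ t ht)) (hd sP)]
      congr 3
      linear_combination κ t * dg t ht + g t * dκ t ht
    have bR' : br T' R' t = g t • (g t • (br T R t + (n t • br T P t + (A t + B t * n t) • P t))
        + (g t * (B t - E t)) • (R t + n t • P t)) := by
      rw [br_smul_left g (hsplit.R_zero t ht), br_smul_right (hder sg t ht) (hd sR1), bR1,
        dg t ht]
    have bQ' : br T' Q' t = g t • ((g t / κ t) • (br T Q t
          + ((2 * n t) • br T R t + (2 * (A t + B t * n t)) • R t)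
          + (n t ^ 2 • br T P t + (2 * n t * (A t + B t * n t)) • P t))
          + (-(g t / κ t * E t)) • (Q t + (2 * n t) • R t + n t ^ 2 • P t)) := by
      rw [br_smul_left g (hsplit.Q_zero t ht),
        br_smul_right ((hder sg t ht).fun_div (hder sκ t ht) (κ0 t)) (hd sQ2), bQ2]
      congr 3
      have := κ0 t
      field_simp
      linear_combination κ t * dg t ht - g t * dκ t ht
    have hgK : g t * K t = κ t ^ 2 := div_mul_cancel₀ _ (h.K_ne t ht)
    obtain ⟨k1, k2, k3⟩ := gauge_algebra (n := n t) (κ0 t) hgK (h.eqQ t ht) (h.eqR t ht)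
      (h.eqP t ht)
    rw [bP', bQ', bR', br_eq_cr (hsplit.Q_zero t ht) (hsplit.R_zero t ht),
      br_eq_cr (hsplit.Q_zero t ht) (hsplit.P_zero t ht),
      br_eq_cr (hsplit.R_zero t ht) (hsplit.P_zero t ht)]
    exact ⟨k1, k2, k3⟩
  -- the `L₂`-component of `P'` is constant, and equal to `1` by the choice of `κ t₀`
  have hP2 : ∀ t ∈ V, P' t 2 = 1 := by
    obtain ⟨c, hc'⟩ := exists_eq_const hV hc (contDiffOn_apply hsplit.smooth_P 2) fun t ht => by
      have h1 := congrFun (hred t ht).2.2 2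
      rw [br_eq_cr (hsplit.R_zero t ht) (hsplit.P_zero t ht)] at h1
      simp only [br, algBr, cr, Matrix.cons_val, hsplit.P_zero t ht, zero_mul, sub_zero] at h1
      have h2 := (hasDerivAt_pi.1 (differentiableAt_of_contDiffOn hV hsplit.smooth_P ht).hasDerivAt
        2).deriv
      rw [h2]
      exact (mul_eq_zero.1 h1).resolve_left (hsplit.T_ne t ht)
    intro t ht
    rw [hc' t ht, ← hc' t₀ ht₀]
    have h1 := h.K_ne t₀ ht₀
    have h2 := h.P_two t₀ ht₀
    simp only [hP', hg, hκ0, Pi.smul_apply, smul_eq_mul]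
    rw [show x ^ 2 / K t₀ * x * P t₀ 2 = x ^ 3 / K t₀ * P t₀ 2 by ring, hx]
    field_simp
  refine ⟨g, κ, n, sg, g0, fun t _ => κ0 t, T', P', Q', R', hsplit, hred, hP2, fun t ht => ?_,
    fun t => ⟨rfl, rfl, rfl, rfl⟩⟩
  have h1 := h.minor_ne t ht
  have : R' t 2 * P' t 3 - R' t 3 * P' t 2
      = g t ^ 2 * κ t * (R t 2 * P t 3 - R t 3 * P t 2) := by
    simp only [hR', hP', Pi.smul_apply, Pi.add_apply, smul_eq_mul]
    ring
  rw [this]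
  exact mul_ne_zero (mul_ne_zero (pow_ne_zero _ (g0 t ht)) (κ0 t)) h1

end

/-! ### Solving the reduced equations -/

section

variable {𝕜 : Type*} [RCLike 𝕜] {V : Set 𝕜} {T P Q R : 𝕜 → Fin 4 → 𝕜}

/-- A smooth function with nonvanishing derivative has smooth local inverses. -/
theorem exists_local_inverse (hV : IsOpen V) {τ : 𝕜 → 𝕜} (hτ : ContDiffOn 𝕜 ∞ τ V)
    (hτ0 : ∀ t ∈ V, deriv τ t ≠ 0) {t₀ : 𝕜} (ht₀ : t₀ ∈ V) :
    ∃ (V' I : Set 𝕜) (g : 𝕜 → 𝕜), IsOpen V' ∧ t₀ ∈ V' ∧ V' ⊆ V ∧ IsOpen I ∧ Set.MapsTo τ V' I ∧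
      Set.MapsTo g I V' ∧ (∀ t ∈ V', g (τ t) = t) ∧ (∀ s ∈ I, τ (g s) = s) ∧
      ContDiffOn 𝕜 ∞ g I := by
  have hd : ∀ t ∈ V, HasDerivAt τ (deriv τ t) t := fun t ht =>
    (differentiableAt_of_contDiffOn hV hτ ht).hasDerivAt
  have hc : ∀ t ∈ V, ContDiffAt 𝕜 ∞ τ t := fun t ht => hτ.contDiffAt (hV.mem_nhds ht)
  set e := (hc t₀ ht₀).toOpenPartialHomeomorph τ ((hd t₀ ht₀).hasFDerivAt_equiv (hτ0 t₀ ht₀))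
    (by simp)
  set e' := e.restrOpen V hV
  have hsub : e'.source ⊆ V := fun t ht => ht.2
  refine ⟨e'.source, e'.target, e'.symm, e'.open_source, ⟨?_, ht₀⟩, hsub, e'.open_target,
    fun t ht => e'.map_source ht, fun s hs => e'.map_target hs, fun t ht => e'.left_inv ht,
    fun s hs => e'.right_inv hs, fun s hs => ?_⟩
  · exact (hc t₀ ht₀).mem_toOpenPartialHomeomorph_source _ _
  · have h1 : e'.symm s ∈ V := hsub (e'.map_target hs)
    exact (e'.contDiffAt_symm_deriv (hτ0 _ h1) hs (hd _ h1) (hc _ h1)).contDiffWithinAt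

theorem deriv_apply {x : 𝕜 → Fin 4 → 𝕜} {t : 𝕜} (hx : DifferentiableAt 𝕜 x t) (i : Fin 4) :
    deriv x t i = deriv (fun r => x r i) t :=
  (hasDerivAt_pi.1 hx.hasDerivAt i).deriv.symm

theorem deriv_vec {x₀ x₁ x₂ x₃ : 𝕜 → 𝕜} {y₀ y₁ y₂ y₃ t : 𝕜} (h₀ : HasDerivAt x₀ y₀ t)
    (h₁ : HasDerivAt x₁ y₁ t) (h₂ : HasDerivAt x₂ y₂ t) (h₃ : HasDerivAt x₃ y₃ t) :
    HasDerivAt (fun t => ![x₀ t, x₁ t, x₂ t, x₃ t]) ![y₀, y₁, y₂, y₃] t :=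
  hasDerivAt_pi.2 fun i => by fin_cases i <;> assumption

/-- The components of the reduced equations: only the `L₁`-components contain brackets. -/
theorem ReducedEqs.components (hV : IsOpen V) (hs : IsSplit V T P Q R) (h : ReducedEqs V T P Q R)
    {t : 𝕜} (ht : t ∈ V) :
    (T t 0 * deriv (fun r => Q r 1) t + (T t 1 * Q t 2 - T t 2 * Q t 1)
        = Q t 1 * R t 2 - Q t 2 * R t 1 + P t 1 ∧
      2 * (T t 0 * deriv (fun r => R r 1) t + (T t 1 * R t 2 - T t 2 * R t 1))
        = Q t 1 * P t 2 - Q t 2 * P t 1 ∧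
      T t 0 * deriv (fun r => P r 1) t + (T t 1 * P t 2 - T t 2 * P t 1)
        = R t 1 * P t 2 - R t 2 * P t 1) ∧
    (T t 0 * deriv (fun r => Q r 2) t = P t 2 ∧ deriv (fun r => R r 2) t = 0) ∧
    T t 0 * deriv (fun r => Q r 3) t = P t 3 ∧ deriv (fun r => R r 3) t = 0 ∧
      deriv (fun r => P r 3) t = 0 := by
  obtain ⟨hQ, hR, hP⟩ := h t ht
  have dQ := deriv_apply (differentiableAt_of_contDiffOn hV hs.smooth_Q ht)
  have dR := deriv_apply (differentiableAt_of_contDiffOn hV hs.smooth_R ht)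
  have dP := deriv_apply (differentiableAt_of_contDiffOn hV hs.smooth_P ht)
  have hT := hs.T_ne t ht
  rw [br_eq_cr (hs.Q_zero t ht) (hs.R_zero t ht)] at hQ
  rw [br_eq_cr (hs.Q_zero t ht) (hs.P_zero t ht)] at hR
  rw [br_eq_cr (hs.R_zero t ht) (hs.P_zero t ht)] at hP
  have q := fun i => congrFun hQ i
  have r := fun i => congrFun hR i
  have p := fun i => congrFun hP i
  have q1 := q 1
  have q2 := q 2
  have q3 := q 3
  have r1 := r 1
  have r2 := r 2
  have r3 := r 3
  have p1 := p 1
  have p3 := p 3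
  simp only [br, algBr, cr, Matrix.cons_val, Pi.add_apply, Pi.smul_apply, smul_eq_mul,
    hs.Q_zero t ht, hs.R_zero t ht, hs.P_zero t ht, zero_mul, sub_zero, zero_add, dQ, dR, dP]
    at q1 q2 q3 r1 r2 r3 p1 p3
  exact ⟨⟨q1, r1, p1⟩, ⟨q2, (mul_eq_zero.1 ((mul_eq_zero.1 r2).resolve_left two_ne_zero)).resolve_left
    hT⟩, q3, (mul_eq_zero.1 ((mul_eq_zero.1 r3).resolve_left two_ne_zero)).resolve_left hT,
    (mul_eq_zero.1 p3).resolve_left hT⟩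

/-- A solution of the reduced equations takes the normal form in a suitable coordinate and a
suitable basis of invariant fields commuting with `T`. -/
theorem ReducedEqs.exists_normalForm (hV : IsOpen V) (hc : Convex ℝ V) (hs : IsSplit V T P Q R)
    (h : ReducedEqs V T P Q R) (hP2 : ∀ t ∈ V, P t 2 = 1)
    (hminor : ∀ t ∈ V, R t 2 * P t 3 - R t 3 * P t 2 ≠ 0) {t₀ : 𝕜} (ht₀ : t₀ ∈ V) :
    ∃ (V' : Set 𝕜) (τ : 𝕜 → 𝕜) (L : Fin 3 → VField 𝕜) (I : Set 𝕜) (F : 𝕜 → 𝕜) (c₁ c₂ : 𝕜),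
      IsOpen V' ∧ t₀ ∈ V' ∧ V' ⊆ V ∧ IsAdapted V' τ (invField T) L ∧ IsOpen I ∧ Set.MapsTo τ V' I ∧
      ContDiffOn 𝕜 ∞ F I ∧ IsAiryOn (deriv F) I ∧ ∀ p ∈ cyl V',
        fieldP F τ L p = invField P p ∧ fieldQ c₁ c₂ F τ L p = invField Q p ∧
        fieldR c₁ F τ L p = invField R p := by
  have hcomp := fun t ht => h.components hV hs (t := t) ht
  have sT := fun i => contDiffOn_apply hs.smooth_T i
  have sP := fun i => contDiffOn_apply hs.smooth_P i
  have sQ := fun i => contDiffOn_apply hs.smooth_Q i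
  have sR := fun i => contDiffOn_apply hs.smooth_R i
  have hder : ∀ {f : 𝕜 → 𝕜}, ContDiffOn 𝕜 ∞ f V → ∀ t ∈ V, HasDerivAt f (deriv f t) t :=
    fun hf t ht => (differentiableAt_of_contDiffOn hV hf ht).hasDerivAt
  -- the `L₃`-components of `P`, `R` and the `L₂`-component of `R` are constant, and so is
  -- the combination `d`
  obtain ⟨v, hv⟩ := exists_eq_const hV hc (sP 3) fun t ht => (hcomp t ht).2.2.2.2
  obtain ⟨c₁, hc₁⟩ := exists_eq_const hV hc (sR 2) fun t ht => (hcomp t ht).2.1.2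
  obtain ⟨w₀, hw₀⟩ := exists_eq_const hV hc (sR 3) fun t ht => (hcomp t ht).2.2.2.1
  obtain ⟨d, hd⟩ := exists_eq_const hV hc (f := fun t => Q t 3 - v * Q t 2)
    ((sQ 3).sub (contDiffOn_const.mul (sQ 2))) fun t ht => by
      rw [show deriv (fun t => Q t 3 - v * Q t 2) t = _ from
        ((hder (sQ 3) t ht).sub ((hder (sQ 2) t ht).const_mul v)).deriv]
      refine (mul_eq_zero.1 (?_ : T t 0 * _ = 0)).resolve_left (hs.T_ne t ht)
      linear_combination (hcomp t ht).2.2.1 - v * (hcomp t ht).2.1.1 + hv t ht - v * hP2 t ht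
  set w : 𝕜 := w₀ - v * c₁ with hw
  have hw_ne : w ≠ 0 := by
    have := hminor t₀ ht₀
    rw [hP2 t₀ ht₀, hv t₀ ht₀, hc₁ t₀ ht₀, hw₀ t₀ ht₀] at this
    intro h0
    exact this (by linear_combination -h0)
  -- the functions `a`, `b` make `a L₁` and `b L₁ + L₂ + v L₃` commute with `T`; the coordinate is
  -- the `L₂`-component of `Q`, up to a constant
  obtain ⟨a, b, sa, sb, a0, -, da, db⟩ :=
    exists_linear_ode hV hc (sT 0) hs.T_ne (sT 2) (sT 1).neg t₀ (one_ne_zero (α := 𝕜))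
  set τ : 𝕜 → 𝕜 := fun t => Q t 2 - c₁ ^ 2 with hτ
  have sτ : ContDiffOn 𝕜 ∞ τ V := (sQ 2).sub contDiffOn_const
  have dτ : ∀ t ∈ V, T t 0 * deriv τ t = 1 := fun t ht => by
    rw [show deriv τ t = _ from ((hder (sQ 2) t ht).sub_const (c₁ ^ 2)).deriv, (hcomp t ht).2.1.1,
      hP2 t ht]
  have dτ0 : ∀ t ∈ V, deriv τ t ≠ 0 := fun t ht h0 => by
    have := dτ t ht
    simp [h0] at this
  obtain ⟨V', I, g, hV', ht₀', hsub, hI, hτI, hgV, hgτ, hτg, sg⟩ :=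
    exists_local_inverse hV sτ dτ0 ht₀
  have dg : ∀ s ∈ I, HasDerivAt g (T (g s) 0) s := by
    intro s hs'
    have h1 := (differentiableAt_of_contDiffOn hI sg hs').hasDerivAt
    have hgs := hsub (hgV hs')
    have h2 := (hder sτ _ hgs).comp s h1
    have h3 := h2.unique ((hasDerivAt_id s).congr_of_eventuallyEq
      (by filter_upwards [hI.mem_nhds hs'] with r hr using hτg r hr))
    have h4 := dτ _ hgs
    refine h1.congr_deriv ?_
    linear_combination T (g s) 0 * h3 - deriv g s * h4
  -- the function `F` and its derivatives, pulled back to `V`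
  set φ₀ : 𝕜 → 𝕜 := fun t => 2 * (P t 1 - b t) / a t with hφ₀
  set φ₁ : 𝕜 → 𝕜 := fun t => 2 * (R t 1 - c₁ * P t 1) / a t with hφ₁
  set φ₂ : 𝕜 → 𝕜 := fun t => (Q t 1 - Q t 2 * P t 1 - 2 * c₁ * (R t 1 - c₁ * P t 1)) / a t with hφ₂
  have sφ₀ : ContDiffOn 𝕜 ∞ φ₀ V := (contDiffOn_const.mul ((sP 1).sub sb)).div sa fun t _ => a0 t
  have sφ₁ : ContDiffOn 𝕜 ∞ φ₁ V :=
    (contDiffOn_const.mul ((sR 1).sub (contDiffOn_const.mul (sP 1)))).div sa fun t _ => a0 t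
  have sφ₂ : ContDiffOn 𝕜 ∞ φ₂ V := (((sQ 1).sub ((sQ 2).mul (sP 1))).sub
    (contDiffOn_const.mul ((sR 1).sub (contDiffOn_const.mul (sP 1))))).div sa fun t _ => a0 t
  have dφ₀ : ∀ t ∈ V, T t 0 * deriv φ₀ t = φ₁ t := by
    intro t ht
    have h1 := (((hder (sP 1) t ht).sub (hder sb t ht)).const_mul 2).fun_div (hder sa t ht) (a0 t)
    rw [show deriv φ₀ t = _ from h1.deriv]
    have k := (hcomp t ht).1.2.2
    rw [hP2 t ht, hc₁ t ht] at k
    have := a0 t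
    simp only [hφ₁, Pi.sub_apply]
    field_simp
    linear_combination a t * k - a t * db t ht - (P t 1 - b t) * da t ht
  have dφ₁ : ∀ t ∈ V, T t 0 * deriv φ₁ t = φ₂ t := by
    intro t ht
    have h1 := (((hder (sR 1) t ht).sub ((hder (sP 1) t ht).const_mul c₁)).const_mul 2).fun_div
      (hder sa t ht) (a0 t)
    rw [show deriv φ₁ t = _ from h1.deriv]
    have k1 := (hcomp t ht).1.2.2
    have k2 := (hcomp t ht).1.2.1
    rw [hP2 t ht, hc₁ t ht] at k1 k2
    have := a0 t
    simp only [hφ₂, Pi.sub_apply]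
    field_simp
    linear_combination a t * k2 - 2 * c₁ * a t * k1 - 2 * (R t 1 - c₁ * P t 1) * da t ht
  have dφ₂ : ∀ t ∈ V, T t 0 * deriv φ₂ t = -τ t * φ₁ t := by
    intro t ht
    have h1 := (((hder (sQ 1) t ht).sub ((hder (sQ 2) t ht).mul (hder (sP 1) t ht))).sub
      (((hder (sR 1) t ht).sub ((hder (sP 1) t ht).const_mul c₁)).const_mul (2 * c₁))).fun_div
      (hder sa t ht) (a0 t)
    rw [show deriv φ₂ t = _ from h1.deriv]
    have k1 := (hcomp t ht).1.2.2
    have k2 := (hcomp t ht).1.2.1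
    have k3 := (hcomp t ht).1.1
    have k4 := (hcomp t ht).2.1.1
    rw [hP2 t ht, hc₁ t ht] at k1 k2
    rw [hc₁ t ht] at k3
    rw [hP2 t ht] at k4
    have := a0 t
    simp only [hφ₁, hτ, Pi.sub_apply, Pi.mul_apply]
    field_simp
    linear_combination a t * k3 - a t * P t 1 * k4 - a t * Q t 2 * k1 - c₁ * a t * k2
      + 2 * c₁ ^ 2 * a t * k1
      - (Q t 1 - Q t 2 * P t 1 - 2 * c₁ * (R t 1 - c₁ * P t 1)) * da t ht
  have hcomp_g : ∀ {φ ψ : 𝕜 → 𝕜}, ContDiffOn 𝕜 ∞ φ V → (∀ t ∈ V, T t 0 * deriv φ t = ψ t) →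
      ∀ s ∈ I, deriv (φ ∘ g) s = ψ (g s) := fun {φ ψ} hφ hd s hs' => by
    have hgs := hsub (hgV hs')
    rw [((hder hφ _ hgs).comp s (dg s hs')).deriv, ← hd _ hgs, mul_comm]
  set F : 𝕜 → 𝕜 := φ₀ ∘ g with hF
  have sF : ContDiffOn 𝕜 ∞ F I := sφ₀.comp sg fun s hs' => hsub (hgV hs')
  have F1 : ∀ s ∈ I, deriv F s = φ₁ (g s) := hcomp_g sφ₀ dφ₀
  have hev : ∀ s ∈ I, ∀ᶠ r in nhds s, r ∈ I := fun s hs' => hI.mem_nhds hs'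
  have F2 : ∀ s ∈ I, deriv (deriv F) s = φ₂ (g s) := fun s hs' => by
    rw [Filter.EventuallyEq.deriv_eq (show _ =ᶠ[nhds s] φ₁ ∘ g from
      (hev s hs').mono fun r hr => F1 r hr)]
    exact hcomp_g sφ₁ dφ₁ s hs'
  have F3 : ∀ s ∈ I, deriv (deriv (deriv F)) s = -s * φ₁ (g s) := fun s hs' => by
    rw [Filter.EventuallyEq.deriv_eq (show _ =ᶠ[nhds s] φ₂ ∘ g from
      (hev s hs').mono fun r hr => F2 r hr),
      hcomp_g sφ₂ dφ₂ s hs', hτg s hs']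
  set l₀ : 𝕜 → Fin 4 → 𝕜 := fun t => ![0, a t, 0, 0] with hl₀
  set l₁ : 𝕜 → Fin 4 → 𝕜 := fun t => ![0, b t, 1, v] with hl₁
  set l₂ : 𝕜 → Fin 4 → 𝕜 := fun _ => ![0, 0, 0, w] with hl₂
  have dl₀ : ∀ t ∈ V, HasDerivAt l₀ ![0, deriv a t, 0, 0] t := fun t ht =>
    deriv_vec (hasDerivAt_const _ _) (hder sa t ht) (hasDerivAt_const _ _) (hasDerivAt_const _ _)
  have dl₁ : ∀ t ∈ V, HasDerivAt l₁ ![0, deriv b t, 0, 0] t := fun t ht =>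
    deriv_vec (hasDerivAt_const _ _) (hder sb t ht) (hasDerivAt_const _ _) (hasDerivAt_const _ _)
  have dl₂ : ∀ t, HasDerivAt l₂ 0 t := fun t => hasDerivAt_const _ _
  have sl₀ : ContDiffOn 𝕜 ∞ l₀ V := contDiffOn_pi.2 fun i => by
    fin_cases i
    exacts [contDiffOn_const, sa, contDiffOn_const, contDiffOn_const]
  have sl₁ : ContDiffOn 𝕜 ∞ l₁ V := contDiffOn_pi.2 fun i => by
    fin_cases i
    exacts [contDiffOn_const, sb, contDiffOn_const, contDiffOn_const]
  have sl₂ : ContDiffOn 𝕜 ∞ l₂ V := contDiffOn_const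
  refine ⟨V', τ, ![invField l₀, invField l₁, invField l₂], I, F, c₁, d / w, hV', ht₀', hsub, ?_, hI,
    hτI, sF, fun s hs' => ?_, fun p hp => ?_⟩
  · have hT' := fun p (hp : p ∈ cyl V') =>
      differentiableAt_of_contDiffOn hV hs.smooth_T (hsub hp)
    have e0 := fun p (hp : p ∈ cyl V') => (dl₀ _ (hsub hp)).differentiableAt
    have e1 := fun p (hp : p ∈ cyl V') => (dl₁ _ (hsub hp)).differentiableAt
    have e2 := fun p : Pt 𝕜 => (dl₂ (p 0)).differentiableAt
    exact {
      smooth_τ := sτ.mono hsub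
      smooth_T := contDiffOn_invField (hs.smooth_T.mono hsub)
      smooth_L := fun j => by
        fin_cases j
        exacts [contDiffOn_invField (sl₀.mono hsub), contDiffOn_invField (sl₁.mono hsub),
          contDiffOn_invField (sl₂.mono hsub)]
      invariant_T := isInvariant_invField _ _
      invariant_L := fun j => by fin_cases j <;> exact isInvariant_invField _ _
      indep := fun p hp => by
        rw [Fintype.linearIndependent_iff]
        intro c hc
        have k1 := congrFun hc 1
        have k2 := congrFun hc 2
        have k3 := congrFun hc 3
        simp [Fin.sum_univ_three, invField, lift_apply, l₀, l₁, l₂] at k1 k2 k3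
        have c1 : c 1 = 0 := k2
        rw [c1] at k1 k3
        simp [exp_ne_zero', a0] at k1
        simp [hw_ne] at k3
        intro j
        fin_cases j
        exacts [k1, c1, k3]
      dτ_T := fun p hp => by
        have := dτ _ (hsub hp)
        rw [mul_comm] at this
        exact this
      dτ_L := fun p hp j => by fin_cases j <;> rfl
      comm := fun p hp j => by
        have ht := hsub hp
        fin_cases j
        · refine (lieBracket_invField (hT' p hp) (e0 p hp)).trans ?_
          rw [br, (dl₀ _ ht).deriv]
          rw [← map_zero (lift p)]
          congr 1
          ext i
          fin_cases i <;> simp [algBr, l₀]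
          linear_combination da _ ht
        · refine (lieBracket_invField (hT' p hp) (e1 p hp)).trans ?_
          rw [br, (dl₁ _ ht).deriv]
          rw [← map_zero (lift p)]
          congr 1
          ext i
          fin_cases i <;> simp [algBr, l₁]
          linear_combination db _ ht
        · refine (lieBracket_invField (hT' p hp) (e2 p)).trans ?_
          rw [br, (dl₂ _).deriv]
          rw [← map_zero (lift p)]
          congr 1
          ext i
          fin_cases i <;> simp [algBr, l₂]
      bracket₁₂ := fun p hp => by
        refine (lieBracket_invField (e0 p hp) (e1 p hp)).trans ?_
        rw [br_eq_cr rfl rfl]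
        change _ = lift p (l₀ (p 0))
        congr 1
        ext i
        fin_cases i <;> simp [cr, l₀, l₁]
      bracket₁₃ := fun p hp => by
        refine (lieBracket_invField (e0 p hp) (e2 p)).trans ?_
        rw [br_eq_cr rfl rfl, ← map_zero (lift p)]
        congr 1
        ext i
        fin_cases i <;> simp [cr, l₀, l₂]
      bracket₂₃ := fun p hp => by
        refine (lieBracket_invField (e1 p hp) (e2 p)).trans ?_
        rw [br_eq_cr rfl rfl, ← map_zero (lift p)]
        congr 1
        ext i
        fin_cases i <;> simp [cr, l₁, l₂] }
  · rw [F3 s hs', F1 s hs']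
    ring
  · have hp' : p 0 ∈ V := hsub hp
    have G0 : F (τ (p 0)) = φ₀ (p 0) := by simp only [hF, Function.comp_apply, hgτ _ hp]
    have G1 : deriv F (τ (p 0)) = φ₁ (p 0) := by rw [F1 _ (hτI hp), hgτ _ hp]
    have G2 : deriv (deriv F) (τ (p 0)) = φ₂ (p 0) := by rw [F2 _ (hτI hp), hgτ _ hp]
    have hτp : c₁ ^ 2 + τ (p 0) = Q (p 0) 2 := by simp [hτ]
    have ha := a0 (p 0)
    have hq3 : Q (p 0) 3 = v * Q (p 0) 2 + d := by linear_combination hd _ hp'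
    refine ⟨?_, ?_, ?_⟩
    · simp only [fieldP, G0, Matrix.cons_val, invField, ← map_smul, ← map_add]
      congr 1
      ext i
      fin_cases i <;> simp [l₀, l₁, hs.P_zero _ hp', hP2 _ hp', hv _ hp', hφ₀]
      field_simp
      ring
    · simp only [fieldQ, G0, G1, G2, hτp, Matrix.cons_val, invField, ← map_smul, ← map_add]
      congr 1
      ext i
      fin_cases i <;> simp [l₀, l₁, l₂, hs.Q_zero _ hp', hφ₀, hφ₁, hφ₂, hq3]
      · field_simp
        ring
      · field_simp
    · simp only [fieldR, G0, G1, Matrix.cons_val, invField, ← map_smul, ← map_add]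
      congr 1
      ext i
      fin_cases i <;> simp [l₀, l₁, l₂, hs.R_zero _ hp', hφ₀, hφ₁, hc₁ _ hp', hw₀ _ hp', hw]
      · field_simp
        ring
      · ring

end

/-! ### Conformal frames -/

section

variable {𝕜 : Type*} [RCLike 𝕜] {U V : Set 𝕜} {T P Q R : 𝕜 → Fin 4 → 𝕜}

/-- The frame `E'` defines, up to the factor `w`, the same contravariant metric as the frame `E`,
and the same orientation. -/
def ConformalFrames (E E' : Fin 4 → Fin 4 → 𝕜) (w : 𝕜) : Prop :=
  ∃ M : Matrix (Fin 4) (Fin 4) 𝕜, (∀ a, E' a = ∑ b, M a b • E b) ∧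
    M.transpose * eta 𝕜 * M = w • eta 𝕜 ∧ M.det = w ^ 2

theorem ConformalFrames.trans {E E' E'' : Fin 4 → Fin 4 → 𝕜} {w w' : 𝕜}
    (h : ConformalFrames E E' w) (h' : ConformalFrames E' E'' w') :
    ConformalFrames E E'' (w' * w) := by
  obtain ⟨M, h1, h2, h3⟩ := h
  obtain ⟨M', h1', h2', h3'⟩ := h'
  refine ⟨M' * M, fun a => ?_, ?_, ?_⟩
  · rw [h1' a]
    simp only [h1, Finset.smul_sum, Matrix.mul_apply, Finset.sum_smul, smul_smul]
    exact Finset.sum_comm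
  · rw [Matrix.transpose_mul, show M.transpose * M'.transpose * eta 𝕜 * (M' * M)
      = M.transpose * (M'.transpose * eta 𝕜 * M') * M by simp only [Matrix.mul_assoc], h2',
      Matrix.mul_smul, Matrix.smul_mul, h2, smul_smul]
  · rw [Matrix.det_mul, h3, h3']
    ring

theorem conformalFrames_splitFrame (E : Fin 4 → 𝕜 → Fin 4 → 𝕜) (t : 𝕜) :
    ConformalFrames (fun a => E a t) (fun a => splitFrame E a t) (splitFactor E t) := by
  refine ⟨splitMatrix E t, splitFrame_eq_sum t, ?_, det_splitMatrix t⟩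
  ext i j
  fin_cases i <;> fin_cases j <;>
    simp [Matrix.mul_apply, Fin.sum_univ_four, splitMatrix, eta, splitFactor] <;> ring

theorem conformalFrames_inversion (t : 𝕜) :
    ConformalFrames (fun a => compOf T P Q R a t) (fun a => compOf T Q P (-R) a t) 1 := by
  refine ⟨eta 𝕜, fun a => ?_, ?_, ?_⟩
  · fin_cases a <;> simp [Fin.sum_univ_four, eta, compOf, sub_eq_add_neg]
  · ext i j
    fin_cases i <;> fin_cases j <;> simp [Matrix.mul_apply, Fin.sum_univ_four, eta]
  · rw [det_fin_four]
    simp [eta]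

theorem conformalFrames_translation (ν : 𝕜 → 𝕜) (t : 𝕜) :
    ConformalFrames (fun a => compOf T P Q R a t) (fun a => compOf T
      (fun t => P t + (2 * ν t) • R t + ν t ^ 2 • Q t) Q (fun t => R t + ν t • Q t) a t) 1 := by
  refine ⟨!![1, -ν t ^ 2, ν t, -ν t; 0, 1, 0, 0; 0, -ν t, 1, 0; 0, ν t, 0, 1], fun a => ?_, ?_, ?_⟩
  · fin_cases a <;> simp [Fin.sum_univ_four, compOf] <;> module
  · ext i j
    fin_cases i <;> fin_cases j <;> simp [Matrix.mul_apply, Fin.sum_univ_four, eta]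
    ring
  · rw [det_fin_four]
    simp

theorem conformalFrames_gauge {T' P' Q' R' : 𝕜 → Fin 4 → 𝕜} {h κ n : 𝕜 → 𝕜} {t : 𝕜}
    (hκ : κ t ≠ 0) (hT : T' t = h t • T t) (hP : P' t = (h t * κ t) • P t)
    (hR : R' t = h t • (R t + n t • P t))
    (hQ : Q' t = (h t / κ t) • (Q t + (2 * n t) • R t + n t ^ 2 • P t)) :
    ConformalFrames (fun a => compOf T P Q R a t) (fun a => compOf T' P' Q' R' a t) (h t ^ 2) := by
  refine ⟨!![h t * κ t, 0, 0, 0;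
    -(h t / κ t) * n t ^ 2, h t / κ t, -(h t / κ t) * n t, (h t / κ t) * n t;
    h t * n t, 0, h t, 0; -(h t * n t), 0, 0, h t], fun a => ?_, ?_, ?_⟩
  · fin_cases a <;> simp [Fin.sum_univ_four, compOf, hT, hP, hR, hQ] <;> module
  · ext i j
    fin_cases i <;> fin_cases j <;> simp [Matrix.mul_apply, Fin.sum_univ_four, eta] <;>
      field_simp <;> ring
  · rw [det_fin_four]
    simp
    field_simp

theorem Tetrad.cometric_eq (e : Tetrad 𝕜) (p : Pt 𝕜) (ξ ζ : Module.Dual 𝕜 (Pt 𝕜)) :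
    e.cometric p ξ ζ
      = (fun a => ξ (e.frame a p)) ⬝ᵥ (eta 𝕜).mulVec (fun a => ζ (e.frame a p)) := by
  simp [Tetrad.cometric, Matrix.mulVec, dotProduct, Fin.sum_univ_four, eta, Tetrad.frame]
  ring

/-- Invariant tetrads with conformal components define the same conformal structure. -/
theorem Tetrad.HasComponents.sameConformal {e e' : Tetrad 𝕜} {E E' : Fin 4 → 𝕜 → Fin 4 → 𝕜}
    (he : e.HasComponents V E) (he' : e'.HasComponents V E') {w : 𝕜 → 𝕜}
    (hw : ContDiffOn 𝕜 ∞ w V) (hw0 : ∀ t ∈ V, w t ≠ 0)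
    (h : ∀ t ∈ V, ConformalFrames (fun a => E a t) (fun a => E' a t) (w t)) :
    e.SameConformal e' (cyl V) := by
  refine ⟨fun p => w (p 0), contDiffOn_comp_time hw, fun p hp => ⟨hw0 _ hp, ?_⟩⟩
  obtain ⟨M, h1, h2, h3⟩ := h _ hp
  have hM : ∀ a, e'.frame a p = ∑ b, M a b • e.frame b p := fun a => by
    have h4 : E' a (p 0) = ∑ b, M a b • E b (p 0) := h1 a
    have h5 : ∀ b, e.frame b p = lift p (E b (p 0)) := fun b => he b p hp
    simp only [h5, ← map_smul, ← map_sum, ← h4]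
    exact he' a p hp
  refine ⟨fun ξ ζ => ?_, ?_⟩
  · have hx : ∀ ξ : Module.Dual 𝕜 (Pt 𝕜), (fun a => ξ (e'.frame a p))
        = M.mulVec fun a => ξ (e.frame a p) := fun ξ => by
      funext a
      simp [hM, Matrix.mulVec, dotProduct]
    rw [Tetrad.cometric_eq, Tetrad.cometric_eq, hx, hx, Matrix.dotProduct_mulVec,
      Matrix.vecMul_mulVec, ← Matrix.dotProduct_mulVec, Matrix.mulVec_mulVec,
      h2, Matrix.smul_mulVec, dotProduct_smul, smul_eq_mul]
  · have : e'.frameMatrix p = e.frameMatrix p * M.transpose := by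
      ext i a
      simp [Tetrad.frameMatrix, hM, Matrix.mul_apply, mul_comm]
    rw [this, Matrix.det_mul, Matrix.det_transpose, h3, mul_comm]

end

/-! ### The adapted frame of a class in general position -/

section

variable {𝕜 : Type*} [RCLike 𝕜] {U V : Set 𝕜} {T P Q R : 𝕜 → Fin 4 → 𝕜}
  {E E' : Fin 4 → 𝕜 → Fin 4 → 𝕜} {e : Tetrad 𝕜}

/-- The field `P = -W` of the frame `splitFrame E`. -/
def splitP (E : Fin 4 → 𝕜 → Fin 4 → 𝕜) : 𝕜 → Fin 4 → 𝕜 := fun t => -splitFrame E 0 t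

/-- The field `Q = W̃` of the frame `splitFrame E`. -/
def splitQ (E : Fin 4 → 𝕜 → Fin 4 → 𝕜) : 𝕜 → Fin 4 → 𝕜 := splitFrame E 1

/-- The field `R = (Z̃ - Z) / 2` of the frame `splitFrame E`. -/
def splitR (E : Fin 4 → 𝕜 → Fin 4 → 𝕜) : 𝕜 → Fin 4 → 𝕜 := fun t =>
  (1 / 2 : 𝕜) • (splitFrame E 3 t - splitFrame E 2 t)

/-- The field `T = (Z̃ + Z) / 2` of the frame `splitFrame E`. -/
def splitT (E : Fin 4 → 𝕜 → Fin 4 → 𝕜) : 𝕜 → Fin 4 → 𝕜 := fun t =>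
  (1 / 2 : 𝕜) • (splitFrame E 3 t + splitFrame E 2 t)

theorem compOf_split (E : Fin 4 → 𝕜 → Fin 4 → 𝕜) :
    compOf (splitT E) (splitP E) (splitQ E) (splitR E) = splitFrame E := by
  funext a t
  fin_cases a
  · simp [compOf, splitP]
  · simp [compOf, splitQ]
  · simp [compOf, splitT, splitR]
    module
  · simp [compOf, splitT, splitR]
    module

theorem isSplit_split (hE : ∀ a, ContDiffOn 𝕜 ∞ (E a) U) (hD : ∀ t ∈ U, splitFactor E t ≠ 0) :
    IsSplit U (splitT E) (splitP E) (splitQ E) (splitR E) where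
  smooth_T := ((contDiffOn_splitFrame hE 3).add (contDiffOn_splitFrame hE 2)).const_smul
    (1 / 2 : 𝕜)
  smooth_P := (contDiffOn_splitFrame hE 0).neg
  smooth_Q := contDiffOn_splitFrame hE 1
  smooth_R := ((contDiffOn_splitFrame hE 3).sub (contDiffOn_splitFrame hE 2)).const_smul
    (1 / 2 : 𝕜)
  T_ne := fun t ht => by
    convert hD t ht using 1
    simp [splitT, splitFrame, splitFactor]
    ring
  P_zero := fun t _ => by
    simp [splitP, splitFrame]
    ring
  Q_zero := fun t _ => by
    simp [splitQ, splitFrame]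
    ring
  R_zero := fun t _ => by
    simp [splitR, splitFrame]
    ring

/-- The quartic of the adapted frame is the twistor quartic of the original one, up to a factor. -/
theorem quartic_split (hU : IsOpen U) (he : e.HasComponents U E)
    (hE : ∀ a, ContDiffOn 𝕜 ∞ (E a) U) (hdet : ∀ t ∈ U, (compMatrix E t).det ≠ 0)
    (hD : ∀ t ∈ U, splitFactor E t ≠ 0) {p : Pt 𝕜} (hp : p ∈ cyl U) (s : 𝕜) :
    s ^ 2 * quad (fun i => twistCoeff (splitFrame E) 1 i (p 0)) s
      + 2 * s * quad (fun i => twistCoeff (splitFrame E) 2 i (p 0)) s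
      - quad (fun i => twistCoeff (splitFrame E) 0 i (p 0)) s
    = -(e.frameMatrix p).det * e.twistorQuartic
        (fun i p => laxCoeff₀ (fun a b d => structC E a b d (p 0)) i)
        (fun i p => laxCoeff₁ (fun a b d => structC E a b d (p 0)) i) p s := by
  have hd : (e.frameMatrix p).det ≠ 0 := by
    rw [he.det_frameMatrix hp]
    exact mul_ne_zero (exp_ne_zero' _) (hdet _ hp)
  have hS := isSplit_split hE hD
  have h1 := hS.twistG_two_add_three hU hp (by
    rw [compOf_split, det_compMatrix_splitFrame]
    exact mul_ne_zero (pow_ne_zero _ (hD _ hp)) (hdet _ hp)) s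
  rw [compOf_split] at h1
  obtain ⟨k0, k1, -, -⟩ := twistG_splitFrame hU hE hdet hD hp s _ _ _ rfl rfl rfl
  have hf : ∀ a, e.frame a p 0 = E a (p 0) 0 := fun a => by
    rw [he a p hp]
    rfl
  have c0 := cubic_laxCoeff₀ (fun a b d => structC E a b d (p 0)) s
  have c1 := cubic_laxCoeff₁ (fun a b d => structC E a b d (p 0)) s
  have hc : ∀ g : Fin 4 → 𝕜, ∑ i : Fin 4, g i * s ^ (i : ℕ) = cubic g s := fun g => by
    simp [Fin.sum_univ_four, cubic]
  rw [twistorQuartic_eq, ← mul_assoc, neg_mul, mul_inv_cancel₀ hd, hc, hc, c0, c1,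
    show e.Wt p 0 = E 1 (p 0) 0 from hf 1, show e.Z p 0 = E 2 (p 0) 0 from hf 2,
    show e.Zt p 0 = E 3 (p 0) 0 from hf 3, show e.W p 0 = E 0 (p 0) 0 from hf 0]
  simp only [quad_twistCoeff]
  linear_combination s * k0 - k1 + s * h1

/-- General position in terms of the adapted frame: the vector `a² Q + 2 a b R + b² P` spans the
intersection of the `α`-plane with the tangent space of the orbit, and its orthogonal complement in
that tangent space is spanned by `a Q + b R` and `a R + b P`. -/
theorem isGeneral_split (he : e.HasComponents U E) (hdet : ∀ t ∈ U, (compMatrix E t).det ≠ 0)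
    (hD : ∀ t ∈ U, splitFactor E t ≠ 0) {p : Pt 𝕜} (hp : p ∈ cyl U) {a b : 𝕜}
    (hab : a ≠ 0 ∨ b ≠ 0) (hg : e.GenericAt p a b) :
    IsGeneral (splitP E (p 0)) (splitQ E (p 0)) (splitR E (p 0)) a b := by
  have hp' : p 0 ∈ U := hp
  have hd : (e.frameMatrix p).det ≠ 0 := by
    rw [he.det_frameMatrix hp]
    exact mul_ne_zero (exp_ne_zero' _) (hdet _ hp)
  have hf : ∀ c, e.frame c p = lift p (E c (p 0)) := fun c => he c p hp
  have hD' := hD _ hp'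
  have hdet' := hdet _ hp'
  have hdetS : (compMatrix (splitFrame E) (p 0)).det ≠ 0 := by
    rw [det_compMatrix_splitFrame]
    exact mul_ne_zero (pow_ne_zero _ hD') hdet'
  obtain ⟨t, ht⟩ : ∃ t, t = p 0 := ⟨_, rfl⟩
  rw [← ht] at hf hD' hdet' hdetS ⊢
  set x := a ^ 2 • splitQ E t + (2 * a * b) • splitR E t + b ^ 2 • splitP E t with hx
  set p' := a * E 3 t 0 - b * E 0 t 0 with hp'
  set q' := a * E 1 t 0 - b * E 2 t 0 with hq'
  have hxE : x = ∑ c, ![b * q', a * p', -(b * p'), -(a * q')] c • E c t := by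
    simp only [hx, Fin.sum_univ_four, Matrix.cons_val, splitP, splitQ, splitR, splitFrame, hp', hq']
    module
  have hx0 : x 0 = 0 := by
    simp [hx, splitP, splitQ, splitR, splitFrame]
    ring
  have hX : lift p x ∈ Submodule.span 𝕜 {a • e.Zt p - b • e.W p, a • e.Wt p - b • e.Z p} := by
    refine Submodule.mem_span_pair.2 ⟨-q', p', ?_⟩
    rw [show e.Zt p = _ from hf 3, show e.W p = _ from hf 0, show e.Wt p = _ from hf 1,
      show e.Z p = _ from hf 2, hxE]
    simp only [← map_smul, ← map_sub, ← map_add]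
    congr 1
    simp only [Fin.sum_univ_four, Matrix.cons_val]
    module
  have hxne : lift p x ≠ 0 := by
    intro h0
    have h1 : x = 0 := lift_injective p (by rw [h0, map_zero])
    have h2 := Matrix.eq_zero_of_mulVec_eq_zero hdet' (v := ![b * q', a * p', -(b * p'), -(a * q')])
      (by rw [compMatrix_mulVec, ← hxE, h1])
    have i0 : b * q' = 0 := congrFun h2 0
    have i1 : a * p' = 0 := congrFun h2 1
    have i2 : b * p' = 0 := neg_eq_zero.1 (congrFun h2 2)
    have i3 : a * q' = 0 := neg_eq_zero.1 (congrFun h2 3)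
    have hpz : p' = 0 := hab.elim (fun h => (mul_eq_zero.1 i1).resolve_left h)
      fun h => (mul_eq_zero.1 i2).resolve_left h
    have hqz : q' = 0 := hab.elim (fun h => (mul_eq_zero.1 i3).resolve_left h)
      fun h => (mul_eq_zero.1 i0).resolve_left h
    have ja : a * splitFactor E t = 0 := by
      rw [splitFactor]
      linear_combination E 2 t 0 * hpz - E 0 t 0 * hqz
    have jb : b * splitFactor E t = 0 := by
      rw [splitFactor]
      linear_combination E 1 t 0 * hpz - E 3 t 0 * hqz
    exact hab.elim (fun h => mul_ne_zero h hD' ja) fun h => mul_ne_zero h hD' jb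
  obtain ⟨hg1, hg2⟩ := hg (lift p x) hX (by rw [lift_apply]; exact hx0) hxne
  have htwo : x 2 ≠ 0 := fun h2 => hg1 <| Submodule.mem_span_pair.2 ⟨x 1, x 3, by
    rw [leftField_zero_eq, leftField_two_eq, ← map_smul, ← map_smul, ← map_add]
    congr 1
    ext i
    fin_cases i <;> simp [hx0, h2]⟩
  refine ⟨htwo, fun hm => ?_⟩
  set y₁ := a • splitQ E t + b • splitR E t with hy₁
  set y₂ := a • splitR E t + b • splitP E t with hy₂
  have hxy : x = a • y₁ + b • y₂ := by
    rw [hx, hy₁, hy₂]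
    module
  -- the combination of `y₁`, `y₂` which is a multiple of `L₁`
  set v := y₂ 2 • y₁ - y₁ 2 • y₂ with hv
  have hvL : v = ![0, v 1, 0, 0] := by
    ext i
    fin_cases i
    · simp [hv, hy₁, hy₂, splitP, splitQ, splitR, splitFrame]
      ring
    · rfl
    · simp [hv]
      ring
    · simp [hv]
      linear_combination -hm
  have hvE : v = ∑ c, ![y₂ 2 * (b / 2 * E 1 t 0) - y₁ 2 * (a / 2 * E 1 t 0 - b * E 2 t 0),
      y₂ 2 * (a * E 3 t 0 - b / 2 * E 0 t 0) - y₁ 2 * (-(a / 2) * E 0 t 0),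
      y₂ 2 * (-(b / 2) * E 3 t 0) - y₁ 2 * (b * E 0 t 0 - a / 2 * E 3 t 0),
      y₂ 2 * (b / 2 * E 2 t 0 - a * E 1 t 0) - y₁ 2 * (a / 2 * E 2 t 0)] c • E c t := by
    rw [hv]
    generalize y₁ 2 = u₁
    generalize y₂ 2 = u₂
    simp only [hy₁, hy₂, Fin.sum_univ_four, Matrix.cons_val, splitP, splitQ, splitR, splitFrame]
    module
  have hco : ∀ {y c : Fin 4 → 𝕜}, y = ∑ i, c i • E i t → e.coords p (lift p y) = c := fun hy =>
    Tetrad.coords_eq hd (by rw [hy, map_sum]; simp only [map_smul, ← hf])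
  have hcx := hco hxE
  have hcv := hco hvE
  have hmet : e.metric p (lift p x) (lift p v) = 0 := by
    rw [Tetrad.metric, hcx, hcv]
    simp [Fin.sum_univ_four, eta, hp', hq']
    ring
  have hmet' : e.metric p (lift p x) (lift p v) = v 1 * e.metric p (lift p x) (leftField 0 p) := by
    have : lift p v = v 1 • leftField 0 p := by
      rw [leftField_zero_eq, ← map_smul]
      congr 1
      rw [hvL]
      simp
    have hc : e.coords p (v 1 • leftField 0 p) = v 1 • e.coords p (leftField 0 p) :=
      Matrix.mulVec_smul _ _ _
    rw [this]
    simp only [Tetrad.metric, hc, Pi.smul_apply, smul_eq_mul, Finset.mul_sum]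
    exact Finset.sum_congr rfl fun i _ => Finset.sum_congr rfl fun j _ => by ring
  have hv1 : v 1 = 0 := (mul_eq_zero.1 (hmet'.symm.trans hmet)).resolve_right hg2
  have hv0 : v = 0 := by
    rw [hvL, hv1]
    ext i
    fin_cases i <;> rfl
  -- `P`, `Q`, `R` are linearly independent
  have hS := Matrix.eq_zero_of_mulVec_eq_zero hdetS
    (v := ![y₁ 2 * b, y₂ 2 * a, -(1 / 2) * (y₂ 2 * b - y₁ 2 * a), 1 / 2 * (y₂ 2 * b - y₁ 2 * a)]) (by
      rw [compMatrix_mulVec, ← hv0, hv]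
      generalize y₁ 2 = u₁
      generalize y₂ 2 = u₂
      simp only [hy₁, hy₂, Fin.sum_univ_four, Matrix.cons_val, splitP, splitQ, splitR]
      module)
  have i0 : y₁ 2 * b = 0 := congrFun hS 0
  have i1 : y₂ 2 * a = 0 := congrFun hS 1
  have i2 : y₂ 2 * b - y₁ 2 * a = 0 := by
    have : 1 / 2 * (y₂ 2 * b - y₁ 2 * a) = 0 := congrFun hS 3
    linear_combination 2 * this
  have hxt : x 2 = a * y₁ 2 + b * y₂ 2 := by
    rw [hxy]
    rfl
  refine htwo ?_
  rcases hab with h | h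
  · have j : y₂ 2 = 0 := (mul_eq_zero.1 i1).resolve_right h
    rw [j] at i2 hxt
    rw [hxt]
    linear_combination -i2
  · have j : y₁ 2 = 0 := (mul_eq_zero.1 i0).resolve_right h
    rw [j] at i2 hxt
    rw [hxt]
    linear_combination i2

end

/-! ### Existence of the normal form -/

section

variable {𝕜 : Type*} [RCLike 𝕜] {U V : Set 𝕜} {T P Q R : 𝕜 → Fin 4 → 𝕜}
  {E E' : Fin 4 → 𝕜 → Fin 4 → 𝕜} {e : Tetrad 𝕜} {σ ρ θ : Fin 3 → 𝕜 → 𝕜} {t₀ : 𝕜}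

/-- Near `t₀` the conformal class of the frame with components `E` has the normal form. -/
def HasNormalForm (U : Set 𝕜) (t₀ : 𝕜) (E : Fin 4 → 𝕜 → Fin 4 → 𝕜) : Prop :=
  ∃ V : Set 𝕜, IsOpen V ∧ t₀ ∈ V ∧ V ⊆ U ∧
    ∃ (τ : 𝕜 → 𝕜) (T : VField 𝕜) (L : Fin 3 → VField 𝕜) (I : Set 𝕜) (F : 𝕜 → 𝕜) (c₁ c₂ : 𝕜),
      IsAdapted V τ T L ∧
      IsOpen I ∧ Set.MapsTo τ V I ∧ ContDiffOn 𝕜 ∞ F I ∧ IsAiryOn (deriv F) I ∧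
      (∃ (E' : Fin 4 → 𝕜 → Fin 4 → 𝕜) (w : 𝕜 → 𝕜),
        (normalTetrad c₁ c₂ F τ T L).HasComponents V E' ∧
        ContDiffOn 𝕜 ∞ w V ∧ (∀ t ∈ V, w t ≠ 0) ∧
        ∀ t ∈ V, ConformalFrames (fun a => E a t) (fun a => E' a t) (w t)) ∧
      (normalTetrad c₁ c₂ F τ T L).IsLaxPair (cyl V) (Tetrad.constCubic 0) (Tetrad.constCubic 1)

theorem HasNormalForm.of_conformalFrames {w : 𝕜 → 𝕜} (h : HasNormalForm U t₀ E')
    (hw : ContDiffOn 𝕜 ∞ w U) (hw0 : ∀ t ∈ U, w t ≠ 0)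
    (hE : ∀ t ∈ U, ConformalFrames (fun a => E a t) (fun a => E' a t) (w t)) :
    HasNormalForm U t₀ E := by
  obtain ⟨V, hV, ht, hVU, τ, T, L, I, F, c₁, c₂, h1, h2, h3, h4, h5, ⟨E'', w', k1, k2, k3, k4⟩,
    h6⟩ := h
  exact ⟨V, hV, ht, hVU, τ, T, L, I, F, c₁, c₂, h1, h2, h3, h4, h5,
    ⟨E'', fun t => w' t * w t, k1, k2.mul (hw.mono hVU),
      fun t ht => mul_ne_zero (k3 t ht) (hw0 t (hVU ht)),
      fun t ht => (hE t (hVU ht)).trans (k4 t ht)⟩, h6⟩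

theorem HasNormalForm.mono (h : HasNormalForm V t₀ E) (hVU : V ⊆ U) : HasNormalForm U t₀ E := by
  obtain ⟨V', hV', ht, hV, h⟩ := h
  exact ⟨V', hV', ht, hV.trans hVU, h⟩

theorem IsSplit.mono (h : IsSplit U T P Q R) (hV : V ⊆ U) : IsSplit V T P Q R where
  smooth_T := h.smooth_T.mono hV
  smooth_P := h.smooth_P.mono hV
  smooth_Q := h.smooth_Q.mono hV
  smooth_R := h.smooth_R.mono hV
  T_ne := fun t ht => h.T_ne t (hV ht)
  P_zero := fun t ht => h.P_zero t (hV ht)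
  Q_zero := fun t ht => h.Q_zero t (hV ht)
  R_zero := fun t ht => h.R_zero t (hV ht)

theorem IsSplit.inversion (h : IsSplit U T P Q R) : IsSplit U T Q P (-R) where
  smooth_T := h.smooth_T
  smooth_P := h.smooth_Q
  smooth_Q := h.smooth_P
  smooth_R := h.smooth_R.neg
  T_ne := h.T_ne
  P_zero := h.Q_zero
  Q_zero := h.P_zero
  R_zero := fun t ht => by simp [h.R_zero t ht]

theorem RedSys.mono (h : RedSys U T P Q R σ ρ θ) (hV : V ⊆ U) : RedSys V T P Q R σ ρ θ where
  smooth_σ := fun i => (h.smooth_σ i).mono hV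
  smooth_ρ := fun i => (h.smooth_ρ i).mono hV
  smooth_θ := fun i => (h.smooth_θ i).mono hV
  eqQ := fun t ht => h.eqQ t (hV ht)
  eqR := fun t ht => h.eqR t (hV ht)
  eqP := fun t ht => h.eqP t (hV ht)
  vert := fun t ht => h.vert t (hV ht)

/-- The normal form for tetrads satisfying the reduced equations. -/
theorem ReducedEqs.hasNormalForm (hV : IsOpen V) (hc : Convex ℝ V) (hs : IsSplit V T P Q R)
    (h : ReducedEqs V T P Q R) (hP2 : ∀ t ∈ V, P t 2 = 1)
    (hminor : ∀ t ∈ V, R t 2 * P t 3 - R t 3 * P t 2 ≠ 0) (ht₀ : t₀ ∈ V) :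
    HasNormalForm V t₀ (compOf T P Q R) := by
  obtain ⟨V', τ, L, I, F, c₁, c₂, hV', ht₀', hV'V, hA, hI, hτ, hF, hAiry, hfield⟩ :=
    h.exists_normalForm hV hc hs hP2 hminor ht₀
  have he : (normalTetrad c₁ c₂ F τ (invField T) L).HasComponents V' (compOf T P Q R) :=
    fun a p hp => tetradOf_frame rfl (hfield p hp).1 (hfield p hp).2.1 (hfield p hp).2.2 a
  refine ⟨V', hV', ht₀', hV'V, τ, invField T, L, I, F, c₁, c₂, hA, hI, hτ, hF, hAiry,
    ⟨compOf T P Q R, fun _ => 1, he, contDiffOn_const, fun _ _ => one_ne_zero,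
      fun t _ => ⟨1, fun a => ?_, by simp, by simp⟩⟩, ?_⟩
  · simp [Matrix.one_apply]
  · exact (isLaxPair_constCubic_iff hV' (hs.mono hV'V) he).2 fun t ht => h t (hV'V ht)

/-- The normal form near a point at which the quadruple zero is not the origin of the twistor
line. -/
theorem RedSys.hasNormalForm_of_ne_zero (hU : IsOpen U) (hs : IsSplit U T P Q R)
    (h : RedSys U T P Q R σ ρ θ)
    (hz : ∀ t ∈ U, ∃ a b, IsGeneralZero (fun i => σ i t) (fun i => ρ i t) (fun i => θ i t)
      (P t) (Q t) (R t) a b) (ht₀ : t₀ ∈ U) (hθ : θ 0 t₀ ≠ 0) :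
    HasNormalForm U t₀ (compOf T P Q R) := by
  have hopen : ∀ᶠ t in nhds t₀, t ∈ U ∧ θ 0 t ≠ 0 :=
    Filter.Eventually.and (hU.mem_nhds ht₀) (((h.smooth_θ 0).continuousOn.continuousAt
      (hU.mem_nhds ht₀)).eventually_ne hθ)
  obtain ⟨r, hr, hball⟩ := Metric.eventually_nhds_iff_ball.1 hopen
  set V := Metric.ball t₀ r
  have hVU : V ⊆ U := fun t ht => (hball t ht).1
  have hV : IsOpen V := Metric.isOpen_ball
  have hc : Convex ℝ V := convex_ball t₀ r
  have htV : t₀ ∈ V := Metric.mem_ball_self hr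
  refine HasNormalForm.mono ?_ hVU
  obtain ⟨ν, A, B, D, K, hν, hs₁, h₁⟩ := (h.mono hVU).exists_inftySys hV (hs.mono hVU)
    (fun t ht => (hball t ht).2) fun t ht => hz t (hVU ht)
  obtain ⟨g, κ, n, hg, hg0, hκ0, T', P', Q', R', hs', h', hP', hminor, heq⟩ :=
    h₁.exists_reducedEqs hV hc hs₁ htV
  exact ((h'.hasNormalForm hV hc hs' hP' hminor htV).of_conformalFrames (hg.pow 2)
    (fun t ht => pow_ne_zero _ (hg0 t ht)) fun t ht => conformalFrames_gauge (hκ0 t ht)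
      (heq t).1 (heq t).2.1 (heq t).2.2.1 (heq t).2.2.2).of_conformalFrames contDiffOn_const
    (fun _ _ => one_ne_zero) fun t _ => conformalFrames_translation ν t

theorem RedSys.hasNormalForm (hU : IsOpen U) (hs : IsSplit U T P Q R)
    (h : RedSys U T P Q R σ ρ θ)
    (hz : ∀ t ∈ U, ∃ a b, IsGeneralZero (fun i => σ i t) (fun i => ρ i t) (fun i => θ i t)
      (P t) (Q t) (R t) a b) (ht₀ : t₀ ∈ U) : HasNormalForm U t₀ (compOf T P Q R) := by
  by_cases hθ : θ 0 t₀ = 0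
  · -- the zero is the origin, which the inversion exchanges with the point at infinity
    refine (h.inversion.hasNormalForm_of_ne_zero hU hs.inversion (fun t ht => ?_) ht₀ ?_
      ).of_conformalFrames contDiffOn_const (fun _ _ => one_ne_zero)
        fun t _ => conformalFrames_inversion t
    · obtain ⟨a, b, hab⟩ := hz t ht
      refine ⟨b, -a, ?_⟩
      convert hab.inversion using 1 <;> funext i <;> fin_cases i <;> rfl
    · obtain ⟨a, b, hab⟩ := hz t₀ ht₀
      obtain ⟨k, hk, k0, -, -, -, k4⟩ := hab.coeff
      have hb : b = 0 := by
        rw [hθ, neg_zero] at k0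
        exact pow_eq_zero_iff (by norm_num) |>.1 ((mul_eq_zero.1 k0.symm).resolve_left hk)
      have ha : a ≠ 0 := hab.ne_zero.resolve_right (not_not.2 hb)
      change -σ 2 t₀ ≠ 0
      rw [k4]
      exact neg_ne_zero.2 (mul_ne_zero hk (pow_ne_zero _ ha))
  · exact h.hasNormalForm_of_ne_zero hU hs hz ht₀ hθ

/-- The components of a smooth invariant tetrad. -/
theorem Tetrad.IsInvariantTetrad.exists_components (h : e.IsInvariantTetrad U) :
    ∃ E : Fin 4 → 𝕜 → Fin 4 → 𝕜, e.HasComponents U E ∧ (∀ a, ContDiffOn 𝕜 ∞ (E a) U) ∧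
      (∀ t ∈ U, (compMatrix E t).det ≠ 0) ∧ ∀ t ∈ U, splitFactor E t ≠ 0 := by
  have he : e.HasComponents U (fun a t => e.frame a ![t, 0, 0, 0]) :=
    fun a => (h.invariant a).eq_invField
  refine ⟨_, he, fun a => ?_, fun t ht => ?_, fun t ht => ?_⟩
  · refine (h.smooth a).comp (contDiff_pi.2 fun i => ?_).contDiffOn fun t ht => ht
    fin_cases i
    exacts [contDiff_id, contDiff_const, contDiff_const, contDiff_const]
  · have hp : (![t, 0, 0, 0] : Pt 𝕜) ∈ cyl U := ht
    have h1 := (Matrix.linearIndependent_cols_iff_isUnit (A := e.frameMatrix ![t, 0, 0, 0])).1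
      (h.indep _ hp)
    rw [Matrix.isUnit_iff_isUnit_det, isUnit_iff_ne_zero, he.det_frameMatrix hp] at h1
    exact right_ne_zero_of_mul h1
  · have h1 := h.nonnull ![t, 0, 0, 0] ht
    contrapose! h1
    simp only [splitFactor, Tetrad.frame, Matrix.cons_val] at h1
    simp only [Tetrad.cometric, LinearMap.proj_apply]
    linear_combination 2 * h1

/-- An invariant anti-self-dual class in general position whose quartic has a quadruple zero is
locally in the normal form. -/
theorem exists_normalTetrad (hU : IsOpen U) (he : e.IsInvariantTetrad U) (hasd : e.IsASD (cyl U))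
    (hz : ∀ f₀ f₁ : Fin 4 → Pt 𝕜 → 𝕜, e.IsLaxPair (cyl U) f₀ f₁ →
      ∀ p ∈ cyl U, ∃ a b : 𝕜, e.QuadrupleZeroAt f₀ f₁ p a b ∧ e.GenericAt p a b) (ht₀ : t₀ ∈ U) :
    ∃ V : Set 𝕜, IsOpen V ∧ t₀ ∈ V ∧ V ⊆ U ∧
      ∃ (τ : 𝕜 → 𝕜) (T : VField 𝕜) (L : Fin 3 → VField 𝕜) (I : Set 𝕜) (F : 𝕜 → 𝕜) (c₁ c₂ : 𝕜),
        IsAdapted V τ T L ∧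
        IsOpen I ∧ Set.MapsTo τ V I ∧ ContDiffOn 𝕜 ∞ F I ∧ IsAiryOn (deriv F) I ∧
        e.SameConformal (normalTetrad c₁ c₂ F τ T L) (cyl V) ∧
        (normalTetrad c₁ c₂ F τ T L).IsLaxPair (cyl V) (Tetrad.constCubic 0)
          (Tetrad.constCubic 1) := by
  obtain ⟨E, hE, hsm, hdet, hD⟩ := he.exists_components
  have hs := isSplit_split hsm hD
  have hdet' : ∀ t ∈ U, (compMatrix (splitFrame E) t).det ≠ 0 := fun t ht => by
    rw [det_compMatrix_splitFrame]
    exact mul_ne_zero (pow_ne_zero _ (hD t ht)) (hdet t ht)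
  have hred := redSys_of_vertDefect hU hs (by rwa [compOf_split]) fun t ht s => by
    rw [compOf_split]
    exact vertDefect_splitFrame hU hsm hdet hD ht s (hE.vertDefect_eq_zero hU hsm hdet hasd ht s)
  rw [compOf_split] at hred
  have hnf := hred.hasNormalForm hU hs (fun t ht => by
    have hp : (![t, 0, 0, 0] : Pt 𝕜) ∈ cyl U := ht
    obtain ⟨a, b, ⟨hab, k, hk, hq⟩, hg⟩ := hz _ _ (hE.isLaxPair hU hsm hdet hasd) _ hp
    have hd : (e.frameMatrix ![t, 0, 0, 0]).det ≠ 0 := by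
      rw [hE.det_frameMatrix hp]
      exact mul_ne_zero (exp_ne_zero' _) (hdet t ht)
    refine ⟨a, b, hab, ⟨-(e.frameMatrix ![t, 0, 0, 0]).det * k,
      mul_ne_zero (neg_ne_zero.2 hd) hk, fun s => ?_⟩, isGeneral_split hE hdet hD hp hab hg⟩
    exact (quartic_split hU hE hsm hdet hD hp s).trans (by rw [hq s, mul_assoc])) ht₀
  rw [compOf_split] at hnf
  have hw : ContDiffOn 𝕜 ∞ (splitFactor E) U :=
    ((contDiffOn_apply (hsm 2) 0).mul (contDiffOn_apply (hsm 3) 0)).sub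
      ((contDiffOn_apply (hsm 0) 0).mul (contDiffOn_apply (hsm 1) 0))
  obtain ⟨V, hV, ht, hVU, τ, T, L, I, F, c₁, c₂, h1, h2, h3, h4, h5, ⟨E', w, k1, k2, k3, k4⟩, h6⟩ :=
    hnf.of_conformalFrames hw hD fun t _ => conformalFrames_splitFrame E t
  exact ⟨V, hV, ht, hVU, τ, T, L, I, F, c₁, c₂, h1, h2, h3, h4, h5,
    Tetrad.HasComponents.sameConformal (fun a p hp => hE a p (hVU hp)) k1 k2 k3 k4, h6⟩

end

end BianchiAiry

end

open BianchiAiry in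
theorem theorem2 (𝕜 : Type*) [RCLike 𝕜] :
    -- every general invariant ASD conformal class whose quartic has a quadruple zero
    -- is locally in the normal form
    (∀ (U : Set 𝕜) (e : Tetrad 𝕜), IsOpen U →
      e.IsInvariantTetrad U →
      e.IsASD (cyl U) →
      (∀ f₀ f₁ : Fin 4 → Pt 𝕜 → 𝕜, e.IsLaxPair (cyl U) f₀ f₁ →
        ∀ p ∈ cyl U, ∃ a b : 𝕜, e.QuadrupleZeroAt f₀ f₁ p a b ∧ e.GenericAt p a b) →
      ∀ t₀ ∈ U, ∃ V : Set 𝕜, IsOpen V ∧ t₀ ∈ V ∧ V ⊆ U ∧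
        ∃ (τ : 𝕜 → 𝕜) (T : VField 𝕜) (L : Fin 3 → VField 𝕜) (I : Set 𝕜) (F : 𝕜 → 𝕜) (c₁ c₂ : 𝕜),
          IsAdapted V τ T L ∧
          IsOpen I ∧ Set.MapsTo τ V I ∧ ContDiffOn 𝕜 ∞ F I ∧ IsAiryOn (deriv F) I ∧
          e.SameConformal (normalTetrad c₁ c₂ F τ T L) (cyl V) ∧
          (normalTetrad c₁ c₂ F τ T L).IsLaxPair (cyl V) (Tetrad.constCubic 0)
            (Tetrad.constCubic 1)) ∧
    -- for the normal form, integrability with `f₀ = 0`, `f₁ = 1` is equivalent to the reduced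
    -- equations, and these are equivalent to the Airy equation
    (∀ (U : Set 𝕜) (F : 𝕜 → 𝕜) (c₁ c₂ : 𝕜), IsOpen U → ContDiffOn 𝕜 ∞ F U →
      ((normalTetrad c₁ c₂ F id dtField leftField).IsLaxPair (cyl U) (Tetrad.constCubic 0)
          (Tetrad.constCubic 1) ↔
        ReducedASD U (fieldP F id leftField) (fieldQ c₁ c₂ F id leftField)
          (fieldR c₁ F id leftField)) ∧
      (ReducedASD U (fieldP F id leftField) (fieldQ c₁ c₂ F id leftField)
          (fieldR c₁ F id leftField) ↔
        IsAiryOn (deriv F) U)) ∧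
    -- conversely, every solution gives such a conformal class, the quartic vanishing at infinity
    (∀ (U : Set 𝕜) (F : 𝕜 → 𝕜) (c₁ c₂ : 𝕜), IsOpen U → ContDiffOn 𝕜 ∞ F U →
      IsAiryOn (deriv F) U →
      (∀ t ∈ U, deriv (deriv F) t + (c₁ - c₂ / 2) * deriv F t ≠ 0) →
      (normalTetrad c₁ c₂ F id dtField leftField).IsInvariantTetrad U ∧
      (normalTetrad c₁ c₂ F id dtField leftField).IsASD (cyl U) ∧
      (normalTetrad c₁ c₂ F id dtField leftField).IsLaxPair (cyl U) (Tetrad.constCubic 0)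
        (Tetrad.constCubic 1) ∧
      ∀ p ∈ cyl U,
        (normalTetrad c₁ c₂ F id dtField leftField).QuadrupleZeroAt
          (Tetrad.constCubic 0) (Tetrad.constCubic 1) p 0 1 ∧
        (normalTetrad c₁ c₂ F id dtField leftField).GenericAt p 0 1) := by
  refine ⟨?_, fun U F c₁ c₂ hU hF => ⟨?_, ?_⟩, fun U F c₁ c₂ hU hF hA hdet => ⟨?_, ?_, ?_, ?_⟩⟩
  · exact fun U e hU he hasd hz t₀ ht₀ => exists_normalTetrad hU he hasd hz ht₀
  · exact (isLaxPair_normalTetrad_iff hU hF c₁ c₂).trans (reducedASD_iff hU hF c₁ c₂).symm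
  · exact (reducedASD_iff hU hF c₁ c₂).trans (reducedEqs_iff_isAiryOn hU hF c₁ c₂)
  · exact isInvariantTetrad_normalTetrad hU hF hdet
  · exact isASD_normalTetrad hU hF hA hdet
  · exact (isLaxPair_normalTetrad_iff hU hF c₁ c₂).2 ((reducedEqs_iff_isAiryOn hU hF c₁ c₂).2 hA)
  · exact fun p hp => ⟨quadrupleZeroAt_normalTetrad hdet hp, genericAt_normalTetrad hdet hp⟩
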